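/- Let $p$ be a prime, $\overline{\mathbb{Q}}_p$ an algebraic closure of $\mathbb{Q}_p$, $\mathbb{C}_p$ its completion, $K\subset\overline{\mathbb{Q}}_p$ a finite extension of $\mathbb{Q}_p$, $K_\infty=K(\mu_{p^\infty})$ and $H_K=\mathrm{Gal}(\overline{\mathbb{Q}}_p/K_\infty)$. Let $A_{\inf}=W(\mathcal{O}_{\mathbb{C}_p}^\flat)$ with its Galois action. Fix a compatible system $\varepsilon=(1,\varepsilon^{(1)},\varepsilon^{(2)},\dots)$ of $p$-power roots of unity with $\varepsilon^{(1)}\neq1$, regarded as an element of $\mathcal{O}_{\mathbb{C}_p}^\flat$, and put $\overline\pi=\varepsilon-1$. The rings $A_{\inf}$ and $A_{\inf}^{H_K}$ carry the $(p,[\overline\pi])$-adic topology; $H_K$ fixes $\overline\pi$ and its $p$-power roots. Let $R$ be a pseudoaffinoid $\mathbb{Z}_p$-algebra, that is, a complete separated Tate $\mathbb{Z}_p$-algebra that has a ring of definition formally of finite type over $\mathbb{Z}_p$. Let $R_0\subset R$ be a noetherian ring of definition formally of finite type over $\mathbb{Z}_p$, and let $u\in R_0$ be a pseudo-uniformizer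 of $R$. For $A=A_{\inf}$ or $A=A_{\inf}^{H_K}$ let $R_0\widehat\otimes A$ be the $(u,p,[\overline\pi])$-adic completion of $R_0\otimes_{\mathbb{Z}_p}A$. Let $a\le b$ be positive rational numbers such that $s(a)=\frac{p-1}{pa}$ and $s(b)=\frac{p-1}{pb}$ are both integral powers (with exponents in $\mathbb{Z}$) of $p$; for $s\in p^{\mathbb{Z}}$ write $[\overline\pi]^{s}=[\overline\pi^{s}]$, where $\overline\pi^{s}$ is formed in the perfect ring $\mathcal{O}_{\mathbb{C}_p}^\flat$. For $B=R_0\widehat\otimes A$ let $B\left\langle\frac{u}{[\overline\pi]^{s(b)}},\frac{[\overline\pi]^{s(a)}}{u}\right\rangle$ be the $u$-adic completion of the subring $B\left[\frac{u}{[\overline\pi]^{s(b)}},\frac{[\overline\pi]^{s(a)}}{u}\right]$ of $B\left[\frac{1}{u[\overline\pi]^{s(b)}}\right]$, and put $$\widetilde\Lambda_{R_0,[a,b]}=(R_0\widehat\otimes A_{\inf})\left\langle\frac{u}{[\overline\pi]^{s(b)}},\frac{[\overline\pi]^{s(a)}}{u}\right\rangle\left[\frac1u\right],$$ with the action of $H_K$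 induced by its action on $A_{\inf}$. Then $$\widetilde\Lambda_{R_0,[a,b]}^{H_K}=(R_0\widehat\otimes A_{\inf}^{H_K})\left\langle\frac{u}{[\overline\pi]^{s(b)}},\frac{[\overline\pi]^{s(a)}}{u}\right\rangle\left[\frac1u\right];$$ that is, the natural ring homomorphism from the right-hand side to $\widetilde\Lambda_{R_0,[a,b]}$, induced by $A_{\inf}^{H_K}\subset A_{\inf}$, is injective and its image is the subring of $H_K$-invariants. -/

import Mathlib

open scoped TensorProduct

noncomputable section

namespace Period

/-! ## The ring `A_inf` and the Galois action on it -/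

/-- Automorphisms of `ℚ̄_p` over `ℚ_p` are isometries. -/
theorem isometry_gal (p : ℕ) [Fact p.Prime] (σ : PadicAlgCl p ≃ₐ[ℚ_[p]] PadicAlgCl p) :
    Isometry (σ : PadicAlgCl p → PadicAlgCl p) :=
  AddMonoidHomClass.isometry_of_norm σ fun x => (spectralNorm_eq_of_equiv σ x).symm

/-- The Galois action on `ℂ_p`: the extension by continuity of an automorphism of `ℚ̄_p`. -/
def galC (p : ℕ) [Fact p.Prime] (σ : PadicAlgCl p ≃ₐ[ℚ_[p]] PadicAlgCl p) :
    ℂ_[p] →+* ℂ_[p] :=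
  UniformSpace.Completion.mapRingHom (σ : PadicAlgCl p →+* PadicAlgCl p)
    (isometry_gal p σ).continuous

theorem galC_coe (p : ℕ) [Fact p.Prime] (σ : PadicAlgCl p ≃ₐ[ℚ_[p]] PadicAlgCl p)
    (x : PadicAlgCl p) : galC p σ (x : ℂ_[p]) = ((σ x : PadicAlgCl p) : ℂ_[p]) :=
  UniformSpace.Completion.mapRingHom_coe (f := (σ : PadicAlgCl p →+* PadicAlgCl p))
    (isometry_gal p σ).continuous x

theorem norm_galC (p : ℕ) [Fact p.Prime] (σ : PadicAlgCl p ≃ₐ[ℚ_[p]] PadicAlgCl p)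
    (x : ℂ_[p]) : ‖galC p σ x‖ = ‖x‖ :=
  AddMonoidHomClass.isometry_iff_norm (galC p σ) |>.1 (isometry_gal p σ).completion_map x

theorem mem_int_iff (p : ℕ) [Fact p.Prime] (x : ℂ_[p]) : x ∈ 𝓞_ℂ_[p] ↔ ‖x‖ ≤ 1 := by
  rw [PadicComplex.norm_eq_norm]
  exact (Valued.toNormedField.norm_le_one_iff (x := x)).symm

/-- The Galois action on `𝒪_{ℂ_p}`. -/
def galInt (p : ℕ) [Fact p.Prime] (σ : PadicAlgCl p ≃ₐ[ℚ_[p]] PadicAlgCl p) :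
    𝓞_ℂ_[p] →+* 𝓞_ℂ_[p] :=
  ((galC p σ).comp (𝓞_ℂ_[p]).subtype).codRestrict (𝓞_ℂ_[p]).toSubring fun x =>
    (mem_int_iff p _).2 ((norm_galC p σ x).le.trans ((mem_int_iff p _).1 x.2))

instance not_isUnit_p (p : ℕ) [Fact p.Prime] : Fact (¬ IsUnit ((p : ℕ) : 𝓞_ℂ_[p])) :=
  ⟨fun h => by
    have h1 := (PadicComplexInt.integers p).valuation_unit h.unit
    have h2 : (PadicComplex.valued p).v (p : ℂ_[p]) = 1 := by simpa using h1
    rw [PadicComplex.valuation_p] at h2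
    have h3 : (p : NNReal) = 1 := by simpa using h2
    exact (Fact.out : p.Prime).one_lt.ne' (by exact_mod_cast h3)⟩

/-- `𝒪_{ℂ_p}^♭`. -/
abbrev OFlat (p : ℕ) [Fact p.Prime] : Type := PreTilt 𝓞_ℂ_[p] p

/-- The Galois action on `𝒪_{ℂ_p}^♭`. -/
def galFlat (p : ℕ) [Fact p.Prime] (σ : PadicAlgCl p ≃ₐ[ℚ_[p]] PadicAlgCl p) :
    OFlat p →+* OFlat p :=
  Perfection.map p (Ideal.quotientMap (Ideal.span {((p : ℕ) : 𝓞_ℂ_[p])}) (galInt p σ) (by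
    rw [Ideal.span_singleton_le_iff_mem, Ideal.mem_comap, map_natCast]
    exact Ideal.mem_span_singleton_self _))

/-- `A_inf = W(𝒪_{ℂ_p}^♭)`. -/
def AInf (p : ℕ) [Fact p.Prime] : Type := WittVector p (OFlat p)

instance (p : ℕ) [Fact p.Prime] : CommRing (AInf p) :=
  inferInstanceAs (CommRing (WittVector p (OFlat p)))

/-- The `ℤ_p`-algebra structure of `A_inf`: `ℤ_p = W(𝔽_p) → W(𝒪_{ℂ_p}^♭)`. -/
instance (p : ℕ) [Fact p.Prime] : Algebra ℤ_[p] (AInf p) :=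
  RingHom.toAlgebra
    ((WittVector.map (ZMod.castHom dvd_rfl (OFlat p))).comp
      (WittVector.equiv p).symm.toRingHom : ℤ_[p] →+* WittVector p (OFlat p))

/-- The Galois action on `A_inf`. -/
def galAInf (p : ℕ) [Fact p.Prime] (σ : PadicAlgCl p ≃ₐ[ℚ_[p]] PadicAlgCl p) :
    AInf p →ₐ[ℤ_[p]] AInf p where
  __ := (WittVector.map (galFlat p σ) : WittVector p (OFlat p) →+* WittVector p (OFlat p))
  commutes' r := by
    change WittVector.map (galFlat p σ) (WittVector.map (ZMod.castHom dvd_rfl (OFlat p)) _) =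
      WittVector.map (ZMod.castHom dvd_rfl (OFlat p)) _
    ext n
    rw [WittVector.map_coeff, WittVector.map_coeff, ← RingHom.comp_apply,
      Subsingleton.elim ((galFlat p σ).comp (ZMod.castHom dvd_rfl (OFlat p)))]

/-! ## The element `π̄`, and the group `H_K` -/

/-- A compatible system `ε = (1, ε⁽¹⁾, ε⁽²⁾, …)` of `p`-power roots of unity, `ε⁽¹⁾ ≠ 1`. -/
structure RootSystem (p : ℕ) [Fact p.Prime] where
  root : ℕ → PadicAlgCl p
  root_zero : root 0 = 1
  root_succ : ∀ n, root (n + 1) ^ p = root n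
  root_one : root 1 ≠ 1

theorem RootSystem.pow_eq_one {p : ℕ} [Fact p.Prime] (ε : RootSystem p) (n : ℕ) :
    ε.root n ^ p ^ n = 1 := by
  induction n with
  | zero => simp [ε.root_zero]
  | succ n ih => rw [pow_succ', pow_mul, ε.root_succ, ih]

/-- The roots of unity `ε⁽ⁿ⁾` as elements of `𝒪_{ℂ_p}`. -/
def RootSystem.int {p : ℕ} [Fact p.Prime] (ε : RootSystem p) (n : ℕ) : 𝓞_ℂ_[p] :=
  ⟨(ε.root n : ℂ_[p]), (mem_int_iff p _).2 <| by
    rw [PadicComplex.norm_extends]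
    refine (pow_eq_one_iff_of_nonneg (norm_nonneg _)
      (pow_ne_zero n (Fact.out : p.Prime).ne_zero)).1 ?_ |>.le
    rw [← norm_pow, ε.pow_eq_one, norm_one]⟩

/-- `ε` as an element of `𝒪_{ℂ_p}^♭`. -/
def RootSystem.flat {p : ℕ} [Fact p.Prime] (ε : RootSystem p) : OFlat p :=
  (⟨fun n => Ideal.Quotient.mk _ (ε.int n), fun n => by
    rw [← map_pow]
    congr 1
    apply Subtype.ext
    change (ε.root (n + 1) : ℂ_[p]) ^ p = (ε.root n : ℂ_[p])
    rw [PadicComplex.coe_eq, PadicComplex.coe_eq, ← map_pow, ε.root_succ]⟩ :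
    Perfection (ModP 𝓞_ℂ_[p] p) p)

/-- `π̄ ^ (p ^ n)` in the perfect ring `𝒪_{ℂ_p}^♭`, for `n ∈ ℤ`, where `π̄ = ε - 1`. -/
def RootSystem.piBar {p : ℕ} [Fact p.Prime] (ε : RootSystem p) (n : ℤ) : OFlat p :=
  ((frobeniusEquiv (OFlat p) p : RingAut (OFlat p)) ^ n) (ε.flat - 1)

/-- The Teichmüller lift `[π̄] ^ (p ^ n) = [π̄ ^ (p ^ n)]`, for `n ∈ ℤ`. -/
def RootSystem.teich {p : ℕ} [Fact p.Prime] (ε : RootSystem p) (n : ℤ) : AInf p :=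
  WittVector.teichmuller p (ε.piBar n)

/-- `K_∞ = K(μ_{p^∞})`. -/
def KInf (p : ℕ) [Fact p.Prime] (K : IntermediateField ℚ_[p] (PadicAlgCl p)) :
    IntermediateField ℚ_[p] (PadicAlgCl p) :=
  K ⊔ IntermediateField.adjoin ℚ_[p] {z | ∃ n : ℕ, z ^ p ^ n = 1}

/-- `H_K = Gal(ℚ̄_p / K_∞)`. -/
def HK (p : ℕ) [Fact p.Prime] (K : IntermediateField ℚ_[p] (PadicAlgCl p)) :
    Subgroup (PadicAlgCl p ≃ₐ[ℚ_[p]] PadicAlgCl p) :=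
  (KInf p K).fixingSubgroup

theorem galFlat_flat {p : ℕ} [Fact p.Prime] {K : IntermediateField ℚ_[p] (PadicAlgCl p)}
    (ε : RootSystem p) {σ : PadicAlgCl p ≃ₐ[ℚ_[p]] PadicAlgCl p} (hσ : σ ∈ HK p K) :
    galFlat p σ ε.flat = ε.flat := by
  refine Perfection.ext fun n => ?_
  refine congrArg (Ideal.Quotient.mk _) (Subtype.ext ?_)
  change galC p σ (ε.root n : ℂ_[p]) = (ε.root n : ℂ_[p])
  rw [galC_coe]
  congr 1
  have hmem : ε.root n ∈ KInf p K :=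
    (le_sup_right : _ ≤ KInf p K)
      (IntermediateField.subset_adjoin _ _ ⟨n, ε.pow_eq_one n⟩)
  exact (IntermediateField.mem_fixingSubgroup_iff _ _).1 hσ _ hmem

theorem galFlat_zpow {p : ℕ} [Fact p.Prime] (σ : PadicAlgCl p ≃ₐ[ℚ_[p]] PadicAlgCl p)
    (n : ℤ) (x : OFlat p) :
    galFlat p σ (((frobeniusEquiv (OFlat p) p : RingAut (OFlat p)) ^ n) x) =
      ((frobeniusEquiv (OFlat p) p : RingAut (OFlat p)) ^ n) (galFlat p σ x) := by
  have key : ∀ y, galFlat p σ (frobeniusEquiv (OFlat p) p y) =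
      frobeniusEquiv (OFlat p) p (galFlat p σ y) := fun y => by
    simp [frobeniusEquiv_apply, frobenius_def]
  induction n generalizing x with
  | zero => simp
  | succ n ih =>
    rw [zpow_add_one, RingAut.mul_apply, ih, key, ← RingAut.mul_apply]
  | pred n ih =>
    rw [zpow_sub_one, RingAut.mul_apply, ih, RingAut.mul_apply]
    congr 1
    apply (frobeniusEquiv (OFlat p) p).injective
    rw [← key]
    simp [RingAut.inv_apply]

theorem galAInf_teich {p : ℕ} [Fact p.Prime] {K : IntermediateField ℚ_[p] (PadicAlgCl p)}
    (ε : RootSystem p) {σ : PadicAlgCl p ≃ₐ[ℚ_[p]] PadicAlgCl p} (hσ : σ ∈ HK p K) (n : ℤ) :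
    galAInf p σ (ε.teich n) = ε.teich n := by
  change WittVector.map (galFlat p σ) (WittVector.teichmuller p (ε.piBar n)) = _
  rw [WittVector.map_teichmuller, RootSystem.piBar, galFlat_zpow, map_sub, map_one,
    galFlat_flat ε hσ]
  rfl

/-- The ring of invariants `A_inf^{H_K}`. -/
def AInfHK (p : ℕ) [Fact p.Prime] (K : IntermediateField ℚ_[p] (PadicAlgCl p)) :
    Subalgebra ℤ_[p] (AInf p) :=
  ⨅ σ ∈ HK p K, AlgHom.equalizer (galAInf p σ) (AlgHom.id ℤ_[p] (AInf p))

theorem mem_AInfHK {p : ℕ} [Fact p.Prime] {K : IntermediateField ℚ_[p] (PadicAlgCl p)}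
    {x : AInf p} : x ∈ AInfHK p K ↔ ∀ σ ∈ HK p K, galAInf p σ x = x := by
  simp [AInfHK, Algebra.mem_iInf, AlgHom.mem_equalizer]

/-- `[π̄] ^ (p ^ n)` as an element of `A_inf^{H_K}`. -/
def RootSystem.teichHK {p : ℕ} [Fact p.Prime] (ε : RootSystem p)
    (K : IntermediateField ℚ_[p] (PadicAlgCl p)) (n : ℤ) : AInfHK p K :=
  ⟨ε.teich n, mem_AInfHK.2 fun _ hσ => galAInf_teich ε hσ n⟩

/-- The ideal `(p, [π̄])` of `A_inf`, which defines its topology. -/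
def RootSystem.ideal {p : ℕ} [Fact p.Prime] (ε : RootSystem p) : Ideal (AInf p) :=
  Ideal.span {(p : AInf p), ε.teich 0}

/-- The ideal `(p, [π̄])` of `A_inf^{H_K}`, which defines its topology. -/
def RootSystem.idealHK {p : ℕ} [Fact p.Prime] (ε : RootSystem p)
    (K : IntermediateField ℚ_[p] (PadicAlgCl p)) : Ideal (AInfHK p K) :=
  Ideal.span {(p : AInfHK p K), ε.teichHK K 0}

/-! ## Completed tensor products and rational localizations -/

theorem adicMap_aux {S S' : Type*} [CommRing S] [CommRing S'] {I : Ideal S} {I' : Ideal S'}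
    (f : S →+* S') (h : I.map f ≤ I') (n : ℕ) : I ^ n ≤ (I' ^ n).comap f := by
  rw [← Ideal.map_le_iff_le_comap, Ideal.map_pow]
  exact Ideal.pow_right_mono h n

theorem adicMap_compat {S S' : Type*} [CommRing S] [CommRing S'] {I : Ideal S} {I' : Ideal S'}
    (f : S →+* S') (h : I.map f ≤ I') {m n : ℕ} (hle : m ≤ n) :
    (Ideal.Quotient.factorPow I' hle).comp
      ((Ideal.quotientMap (I' ^ n) f (adicMap_aux f h n)).comp
        (AdicCompletion.evalₐ I n : AdicCompletion I S →+* S ⧸ I ^ n)) =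
      (Ideal.quotientMap (I' ^ m) f (adicMap_aux f h m)).comp
        (AdicCompletion.evalₐ I m : AdicCompletion I S →+* S ⧸ I ^ m) := by
  refine RingHom.ext fun x => ?_
  obtain ⟨y, rfl⟩ := AdicCompletion.mk_surjective I S x
  rw [RingHom.comp_apply, RingHom.comp_apply, RingHom.comp_apply, RingHom.coe_coe,
    RingHom.coe_coe, AdicCompletion.evalₐ_mk, AdicCompletion.evalₐ_mk,
    ← AdicCompletion.Ideal.mk_eq_mk I hle y]
  rfl

/-- Functoriality of adic completions of rings: the limit of the maps `S / Iⁿ → S' / I'ⁿ`. -/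
def adicMap {S S' : Type*} [CommRing S] [CommRing S'] {I : Ideal S} {I' : Ideal S'}
    (f : S →+* S') (h : I.map f ≤ I') : AdicCompletion I S →+* AdicCompletion I' S' :=
  AdicCompletion.liftRingHom I'
    (fun n => (Ideal.quotientMap (I' ^ n) f (adicMap_aux f h n)).comp
      (AdicCompletion.evalₐ I n : AdicCompletion I S →+* S ⧸ I ^ n))
    (adicMap_compat f h)

theorem adicMap_algebraMap {S S' : Type*} [CommRing S] [CommRing S'] {I : Ideal S}
    {I' : Ideal S'} (f : S →+* S') (h : I.map f ≤ I') (x : S) :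
    adicMap f h (algebraMap S _ x) = algebraMap S' (AdicCompletion I' S') (f x) := by
  refine AdicCompletion.ext_evalₐ fun n => ?_
  rw [adicMap, AdicCompletion.evalₐ_liftRingHom _ _ (adicMap_compat f h)]
  simp

/-- The ideal `(u, J)` of `R₀ ⊗ A`. -/
def tensorIdeal (p : ℕ) [Fact p.Prime] {R₀ A : Type*} [CommRing R₀] [Algebra ℤ_[p] R₀]
    [CommRing A] [Algebra ℤ_[p] A] (u : R₀) (J : Ideal A) : Ideal (R₀ ⊗[ℤ_[p]] A) :=
  Ideal.span {u ⊗ₜ[ℤ_[p]] (1 : A)} ⊔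
    J.map (Algebra.TensorProduct.includeRight : A →ₐ[ℤ_[p]] R₀ ⊗[ℤ_[p]] A)

/-- The completed tensor product `R₀ ⊗̂_{ℤ_p} A`, where `R₀` has the `u`-adic and `A` has the
`J`-adic topology. -/
abbrev CTensor (p : ℕ) [Fact p.Prime] {R₀ A : Type*} [CommRing R₀] [Algebra ℤ_[p] R₀]
    [CommRing A] [Algebra ℤ_[p] A] (u : R₀) (J : Ideal A) : Type _ :=
  AdicCompletion (tensorIdeal p u J) (R₀ ⊗[ℤ_[p]] A)

/-- The element `r ⊗ x` of `R₀ ⊗̂ A`. -/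
def ctmul (p : ℕ) [Fact p.Prime] {R₀ A : Type*} [CommRing R₀] [Algebra ℤ_[p] R₀]
    [CommRing A] [Algebra ℤ_[p] A] (u : R₀) (J : Ideal A) (r : R₀) (x : A) : CTensor p u J :=
  algebraMap (R₀ ⊗[ℤ_[p]] A) (CTensor p u J) (r ⊗ₜ[ℤ_[p]] x)

theorem tensorIdeal_map (p : ℕ) [Fact p.Prime] {R₀ A A' : Type*} [CommRing R₀]
    [Algebra ℤ_[p] R₀] [CommRing A] [Algebra ℤ_[p] A] [CommRing A'] [Algebra ℤ_[p] A']
    (u : R₀) {J : Ideal A} {J' : Ideal A'} (f : A →ₐ[ℤ_[p]] A') (hJ : J.map f ≤ J') :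
    (tensorIdeal p u J).map
      (Algebra.TensorProduct.map (AlgHom.id ℤ_[p] R₀) f : R₀ ⊗[ℤ_[p]] A →+* R₀ ⊗[ℤ_[p]] A') ≤
      tensorIdeal p u J' := by
  rw [Ideal.map_le_iff_le_comap, tensorIdeal, sup_le_iff, Ideal.span_singleton_le_iff_mem,
    Ideal.map_le_iff_le_comap]
  refine ⟨?_, fun x hx => ?_⟩
  · refine Ideal.mem_sup_left ?_
    simp
  · refine Ideal.mem_sup_right ?_
    simpa using Ideal.mem_map_of_mem
      (Algebra.TensorProduct.includeRight : A' →ₐ[ℤ_[p]] R₀ ⊗[ℤ_[p]] A')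
      (hJ (Ideal.mem_map_of_mem f hx))

/-- The map `R₀ ⊗̂ A → R₀ ⊗̂ A'` induced by `f : A → A'`. -/
def ctMap (p : ℕ) [Fact p.Prime] {R₀ A A' : Type*} [CommRing R₀]
    [Algebra ℤ_[p] R₀] [CommRing A] [Algebra ℤ_[p] A] [CommRing A'] [Algebra ℤ_[p] A']
    (u : R₀) {J : Ideal A} {J' : Ideal A'} (f : A →ₐ[ℤ_[p]] A') (hJ : J.map f ≤ J') :
    CTensor p u J →+* CTensor p u J' :=
  adicMap _ (tensorIdeal_map p u f hJ)

theorem ctMap_ctmul (p : ℕ) [Fact p.Prime] {R₀ A A' : Type*} [CommRing R₀]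
    [Algebra ℤ_[p] R₀] [CommRing A] [Algebra ℤ_[p] A] [CommRing A'] [Algebra ℤ_[p] A']
    (u : R₀) {J : Ideal A} {J' : Ideal A'} (f : A →ₐ[ℤ_[p]] A') (hJ : J.map f ≤ J')
    (r : R₀) (x : A) : ctMap p u f hJ (ctmul p u J r x) = ctmul p u J' r (f x) := by
  rw [ctMap, ctmul, adicMap_algebraMap]
  simp [ctmul]

/-- The subring `B[u/β, α/u]` of `B[1/(uβ)]`; here `u/β = u²/(uβ)` and `α/u = αβ/(uβ)`. -/
def ratPoly {B : Type*} [CommRing B] (u α β : B) : Subalgebra B (Localization.Away (u * β)) :=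
  Algebra.adjoin B {algebraMap B _ (u * u) * IsLocalization.Away.invSelf (u * β),
    algebraMap B _ (α * β) * IsLocalization.Away.invSelf (u * β)}

/-- The ring `B⟨u/β, α/u⟩`: the `u`-adic completion of `B[u/β, α/u]`. For `B = R₀ ⊗̂ A` with ideal
of definition `(u, p, [π̄])`, `β = [π̄] ^ s(b)` and `α = [π̄] ^ s(a) = (α/u) * u`, a power of `[π̄]` and
a power of `p` are multiples of `u`, so that the topology which `B[u/β, α/u]` carries as a ring of
definition of the rational localization is the `u`-adic one. -/
abbrev RatInt {B : Type*} [CommRing B] (u α β : B) : Type _ :=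
  AdicCompletion (Ideal.span {algebraMap B (ratPoly u α β) u}) (ratPoly u α β)

/-- The ring `B⟨u/β, α/u⟩[1/u]`. -/
abbrev RatLoc {B : Type*} [CommRing B] (u α β : B) : Type _ :=
  Localization.Away (algebraMap (ratPoly u α β) (RatInt u α β) (algebraMap B _ u))

section map

variable {B B' : Type*} [CommRing B] [CommRing B'] {u α β : B} {u' α' β' : B'}

/-- `B[1/(uβ)] → B'[1/(u'β')]`. -/
def awayMap (g : B →+* B') (hu : g u = u') (hβ : g β = β') :
    Localization.Away (u * β) →+* Localization.Away (u' * β') :=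
  IsLocalization.map (M := Submonoid.powers (u * β)) (T := Submonoid.powers (u' * β')) _ g
    (by rw [Submonoid.powers_le]; exact ⟨1, by simp [hu, hβ]⟩)

theorem awayMap_algebraMap (g : B →+* B') (hu : g u = u') (hβ : g β = β') (x : B) :
    awayMap g hu hβ (algebraMap B _ x) = algebraMap B' _ (g x) :=
  IsLocalization.map_eq _ x

theorem awayMap_invSelf (g : B →+* B') (hu : g u = u') (hβ : g β = β') :
    awayMap g hu hβ (IsLocalization.Away.invSelf (u * β)) =
      IsLocalization.Away.invSelf (u' * β') := by
  have h1 := congrArg (awayMap g hu hβ)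
    (IsLocalization.Away.mul_invSelf (S := Localization.Away (u * β)) (u * β))
  have h2 := IsLocalization.Away.mul_invSelf (S := Localization.Away (u' * β')) (u' * β')
  rw [map_mul, awayMap_algebraMap, map_mul, hu, hβ, map_one] at h1
  exact (IsLocalization.Away.algebraMap_isUnit (u' * β')).mul_left_cancel (h1.trans h2.symm)

theorem awayMap_mem (g : B →+* B') (hu : g u = u') (hα : g α = α') (hβ : g β = β')
    (x : ratPoly u α β) : awayMap g hu hβ x ∈ ratPoly u' α' β' := by
  obtain ⟨x, hx⟩ := x
  refine Algebra.adjoin_induction ?_ ?_ ?_ ?_ hx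
  · rintro y (rfl | rfl)
    · have h : awayMap g hu hβ (algebraMap B _ (u * u) * IsLocalization.Away.invSelf (u * β)) =
          algebraMap B' _ (u' * u') * IsLocalization.Away.invSelf (u' * β') := by
        rw [map_mul, awayMap_algebraMap, awayMap_invSelf, map_mul g, hu]
      rw [h]
      exact Algebra.subset_adjoin (Or.inl rfl)
    · have h : awayMap g hu hβ (algebraMap B _ (α * β) * IsLocalization.Away.invSelf (u * β)) =
          algebraMap B' _ (α' * β') * IsLocalization.Away.invSelf (u' * β') := by
        rw [map_mul, awayMap_algebraMap, awayMap_invSelf, map_mul g, hα, hβ]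
      rw [h]
      exact Algebra.subset_adjoin (Or.inr rfl)
  · intro y
    rw [awayMap_algebraMap]
    exact Subalgebra.algebraMap_mem _ _
  · intro y z _ _ hy hz
    rw [map_add]
    exact add_mem hy hz
  · intro y z _ _ hy hz
    rw [map_mul]
    exact mul_mem hy hz

/-- `B[u/β, α/u] → B'[u'/β', α'/u']`. -/
def ratPolyMap (g : B →+* B') (hu : g u = u') (hα : g α = α') (hβ : g β = β') :
    ratPoly u α β →+* ratPoly u' α' β' :=
  ((awayMap g hu hβ).comp (ratPoly u α β).val.toRingHom).codRestrict (ratPoly u' α' β').toSubring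
    (awayMap_mem g hu hα hβ)

theorem ratPolyMap_algebraMap (g : B →+* B') (hu : g u = u') (hα : g α = α') (hβ : g β = β')
    (x : B) : ratPolyMap g hu hα hβ (algebraMap B _ x) = algebraMap B' _ (g x) :=
  Subtype.ext (awayMap_algebraMap g hu hβ x)

/-- `B⟨u/β, α/u⟩ → B'⟨u'/β', α'/u'⟩`. -/
def ratIntMap (g : B →+* B') (hu : g u = u') (hα : g α = α') (hβ : g β = β') :
    RatInt u α β →+* RatInt u' α' β' :=
  adicMap (ratPolyMap g hu hα hβ) (by
    rw [Ideal.map_span, Set.image_singleton, ratPolyMap_algebraMap, hu])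

/-- `B⟨u/β, α/u⟩[1/u] → B'⟨u'/β', α'/u'⟩[1/u']`, induced by `g : B → B'` with `g u = u'`,
`g α = α'` and `g β = β'`. -/
def ratLocMap (g : B →+* B') (hu : g u = u') (hα : g α = α') (hβ : g β = β') :
    RatLoc u α β →+* RatLoc u' α' β' :=
  IsLocalization.map (M := Submonoid.powers _) (T := Submonoid.powers _) _
    (ratIntMap g hu hα hβ) (by
      rw [Submonoid.powers_le]
      refine ⟨1, ?_⟩
      simp only [pow_one]
      rw [ratIntMap, adicMap_algebraMap, ratPolyMap_algebraMap, hu])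

end map

/-! ## Pseudoaffinoid algebras -/

/-- A pseudo-uniformizer: a topologically nilpotent unit. -/
def IsPseudoUniformizer {R : Type*} [CommRing R] [TopologicalSpace R] (u : R) : Prop :=
  IsUnit u ∧ IsTopologicallyNilpotent u

/-- A ring of definition of `R`: an open subring with an adic subspace topology that is defined
by a finitely generated ideal. -/
def IsRingOfDefinition (p : ℕ) [Fact p.Prime] {R : Type*} [CommRing R] [TopologicalSpace R]
    [Algebra ℤ_[p] R] (R₀ : Subalgebra ℤ_[p] R) : Prop :=
  IsOpen (R₀ : Set R) ∧ ∃ I : Ideal R₀, I.FG ∧ IsAdic I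

/-- A complete adic `ℤ_p`-algebra `A` is formally of finite type over `ℤ_p` if it has a finitely
generated ideal of definition `I`, containing `p`, such that `A / I` is of finite type. -/
def IsFormallyOfFiniteType (p : ℕ) [Fact p.Prime] (A : Type*) [CommRing A] [TopologicalSpace A]
    [Algebra ℤ_[p] A] : Prop :=
  ∃ I : Ideal A, I.FG ∧ IsAdic I ∧ IsAdicComplete I A ∧ (p : A) ∈ I ∧
    Algebra.FiniteType ℤ_[p] (A ⧸ I)

/-- A pseudoaffinoid `ℤ_p`-algebra: a complete (separated) Tate `ℤ_p`-algebra with a ring of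
definition that is formally of finite type over `ℤ_p`. -/
structure IsPseudoaffinoid (p : ℕ) [Fact p.Prime] (R : Type*) [CommRing R] [UniformSpace R]
    [IsUniformAddGroup R] [IsTopologicalRing R] [Algebra ℤ_[p] R] : Prop where
  complete : CompleteSpace R
  separated : T2Space R
  tate : ∃ u : R, IsPseudoUniformizer u
  exists_ringOfDefinition : ∃ R₀ : Subalgebra ℤ_[p] R,
    IsRingOfDefinition p R₀ ∧ IsFormallyOfFiniteType p R₀

/-! ## The rings `Λ̃_{R₀,[a,b]}` -/

/-- `s(a) = (p - 1) / (p a)`. -/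
def sExp (p : ℕ) (a : ℚ) : ℚ := ((p : ℚ) - 1) / (p * a)

section Lambda

variable {p : ℕ} [Fact p.Prime] (ε : RootSystem p)
  (K : IntermediateField ℚ_[p] (PadicAlgCl p))
  {R₀ : Type*} [CommRing R₀] [Algebra ℤ_[p] R₀] (u : R₀) (m n : ℤ)

/-- `Λ̃_{R₀,[a,b]} = (R₀ ⊗̂ A_inf)⟨u/[π̄]^s(b), [π̄]^s(a)/u⟩[1/u]`,
where `s(a) = p ^ m` and `s(b) = p ^ n`. -/
abbrev LambdaTilde : Type _ :=
  RatLoc (ctmul p u ε.ideal u 1) (ctmul p u ε.ideal 1 (ε.teich m))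
    (ctmul p u ε.ideal 1 (ε.teich n))

/-- `(R₀ ⊗̂ A_inf^{H_K})⟨u/[π̄]^s(b), [π̄]^s(a)/u⟩[1/u]`,
where `s(a) = p ^ m` and `s(b) = p ^ n`. -/
abbrev LambdaHK : Type _ :=
  RatLoc (ctmul p u (ε.idealHK K) u 1) (ctmul p u (ε.idealHK K) 1 (ε.teichHK K m))
    (ctmul p u (ε.idealHK K) 1 (ε.teichHK K n))

/-- The natural map from `LambdaHK` to `LambdaTilde`, induced by `A_inf^{H_K} ⊆ A_inf`. -/
def lambdaIncl : LambdaHK ε K u m n →+* LambdaTilde ε u m n :=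
  ratLocMap
    (ctMap p u (AInfHK p K).val (J := ε.idealHK K) (J' := ε.ideal) (by
      rw [RootSystem.idealHK, RootSystem.ideal, Ideal.map_span, Set.image_pair, map_natCast]
      rfl))
    (by rw [ctMap_ctmul, map_one]) (by rw [ctMap_ctmul]; rfl) (by rw [ctMap_ctmul]; rfl)

/-- The action of `σ ∈ H_K` on `Λ̃_{R₀,[a,b]}`, induced by its action on `A_inf`. -/
def lambdaGal (σ : HK p K) : LambdaTilde ε u m n →+* LambdaTilde ε u m n :=
  ratLocMap
    (ctMap p u (galAInf p σ) (J := ε.ideal) (J' := ε.ideal) (by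
      rw [RootSystem.ideal, Ideal.map_span, Set.image_pair, map_natCast,
        galAInf_teich ε σ.2]))
    (by rw [ctMap_ctmul, map_one]) (by rw [ctMap_ctmul, galAInf_teich ε σ.2])
    (by rw [ctMap_ctmul, galAInf_teich ε σ.2])

/-- The subring of invariants `Λ̃_{R₀,[a,b]}^{H_K}`. -/
def lambdaInvariants : Subring (LambdaTilde ε u m n) :=
  ⨅ σ : HK p K, (lambdaGal ε K u m n σ).eqLocus (RingHom.id _)

end Lambda

end Period

end

open Polynomial
open scoped TensorProduct

noncomputable section

namespace Period

/-! ## Lifting roots of polynomials along a common reduction -/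

/-! Write `t = [π̄]^{s(b)}`, `s = [π̄]^{s(a)}`. Since `a ≤ b`, `s = t ^ e` with `e` a power of `p`;
moreover `u` divides a power of `p` in `R₀`. It suffices to work modulo each `u ^ k` before
completing, and factors of `u` may be lost because `u` is inverted at the end
(`ratLocMap_injective_and_range`). With `A = A_inf`, `A' = A_inf^{H_K}` and `B`, `B'` their
completed tensor products with `R₀`, two facts are needed.

Injectivity of `B'[u/t, s/u] → B[u/t, s/u]` modulo `u ^ k` (`dvd_of_dvd_ratPolyMap`). Regard `A` as
an algebra over `Λ = ℤ_p[X]` through `X ↦ t`, and let `Q = R₀[X][u/X, X^e/u]`. The map `A ⊗_Λ Q →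
B[u/t, s/u]` is surjective modulo `u ^ k` (`exists_dvd_sub_tensorToCTRat`), and injective modulo `u
^ k` once `u` is a nonzerodivisor on its source (`dvd_of_dvd_tensorToCTRat`). A power of the maximal
ideal `(p, X)` kills `Q / u ^ k`, and `(p, t)` is a regular sequence on `A`; so tensoring `A` with
such modules is exact enough for dévissage (`lTensor_subtype_injective_of_regular`). Everything
reduces to the injectivity of `A'/(p, t) → A/(p, t)` (`mem_span_of_coe_mem_span`).

Descent of invariants (`exists_dvd_sub_of_trace`). Write an element `z`, invariant modulo `u ^ k`,
as a finite sum `∑ aᵢ ⊗ qᵢ` modulo `u ^ k`. By `exists_approx_trace` the `aᵢ` can be replaced by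
elements of finite orbit, and some `w` has trace close to `t`. Averaging `w z` gives `t z ≡ ∑ Tr(w
aᵢ) qᵢ`, with coefficients in `A'`; multiplication by `u/t` yields `u z`.

Approximate traces need elements of finite `H_K`-orbit to be dense in `𝒪_{ℂ_p}^♭`
(`exists_finiteOrbit_approx`). The ring `D` of these elements is a perfect valuation ring, and monic
polynomials over `D` have roots in `D`, because they have roots in `𝒪_{ℂ_p}^♭` (`flat_exists_root`).
The image of `W(D)` under Fontaine's `θ` is a `p`-complete valuation ring, and its reduction modulo
`p` is a quotient of `D`; lifting roots from the reduction shows that monic polynomials over it have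
roots too (`thetaRange_exists_root`). Hence it approximates every integer of `ℚ̄_p` modulo `p`, so
`D → 𝒪_{ℂ_p}/p` is onto, and Frobenius gives density. Finally, independence of characters provides
an element of `D` with nonzero trace, and extracting `p`-power roots makes that trace as close to a
unit as required (`exists_sum_out_smul_pow_dvd`). -/

theorem exists_mem_forall_dvd {V ι : Type*} [CommRing V] [IsDomain V] [ValuationRing V]
    (s : Finset ι) (hs : s.Nonempty) (f : ι → V) : ∃ i ∈ s, ∀ j ∈ s, f j ∣ f i := by
  induction hs using Finset.Nonempty.cons_induction with
  | singleton a => exact ⟨a, by simp, by simp⟩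
  | cons a s ha hs ih =>
    obtain ⟨i, hi, h⟩ := ih
    rcases ValuationRing.dvd_total (f i) (f a) with h1 | h1
    · refine ⟨a, by simp, fun j hj => ?_⟩
      rcases Finset.mem_cons.1 hj with rfl | hj
      · exact dvd_rfl
      · exact (h j hj).trans h1
    · refine ⟨i, by simp [hi], fun j hj => ?_⟩
      rcases Finset.mem_cons.1 hj with rfl | hj
      · exact h1
      · exact h j hj

/-- If monic polynomials over `W` have roots, they split. -/
theorem exists_multiset_prod_eq {W : Type*} [CommRing W]
    (hW : ∀ P : W[X], P.Monic → P.natDegree ≠ 0 → ∃ x, P.eval x = 0) (P : W[X]) (hP : P.Monic) :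
    ∃ s : Multiset W, P = (s.map fun a => X - C a).prod := by
  nontriviality W
  induction hd : P.natDegree generalizing P with
  | zero => exact ⟨0, by simpa using eq_one_of_monic_natDegree_zero hP hd⟩
  | succ d ih =>
    obtain ⟨x, hx⟩ := hW P hP (by lia)
    obtain ⟨Q, hQ⟩ := dvd_iff_isRoot.2 hx
    have hQm : Q.Monic := (monic_X_sub_C x).of_mul_monic_left (hQ ▸ hP)
    have hdeg : Q.natDegree = d := by
      have := (monic_X_sub_C x).natDegree_mul hQm
      rw [← hQ, hd, natDegree_X_sub_C] at this
      lia
    obtain ⟨s, hs⟩ := ih Q hQm hdeg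
    exact ⟨x ::ₘ s, by rw [Multiset.map_cons, Multiset.prod_cons, ← hs, hQ]⟩

/-- A monic polynomial with a lower coefficient outside the kernel of a map to a field has a root
outside this kernel. -/
theorem exists_root_map_ne_zero {W k : Type*} [CommRing W] [Field k] (ψ : W →+* k)
    (hW : ∀ P : W[X], P.Monic → P.natDegree ≠ 0 → ∃ x, P.eval x = 0) (P : W[X]) (hP : P.Monic)
    (i : ℕ) (hi : i < P.natDegree) (h : ψ (P.coeff i) ≠ 0) :
    ∃ x, P.eval x = 0 ∧ ψ x ≠ 0 := by
  have : Nontrivial W := ψ.domain_nontrivial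
  obtain ⟨s, hs⟩ := exists_multiset_prod_eq hW P hP
  -- If every root died in `k`, the reduction would be a pure power of `X`, with no lower
  -- coefficients.
  by_contra! H
  have h1 : ∀ a ∈ s, ψ a = 0 := fun a ha => H a <| by
    rw [hs, eval_multiset_prod]
    exact Multiset.prod_eq_zero (by simpa using ⟨a, ha, by simp⟩)
  have h2 : P.map ψ = X ^ Multiset.card s := by
    rw [hs, Polynomial.map_multiset_prod, Multiset.map_map,
      Multiset.map_congr rfl (g := fun _ => X) fun a ha => by simp [h1 a ha]]
    simp
  have h3 : P.natDegree = Multiset.card s := by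
    rw [hs, natDegree_multiset_prod_X_sub_C_eq_card]
  rw [← coeff_map, h2, coeff_X_pow, if_neg (by lia)] at h
  exact h rfl

section

variable {V W T : Type*} [CommRing V] [IsDomain V] [ValuationRing V] [CommRing W] [CommRing T]
  [Nontrivial T]

/-- A Newton polygon step. Expand `P (s + y) = ∑ c i * y ^ i` and scale `y` by an `e` whose
valuation is the steepest slope at the constant term. After division by `c 0` the coefficients are
integral, the constant one is `1` and another one is a unit, so a root modulo `ϖ` can be imported
from `W`. Since `c d = 1`, `c 0` divides `e ^ d`, which bounds the displacement. -/
theorem exists_improved_root {ϖ : V} (π : V →+* T) (hπ : Function.Surjective π)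
    (hker : ∀ x, π x = 0 → ϖ ∣ x)
    (hdiv : ∀ g : V, g ≠ 0 → ∀ i : ℕ, i ≠ 0 → ∃ e, Associated (e ^ i) g)
    (hW : ∀ P : W[X], P.Monic → P.natDegree ≠ 0 → ∃ x, P.eval x = 0)
    (φ : W →+* T) (hφ : Function.Surjective φ) [IsLocalHom φ]
    (P : V[X]) (hP : P.Monic) (hd : P.natDegree ≠ 0) (s : V) :
    ∃ s' e : V, ϖ * P.eval s ∣ P.eval s' ∧ e ∣ s' - s ∧ P.eval s ∣ e ^ P.natDegree := by
  classical
  by_cases h0 : P.eval s = 0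
  · exact ⟨s, 0, by simp [h0], by simp, by simp [hd]⟩
  set d := P.natDegree with hd_def
  set c : ℕ → V := (taylor s P).coeff with hc
  have hc0 : c 0 = P.eval s := taylor_coeff_zero s P
  have hcd : c d = 1 := by
    have : (taylor s P).natDegree = d := natDegree_taylor P s
    rw [hc, ← this]
    exact (show (taylor s P).Monic from by rwa [Monic, leadingCoeff_taylor])
  have heval : ∀ y, P.eval (s + y) = ∑ i ∈ Finset.range (d + 1), c i * y ^ i := fun y => by
    have : (taylor s P).eval y = P.eval (s + y) := by rw [taylor_eval, add_comm]
    rw [← this, eval_eq_sum_range, natDegree_taylor]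
  -- The indices for which some `e` makes `c i * e ^ i` associated to `c 0`; for any other `i ≠ 0`,
  -- `c 0` already divides `c i`.
  set I := (Finset.range (d + 1)).filter fun i => i ≠ 0 ∧ c i ∣ c 0 with hI
  have hdI : d ∈ I := by simp [hI, hd, hcd]
  have hch : ∀ i, ∃ e, i ∈ I → Associated (c i * e ^ i) (c 0) := fun i => by
    by_cases hi : i ∈ I
    · simp only [hI, Finset.mem_filter] at hi
      obtain ⟨-, hi0, g, hg⟩ := hi
      have hg0 : g ≠ 0 := by rintro rfl; simp [hc0, h0] at hg
      obtain ⟨e, he⟩ := hdiv g hg0 i hi0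
      exact ⟨e, fun _ => hg ▸ he.mul_left _⟩
    · exact ⟨0, fun h => absurd h hi⟩
  choose E hE using hch
  -- The scale of largest valuation makes all terms divisible by `c 0`, with equality at `i₀`.
  obtain ⟨i₀, hi₀, hmax⟩ := exists_mem_forall_dvd I ⟨d, hdI⟩ E
  set e := E i₀ with he
  have hdvd : ∀ i, i ∈ Finset.range (d + 1) → i ≠ 0 → c 0 ∣ c i * e ^ i := fun i hi hi0 => by
    by_cases hiI : i ∈ I
    · exact (hE i hiI).symm.dvd.trans (mul_dvd_mul_left _ (pow_dvd_pow_of_dvd (hmax i hiI) i))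
    · have : ¬ c i ∣ c 0 := fun h => hiI (by simp only [hI, Finset.mem_filter]; exact ⟨hi, hi0, h⟩)
      exact ((ValuationRing.dvd_total (c i) (c 0)).resolve_left this).mul_right _
  have hb : ∀ i, ∃ b, i ∈ Finset.range (d + 1) → c i * e ^ i = c 0 * b := fun i => by
    by_cases hi : i ∈ Finset.range (d + 1)
    · by_cases hi0 : i = 0
      · exact ⟨1, fun _ => by simp [hi0]⟩
      · obtain ⟨b, hb⟩ := hdvd i hi hi0
        exact ⟨b, fun _ => hb⟩
    · exact ⟨0, fun h => absurd h hi⟩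
  choose b hb using hb
  have hc00 : c 0 ≠ 0 := hc0 ▸ h0
  have hi₀' : i₀ ∈ Finset.range (d + 1) ∧ i₀ ≠ 0 := by
    simp only [hI, Finset.mem_filter] at hi₀; exact ⟨hi₀.1, hi₀.2.1⟩
  have hbu : IsUnit (b i₀) := by
    have h1 : Associated (c 0 * b i₀) (c 0 * 1) := by
      rw [← hb i₀ hi₀'.1, mul_one]; exact hE i₀ hi₀
    exact (associated_one_iff_isUnit).1 (Associated.of_mul_left h1 (Associated.refl _) hc00)
  have hb0 : b 0 = 1 := by
    have := hb 0 (by simp)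
    rw [pow_zero, mul_one] at this
    exact (mul_left_cancel₀ hc00 (by rw [mul_one]; exact this)).symm
  choose lft hlft using hφ
  set w : ℕ → W := fun i => lft (π (b i)) with hw
  have hφw : ∀ i, φ (w i) = π (b i) := fun i => hlft _
  have : Nontrivial W := φ.domain_nontrivial
  have : IsLocalRing T := IsLocalRing.of_surjective' π hπ
  let ψ : W →+* IsLocalRing.ResidueField T := (IsLocalRing.residue _).comp φ
  have hψ : ∀ x, ψ x ≠ 0 ↔ IsUnit x := fun x => by
    rw [RingHom.comp_apply, IsLocalRing.residue_ne_zero_iff_isUnit]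
    exact ⟨fun h => isUnit_of_map_unit φ x h, fun h => h.map φ⟩
  -- `X ^ d + q` lifts the reversal of `∑ b i * X ^ i`; it is monic because `b 0 = 1`. A unit root
  -- `y` of it gives the root `y⁻¹` of the original modulo `ϖ`.
  set q : W[X] := ∑ i ∈ Finset.range d, C (w (i + 1)) * X ^ (d - 1 - i) with hq
  have hqdeg : q.degree < d := by
    refine (degree_sum_le _ _).trans_lt ?_
    rw [Finset.sup_lt_iff (by exact_mod_cast WithBot.bot_lt_coe d)]
    intro i hi
    refine (degree_C_mul_X_pow_le _ _).trans_lt ?_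
    have := Finset.mem_range.1 hi
    exact_mod_cast (by lia : d - 1 - i < d)
  have hmon : (X ^ d + q).Monic := monic_X_pow_add hqdeg
  have hdeg : (X ^ d + q).natDegree = d := by
    rw [natDegree_add_eq_left_of_degree_lt (by rwa [degree_X_pow]), natDegree_X_pow]
  have hi₁ := Finset.mem_range.1 hi₀'.1
  have hcoeff : (X ^ d + q).coeff (d - i₀) = w i₀ := by
    rw [coeff_add, coeff_X_pow, if_neg (by lia), zero_add, hq, finsetSum_coeff,
      Finset.sum_eq_single (i₀ - 1)]
    · rw [coeff_C_mul_X_pow, if_pos (by lia), Nat.sub_add_cancel (by lia)]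
    · intro j hj hne
      have := Finset.mem_range.1 hj
      rw [coeff_C_mul_X_pow, if_neg (by lia)]
    · intro h; exact absurd (Finset.mem_range.2 (by lia)) h
  obtain ⟨y, hy, hyu⟩ := exists_root_map_ne_zero ψ hW _ hmon (d - i₀) (by lia) (by
    rw [hcoeff, hψ]
    exact isUnit_of_map_unit φ _ (by rw [hφw]; exact hbu.map _))
  rw [hψ] at hyu
  obtain ⟨y, rfl⟩ := hyu
  have hφ1 : ∑ i ∈ Finset.range (d + 1), φ (w i) * φ (↑y⁻¹ : W) ^ i = 0 := by
    have h1 : φ (y : W) ^ d + ∑ i ∈ Finset.range d, φ (w (i + 1)) * φ (y : W) ^ (d - 1 - i) = 0 := by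
      have := congrArg φ hy
      simpa [hq, eval_finsetSum] using this
    have hyy : φ (y : W) * φ (↑y⁻¹ : W) = 1 := by rw [← map_mul]; simp
    have h2 := congrArg (· * φ (↑y⁻¹ : W) ^ d) h1
    simp only [zero_mul, add_mul, ← mul_pow, hyy, one_pow, Finset.sum_mul] at h2
    rw [Finset.sum_range_succ', ← h2, add_comm, hφw 0, hb0, map_one, pow_zero, mul_one]
    congr 1
    refine Finset.sum_congr rfl fun i hi => ?_
    have := Finset.mem_range.1 hi
    rw [mul_assoc]
    congr 1
    rw [show d = (d - 1 - i) + (i + 1) by lia]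
    rw [pow_add _ (d - 1 - i) (i + 1), ← mul_assoc, show d - 1 - i + (i + 1) - 1 - i = d - 1 - i by lia,
      ← mul_pow, hyy, one_pow, one_mul]
  obtain ⟨x, hx⟩ := hπ (φ (↑y⁻¹ : W))
  have hsum : ϖ ∣ ∑ i ∈ Finset.range (d + 1), b i * x ^ i := by
    refine hker _ ?_
    rw [map_sum, ← hφ1]
    refine Finset.sum_congr rfl fun i _ => ?_
    rw [map_mul, map_pow, hx, hφw]
  refine ⟨s + e * x, e, ?_, ⟨x, by ring⟩, ?_⟩
  · rw [heval, mul_comm, ← hc0]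
    have : ∑ i ∈ Finset.range (d + 1), c i * (e * x) ^ i =
        c 0 * ∑ i ∈ Finset.range (d + 1), b i * x ^ i := by
      rw [Finset.mul_sum]
      refine Finset.sum_congr rfl fun i hi => ?_
      rw [mul_pow, ← mul_assoc, hb i hi, mul_assoc]
    rw [this]
    exact mul_dvd_mul_left _ hsum
  · have := hb d (by simp)
    rw [hcd, one_mul] at this
    exact ⟨b d, by rw [this, hc0]⟩

theorem dvd_of_pow_dvd_pow {a b : V} {n : ℕ} (hn : n ≠ 0) (ha : a ≠ 0) (h : a ^ n ∣ b ^ n) :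
    a ∣ b := by
  rcases ValuationRing.dvd_total a b with h1 | ⟨c, rfl⟩
  · exact h1
  · rw [mul_pow] at h
    have hb : b ≠ 0 := left_ne_zero_of_mul ha
    have : IsUnit (c ^ n) := by
      have h2 : b ^ n * c ^ n ∣ b ^ n * 1 := by simpa using h
      exact isUnit_of_dvd_one ((mul_dvd_mul_iff_left (pow_ne_zero n hb)).1 h2)
    exact ((isUnit_pow_iff hn).1 this).mul_right_dvd.2 dvd_rfl

/-- Monic polynomials over a complete valuation ring `V` with divisible value group have roots, if
monic polynomials have roots over some ring `W` with a surjective local homomorphism to `V / ϖ`. -/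
theorem exists_root_of_surjective {ϖ : V} (hϖ0 : ϖ ≠ 0) (π : V →+* T)
    (hπ : Function.Surjective π) (hker : ∀ x, π x = 0 → ϖ ∣ x) [IsAdicComplete (Ideal.span {ϖ}) V]
    (hdiv : ∀ g : V, g ≠ 0 → ∀ i : ℕ, i ≠ 0 → ∃ e, Associated (e ^ i) g)
    (hW : ∀ P : W[X], P.Monic → P.natDegree ≠ 0 → ∃ x, P.eval x = 0)
    (φ : W →+* T) (hφ : Function.Surjective φ) [IsLocalHom φ]
    (P : V[X]) (hP : P.Monic) (hd : P.natDegree ≠ 0) : ∃ x, P.eval x = 0 := by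
  choose nxt E h1 h2 h3 using exists_improved_root π hπ hker hdiv hW φ hφ P hP hd
  set d := P.natDegree
  let s : ℕ → V := fun n => nxt^[n] 0
  have hs : ∀ n, s (n + 1) = nxt (s n) := fun n => Function.iterate_succ_apply' _ _ _
  have hP' : ∀ n, ϖ ^ n ∣ P.eval (s n) := fun n => by
    induction n with
    | zero => simp
    | succ n ih => rw [hs, pow_succ']; exact (mul_dvd_mul_left ϖ ih).trans (h1 _)
  -- `ϖ ^ n ∣ P (s n) ∣ E ^ d`, so once `d * k ≤ n` the displacement is divisible by `ϖ ^ k`.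
  have hstep : ∀ k n, d * k ≤ n → ϖ ^ k ∣ s (n + 1) - s n := fun k n hkn => by
    rw [hs]
    refine (dvd_of_pow_dvd_pow hd (pow_ne_zero k hϖ0) ?_).trans (h2 _)
    rw [← pow_mul, mul_comm]
    exact (pow_dvd_pow ϖ hkn).trans ((hP' n).trans (h3 _))
  have hcauchy : ∀ k n m, d * k ≤ m → m ≤ n → ϖ ^ k ∣ s n - s m := fun k n m hm hmn => by
    induction n, hmn using Nat.le_induction with
    | base => simp
    | succ n hn ih =>
      have := dvd_add (hstep k n (hm.trans hn)) ih
      simpa using this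
  -- Displacements gain one factor `ϖ` only every `d` steps, hence the subsequence `s (d * k)`.
  obtain ⟨L, hL⟩ := IsPrecomplete.prec (I := Ideal.span {ϖ}) (M := V) inferInstance
    (f := fun k => s (d * k)) (fun {m n} hmn => by
      rw [SModEq.sub_mem, Ideal.span_singleton_pow, smul_eq_mul, Ideal.mul_top,
        Ideal.mem_span_singleton]
      have := hcauchy m (d * n) (d * m) le_rfl (Nat.mul_le_mul_left d hmn)
      rwa [dvd_sub_comm])
  refine ⟨L, IsHausdorff.haus (I := Ideal.span {ϖ}) (M := V) inferInstance _ fun k => ?_⟩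
  have h4 := hL k
  rw [SModEq.sub_mem, Ideal.span_singleton_pow, smul_eq_mul, Ideal.mul_top,
    Ideal.mem_span_singleton] at h4 ⊢
  have h5 : ϖ ^ k ∣ P.eval (s (d * k)) - P.eval L := h4.trans (P.sub_dvd_eval_sub _ _)
  have h6 : ϖ ^ k ∣ P.eval (s (d * k)) :=
    (pow_dvd_pow ϖ (Nat.le_mul_of_pos_left k (Nat.pos_of_ne_zero hd))).trans (hP' _)
  rw [sub_zero]
  simpa using dvd_sub h6 h5

end

/-! ## The ring `𝒪_{ℂ_p}` and its tilt -/

section tilt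

variable (p : ℕ) [Fact p.Prime]

theorem norm_natCast_p : ‖(p : ℂ_[p])‖ = (p : ℝ)⁻¹ := by
  rw [← PadicComplex.coe_natCast, PadicComplex.norm_extends,
    ← map_natCast (algebraMap ℚ_[p] (PadicAlgCl p)), PadicAlgCl.norm_extends, Padic.norm_p]

theorem norm_natCast_p_lt_one : ‖(p : ℂ_[p])‖ < 1 := by
  rw [norm_natCast_p]
  exact inv_lt_one_of_one_lt₀ (by exact_mod_cast (Fact.out : p.Prime).one_lt)

theorem natCast_p_ne_zero : ((p : ℕ) : 𝓞_ℂ_[p]) ≠ 0 := by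
  intro h
  have h1 := congrArg (Subtype.val : 𝓞_ℂ_[p] → ℂ_[p]) h
  exact (Fact.out : p.Prime).ne_zero (by simpa using h1)

theorem int_dvd_iff (x y : 𝓞_ℂ_[p]) : x ∣ y ↔ ‖(y : ℂ_[p])‖ ≤ ‖(x : ℂ_[p])‖ := by
  constructor
  · rintro ⟨c, rfl⟩
    rw [MulMemClass.coe_mul, norm_mul]
    exact mul_le_of_le_one_right (norm_nonneg _) ((mem_int_iff p _).1 c.2)
  · intro h
    by_cases hx : (x : ℂ_[p]) = 0
    · rw [hx, norm_zero, norm_le_zero_iff] at h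
      rw [show y = 0 from Subtype.ext h]
      exact dvd_zero x
    · refine ⟨⟨y / x, (mem_int_iff p _).2 ?_⟩, Subtype.ext ?_⟩
      · rw [norm_div]
        exact div_le_one_of_le₀ h (norm_nonneg _)
      · rw [MulMemClass.coe_mul, mul_div_cancel₀ _ hx]

theorem pow_p_dvd_iff (n : ℕ) (x : 𝓞_ℂ_[p]) :
    ((p : ℕ) : 𝓞_ℂ_[p]) ^ n ∣ x ↔ ‖(x : ℂ_[p])‖ ≤ ‖(p : ℂ_[p])‖ ^ n := by
  rw [int_dvd_iff, ← norm_pow]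
  rfl

instance isAdicComplete_int : IsAdicComplete (Ideal.span {((p : ℕ) : 𝓞_ℂ_[p])}) 𝓞_ℂ_[p] where
  haus' x hx := by
    refine Subtype.ext (norm_le_zero_iff.1 ?_)
    refine ge_of_tendsto'
      (tendsto_pow_atTop_nhds_zero_of_lt_one (norm_nonneg _) (norm_natCast_p_lt_one p)) fun n => ?_
    have := hx n
    rwa [SModEq.zero, Ideal.span_singleton_pow, smul_eq_mul, Ideal.mul_top,
      Ideal.mem_span_singleton, pow_p_dvd_iff] at this
  prec' f hf := by
    have hf' : ∀ m n, m ≤ n → ‖(f n : ℂ_[p]) - f m‖ ≤ ‖(p : ℂ_[p])‖ ^ m := fun m n hmn => by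
      have := hf hmn
      rwa [SModEq.sub_mem, Ideal.span_singleton_pow, smul_eq_mul, Ideal.mul_top,
        Ideal.mem_span_singleton, pow_p_dvd_iff, AddSubgroupClass.coe_sub, norm_sub_rev] at this
    have hlim := tendsto_pow_atTop_nhds_zero_of_lt_one (norm_nonneg _) (norm_natCast_p_lt_one p)
    have hc : CauchySeq fun n => (f n : ℂ_[p]) :=
      cauchySeq_of_le_tendsto_0' _ (fun m n hmn => by
        rw [dist_eq_norm, norm_sub_rev]; exact hf' m n hmn) hlim
    obtain ⟨L, hL⟩ := cauchySeq_tendsto_of_complete hc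
    have hL1 : L ∈ 𝓞_ℂ_[p] := (mem_int_iff p _).2 <|
      le_of_tendsto' hL.norm fun n => (mem_int_iff p _).1 (f n).2
    refine ⟨⟨L, hL1⟩, fun n => ?_⟩
    rw [SModEq.sub_mem, Ideal.span_singleton_pow, smul_eq_mul, Ideal.mul_top,
        Ideal.mem_span_singleton, pow_p_dvd_iff, AddSubgroupClass.coe_sub, norm_sub_rev]
    refine le_of_tendsto ((hL.sub_const _).norm) ?_
    filter_upwards [Filter.eventually_ge_atTop n] with m hm using hf' n m hm

theorem int_exists_root (P : (𝓞_ℂ_[p])[X]) (hP : P.Monic) (hd : P.natDegree ≠ 0) :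
    ∃ x, P.eval x = 0 := by
  obtain ⟨z, hz⟩ := IsAlgClosed.exists_root (P.map (𝓞_ℂ_[p]).subtype) (by
    rw [hP.degree_map, degree_eq_natDegree hP.ne_zero]; exact_mod_cast hd)
  have hint : IsIntegral 𝓞_ℂ_[p] z := ⟨P, hP, by rwa [IsRoot, eval_map] at hz⟩
  obtain ⟨x, hx⟩ := IsIntegrallyClosed.isIntegral_iff.1 hint
  refine ⟨x, Subtype.val_injective ?_⟩
  rw [IsRoot, eval_map, ← hx] at hz
  have := P.hom_eval₂ (RingHom.id _) (𝓞_ℂ_[p]).subtype x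
  rw [RingHom.comp_id] at this
  exact (this.trans hz)

theorem int_exists_pow_eq (n : ℕ) (hn : n ≠ 0) (x : 𝓞_ℂ_[p]) : ∃ y, y ^ n = x := by
  obtain ⟨y, hy⟩ := int_exists_root p (X ^ n - C x) (monic_X_pow_sub_C x hn)
    (by rwa [natDegree_X_pow_sub_C])
  exact ⟨y, by simpa [sub_eq_zero] using hy⟩

instance isDomain_flat : IsDomain (OFlat p) :=
  PreTilt.isDomain ℂ_[p] (PadicComplex.valued p).v 𝓞_ℂ_[p] (PadicComplexInt.integers p) p

variable {p}

variable (p) in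
/-- `𝒪_{ℂ_p}^♭` as the multiplicative monoid of compatible systems of `p`-power roots. -/
def flatEquiv : Perfection 𝓞_ℂ_[p] p ≃* OFlat p :=
  Perfection.quotientMulEquiv p (Ideal.span {((p : ℕ) : 𝓞_ℂ_[p])})

/-- The element `untilt (x ^ (1 / p ^ n))`. -/
def untiltRoot (n : ℕ) : OFlat p →* 𝓞_ℂ_[p] :=
  (Perfection.coeffMonoidHom 𝓞_ℂ_[p] p n).comp (flatEquiv p).symm.toMonoidHom

theorem untiltRoot_zero (x : OFlat p) : untiltRoot 0 x = PreTilt.untilt x :=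
  Perfection.coeff_zero_symm_quotientMulEquiv x

theorem untiltRoot_pow (n : ℕ) (x : OFlat p) : untiltRoot (n + 1) x ^ p = untiltRoot n x :=
  Perfection.coeffMonoidHom_pow_p' ((flatEquiv p).symm x) n

theorem mk_untiltRoot (n : ℕ) (x : OFlat p) :
    Ideal.Quotient.mk _ (untiltRoot n x) = PreTilt.coeff n x := by
  have h : PreTilt.coeff n (flatEquiv p ((flatEquiv p).symm x)) =
      Ideal.Quotient.mk _ (untiltRoot n x) :=
    Perfection.coeff_quotientMulEquiv ((flatEquiv p).symm x) n
  rw [← h, MulEquiv.apply_symm_apply]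

theorem exists_untiltRoot_eq (f : ℕ → 𝓞_ℂ_[p]) (hf : ∀ n, f (n + 1) ^ p = f n) :
    ∃ x : OFlat p, ∀ n, untiltRoot n x = f n := by
  let y : Perfection 𝓞_ℂ_[p] p := ⟨f, hf⟩
  refine ⟨flatEquiv p y, fun n => ?_⟩
  have h : untiltRoot n (flatEquiv p y) =
      Perfection.coeffMonoidHom 𝓞_ℂ_[p] p n ((flatEquiv p).symm (flatEquiv p y)) := rfl
  rw [h, MulEquiv.symm_apply_apply]
  rfl

theorem flat_ext {x y : OFlat p} (h : ∀ n, untiltRoot n x = untiltRoot n y) : x = y :=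
  Perfection.ext fun n => by
    have := congrArg (Ideal.Quotient.mk (Ideal.span {((p : ℕ) : 𝓞_ℂ_[p])})) (h n)
    rwa [mk_untiltRoot, mk_untiltRoot] at this

theorem untiltRoot_pow_pow (n : ℕ) (x : OFlat p) : untiltRoot n x ^ p ^ n = untiltRoot 0 x := by
  induction n with
  | zero => simp
  | succ n ih => rw [pow_succ', pow_mul, untiltRoot_pow, ih]

theorem untilt_surjective (z : 𝓞_ℂ_[p]) : ∃ x : OFlat p, x.untilt = z := by
  choose r hr using int_exists_pow_eq p p (Fact.out : p.Prime).ne_zero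
  obtain ⟨x, hx⟩ := exists_untiltRoot_eq (fun n => r^[n] z) fun n => by
    rw [Function.iterate_succ_apply', hr]
  exact ⟨x, by rw [← untiltRoot_zero, hx]; rfl⟩

theorem coeff_zero_surjective : Function.Surjective (PreTilt.coeff 0 : OFlat p →+* _) := fun y => by
  obtain ⟨z, rfl⟩ := Ideal.Quotient.mk_surjective y
  obtain ⟨x, hx⟩ := untilt_surjective z
  exact ⟨x, by rw [← PreTilt.mk_untilt_eq_coeff_zero, hx]⟩

theorem untilt_eq_zero {x : OFlat p} : x.untilt = 0 ↔ x = 0 := by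
  rw [← untiltRoot_zero]
  constructor
  · intro h
    refine flat_ext fun n => ?_
    have h1 : ∀ y : OFlat p, untiltRoot 0 y = 0 → untiltRoot n y = 0 := fun y hy =>
      eq_zero_of_pow_eq_zero (n := p ^ n) (by rw [untiltRoot_pow_pow, hy])
    rw [h1 x h, h1 0]
    rw [untiltRoot_zero]
    exact Perfection.teichmuller_zero
  · rintro rfl
    rw [untiltRoot_zero]
    exact Perfection.teichmuller_zero

/-- Norms determine divisibility in `𝒪_{ℂ_p}`, so divisibility passes to `p ^ n`-th roots; the
quotients of these roots again form a compatible system. This makes the tilt a valuation ring. -/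
theorem untilt_dvd_untilt {x y : OFlat p} : x.untilt ∣ y.untilt ↔ x ∣ y := by
  refine ⟨fun h => ?_, map_dvd _⟩
  by_cases hx : x.untilt = 0
  · rw [hx, zero_dvd_iff, untilt_eq_zero] at h
    rw [h]; exact dvd_zero x
  have hpow : ∀ n, untiltRoot n x ∣ untiltRoot n y := fun n => by
    rw [int_dvd_iff]
    refine le_of_pow_le_pow_left₀ (pow_ne_zero n (Fact.out : p.Prime).ne_zero) (norm_nonneg _) ?_
    rw [← norm_pow, ← norm_pow, ← SubmonoidClass.coe_pow, ← SubmonoidClass.coe_pow,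
      untiltRoot_pow_pow, untiltRoot_pow_pow, ← int_dvd_iff, untiltRoot_zero, untiltRoot_zero]
    exact h
  choose c hc using hpow
  obtain ⟨z, hz⟩ := exists_untiltRoot_eq c fun n => by
    have hx' : untiltRoot n x ≠ 0 := fun h0 => hx <| by
      rw [← untiltRoot_zero, ← untiltRoot_pow_pow n, h0,
        zero_pow (pow_ne_zero n (Fact.out : p.Prime).ne_zero)]
    refine mul_left_cancel₀ hx' ?_
    rw [← hc n, ← untiltRoot_pow n x, ← mul_pow, ← hc (n + 1), untiltRoot_pow]
  exact ⟨z, flat_ext fun n => by rw [map_mul, hz, hc]⟩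

instance valuationRing_flat : ValuationRing (OFlat p) :=
  ValuationRing.iff_dvd_total.2 ⟨fun x y => by
    rw [← untilt_dvd_untilt, ← untilt_dvd_untilt]
    exact ValuationRing.dvd_total _ _⟩

theorem flat_exists_associated_pow (g : OFlat p) (i : ℕ) (hi : i ≠ 0) :
    ∃ e, Associated (e ^ i) g := by
  obtain ⟨z, hz⟩ := int_exists_pow_eq p i hi g.untilt
  obtain ⟨e, he⟩ := untilt_surjective z
  refine ⟨e, associated_of_dvd_dvd ?_ ?_⟩ <;> rw [← untilt_dvd_untilt, map_pow, he, hz]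

end tilt

/-! ### Galois action on the tilt and elements of finite orbit -/

section galois

variable {p : ℕ} [Fact p.Prime]

theorem galC_mul (σ τ : PadicAlgCl p ≃ₐ[ℚ_[p]] PadicAlgCl p) (x : ℂ_[p]) :
    galC p (σ * τ) x = galC p σ (galC p τ x) := by
  have h : ∀ σ, Continuous (galC p σ) := fun σ =>
    AddMonoidHomClass.isometry_iff_norm (galC p σ) |>.2 (norm_galC p σ) |>.continuous
  refine congrFun (UniformSpace.Completion.ext (h _) ((h σ).comp (h τ)) fun a => ?_) x
  simp only [Function.comp_apply, galC_coe]
  rfl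

theorem galC_one (x : ℂ_[p]) : galC p 1 x = x := by
  have h : ∀ σ, Continuous (galC p σ) := fun σ =>
    AddMonoidHomClass.isometry_iff_norm (galC p σ) |>.2 (norm_galC p σ) |>.continuous
  refine congrFun (UniformSpace.Completion.ext (h _) continuous_id fun a => ?_) x
  rw [galC_coe]
  rfl

theorem coeff_galFlat (σ : PadicAlgCl p ≃ₐ[ℚ_[p]] PadicAlgCl p) (x : OFlat p) (n : ℕ) :
    PreTilt.coeff n (galFlat p σ x) =
      Ideal.Quotient.mk _ (galInt p σ (untiltRoot n x)) := by
  have h : PreTilt.coeff n (galFlat p σ x) =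
      Ideal.quotientMap (Ideal.span {((p : ℕ) : 𝓞_ℂ_[p])}) (galInt p σ) (by
        rw [Ideal.span_singleton_le_iff_mem, Ideal.mem_comap, map_natCast]
        exact Ideal.mem_span_singleton_self _) (PreTilt.coeff n x) := rfl
  rw [h, ← mk_untiltRoot]
  rfl

theorem untiltRoot_galFlat (σ : PadicAlgCl p ≃ₐ[ℚ_[p]] PadicAlgCl p) (x : OFlat p) (n : ℕ) :
    untiltRoot n (galFlat p σ x) = galInt p σ (untiltRoot n x) := by
  obtain ⟨y, hy⟩ := exists_untiltRoot_eq (fun n => galInt p σ (untiltRoot n x)) fun n => by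
    rw [← map_pow, untiltRoot_pow]
  have : y = galFlat p σ x := Perfection.ext fun n => by
    change PreTilt.coeff n y = PreTilt.coeff n _
    rw [coeff_galFlat, ← hy, mk_untiltRoot]
  rw [← this, hy]

theorem galFlat_mul (σ τ : PadicAlgCl p ≃ₐ[ℚ_[p]] PadicAlgCl p) (x : OFlat p) :
    galFlat p (σ * τ) x = galFlat p σ (galFlat p τ x) :=
  flat_ext fun n => by
    simp only [untiltRoot_galFlat]
    exact Subtype.ext (galC_mul σ τ _)

theorem galFlat_one (x : OFlat p) : galFlat p 1 x = x :=
  flat_ext fun n => by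
    simp only [untiltRoot_galFlat]
    exact Subtype.ext (galC_one _)

theorem galFlat_injective (σ : PadicAlgCl p ≃ₐ[ℚ_[p]] PadicAlgCl p) :
    Function.Injective (galFlat p σ) := fun x y h => by
  rw [← galFlat_one x, ← galFlat_one y, ← inv_mul_cancel σ, galFlat_mul, galFlat_mul, h]

variable (p) in
/-- The elements of `𝒪_{ℂ_p}^♭` with finite orbit under `H_K`. -/
def finiteOrbit (K : IntermediateField ℚ_[p] (PadicAlgCl p)) : Subring (OFlat p) where
  carrier := {x | (Set.range fun σ : HK p K => galFlat p σ x).Finite}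
  mul_mem' {x y} hx hy := (hx.image2 (· * ·) hy).subset <| by
    rintro _ ⟨σ, rfl⟩
    exact ⟨_, ⟨σ, rfl⟩, _, ⟨σ, rfl⟩, (map_mul _ _ _).symm⟩
  add_mem' {x y} hx hy := (hx.image2 (· + ·) hy).subset <| by
    rintro _ ⟨σ, rfl⟩
    exact ⟨_, ⟨σ, rfl⟩, _, ⟨σ, rfl⟩, (map_add _ _ _).symm⟩
  zero_mem' := (Set.finite_singleton 0).subset <| by
    rintro _ ⟨σ, rfl⟩; exact map_zero _
  one_mem' := (Set.finite_singleton 1).subset <| by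
    rintro _ ⟨σ, rfl⟩; exact map_one _
  neg_mem' {x} hx := (hx.image Neg.neg).subset <| by
    rintro _ ⟨σ, rfl⟩; exact ⟨_, ⟨σ, rfl⟩, (map_neg _ _).symm⟩

variable {K : IntermediateField ℚ_[p] (PadicAlgCl p)}

theorem mem_finiteOrbit_of_forall {x : OFlat p} (h : ∀ σ ∈ HK p K, galFlat p σ x = x) :
    x ∈ finiteOrbit p K :=
  (Set.finite_singleton x).subset <| by rintro _ ⟨σ, rfl⟩; exact h σ σ.2

theorem frobeniusEquiv_symm_mem {x : OFlat p} (hx : x ∈ finiteOrbit p K) :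
    (frobeniusEquiv (OFlat p) p).symm x ∈ finiteOrbit p K :=
  (hx.image (frobeniusEquiv (OFlat p) p).symm).subset <| by
    rintro _ ⟨σ, rfl⟩
    refine ⟨_, ⟨σ, rfl⟩, (frobeniusEquiv (OFlat p) p).injective ?_⟩
    simp only [RingEquiv.apply_symm_apply]
    rw [frobeniusEquiv_apply, frobenius_def, ← map_pow, ← frobenius_def p,
      ← frobeniusEquiv_apply, RingEquiv.apply_symm_apply]

/-- A root of a nonzero polynomial over `finiteOrbit p K` lies in `finiteOrbit p K`. -/
theorem mem_finiteOrbit_of_root (P : (finiteOrbit p K)[X]) (hP : P ≠ 0) (x : OFlat p)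
    (hx : P.eval₂ (finiteOrbit p K).subtype x = 0) : x ∈ finiteOrbit p K := by
  classical
  -- The conjugates of `x` are roots of the conjugates of `P`, of which there are finitely many
  -- because the coefficients have finite orbits.
  let Q : HK p K → (OFlat p)[X] := fun σ => P.map ((galFlat p σ).comp (finiteOrbit p K).subtype)
  have hQ0 : ∀ σ, Q σ ≠ 0 := fun σ => by
    have h : Function.Injective ((galFlat p σ).comp (finiteOrbit p K).subtype) :=
      (galFlat_injective (σ : PadicAlgCl p ≃ₐ[ℚ_[p]] PadicAlgCl p)).comp Subtype.val_injective
    exact (Polynomial.map_ne_zero_iff h).2 hP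
  have hfin : (Set.range Q).Finite := by
    let F : HK p K → (Fin (P.natDegree + 1) → OFlat p) := fun σ i => galFlat p σ (P.coeff i)
    have h1 : (Set.range F).Finite :=
      (Set.Finite.pi' fun i : Fin (P.natDegree + 1) => (P.coeff i).2).subset <| by
        rintro _ ⟨σ, rfl⟩ i
        exact ⟨σ, rfl⟩
    refine (h1.image fun f => ∑ i : Fin (P.natDegree + 1), C (f i) * X ^ (i : ℕ)).subset ?_
    rintro _ ⟨σ, rfl⟩
    refine ⟨_, ⟨σ, rfl⟩, ?_⟩
    have : Q σ = ∑ i ∈ Finset.range (P.natDegree + 1),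
        C (galFlat p σ (P.coeff i)) * X ^ i := by
      rw [as_sum_range_C_mul_X_pow' (Q σ) (n := P.natDegree + 1)
        (Nat.lt_succ_of_le natDegree_map_le)]
      simp [Q]
    rw [this, Finset.sum_range]
  refine (hfin.biUnion fun q _ => q.roots.toFinset.finite_toSet).subset ?_
  rintro _ ⟨σ, rfl⟩
  refine Set.mem_iUnion₂.2 ⟨Q σ, ⟨σ, rfl⟩, ?_⟩
  simp only [Finset.mem_coe, Multiset.mem_toFinset]
  rw [mem_roots (hQ0 σ), IsRoot, eval_map, ← hom_eval₂, hx, map_zero]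

theorem mem_finiteOrbit_of_mul_mem {x y : OFlat p} (hx : x ∈ finiteOrbit p K) (hx0 : x ≠ 0)
    (h : x * y ∈ finiteOrbit p K) : y ∈ finiteOrbit p K := by
  refine mem_finiteOrbit_of_root (C ⟨x, hx⟩ * X - C ⟨x * y, h⟩) (fun h0 => hx0 ?_) y (by simp)
  have := congrArg (fun q => q.coeff 1) h0
  simpa [coeff_C] using congrArg Subtype.val this

/-- A quotient of elements of finite orbit is a root of a linear polynomial over `finiteOrbit p K`,
so it has finite orbit. The valuation ring property is thereby inherited from the tilt. -/
theorem finiteOrbit_dvd_iff (x y : finiteOrbit p K) : x ∣ y ↔ (x : OFlat p) ∣ y := by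
  refine ⟨fun h => map_dvd (finiteOrbit p K).subtype h, ?_⟩
  rintro ⟨c, hc⟩
  by_cases hx : (x : OFlat p) = 0
  · rw [hx, zero_mul] at hc
    rw [show y = 0 from Subtype.ext hc]
    exact dvd_zero x
  · exact ⟨⟨c, mem_finiteOrbit_of_mul_mem x.2 hx (hc ▸ y.2)⟩, Subtype.ext hc⟩

theorem finiteOrbit_isUnit_iff (x : finiteOrbit p K) : IsUnit x ↔ IsUnit (x : OFlat p) := by
  rw [isUnit_iff_dvd_one, isUnit_iff_dvd_one, finiteOrbit_dvd_iff]
  rfl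

instance valuationRing_finiteOrbit : ValuationRing (finiteOrbit p K) :=
  ValuationRing.iff_dvd_total.2 ⟨fun x y => by
    rw [finiteOrbit_dvd_iff, finiteOrbit_dvd_iff]
    exact ValuationRing.dvd_total _ _⟩

instance charP_finiteOrbit : CharP (finiteOrbit p K) p :=
  RingHom.charP (finiteOrbit p K).subtype Subtype.val_injective p

instance perfectRing_finiteOrbit : PerfectRing (finiteOrbit p K) p :=
  PerfectRing.ofSurjective _ p fun x =>
    ⟨⟨_, frobeniusEquiv_symm_mem x.2⟩, Subtype.ext (by
      rw [frobenius_def, SubmonoidClass.coe_pow, ← frobenius_def p, ← frobeniusEquiv_apply,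
        RingEquiv.apply_symm_apply])⟩

end galois

/-! ## A generator of the kernel of `𝒪_{ℂ_p}^♭ → 𝒪_{ℂ_p} / p` -/

section kernel

variable {p : ℕ} [Fact p.Prime] (ε : RootSystem p) (K : IntermediateField ℚ_[p] (PadicAlgCl p))

theorem untiltRoot_flat (n : ℕ) : untiltRoot n ε.flat = ε.int n := by
  obtain ⟨x, hx⟩ := exists_untiltRoot_eq ε.int fun n => Subtype.ext <| by
    change (ε.root (n + 1) : ℂ_[p]) ^ p = (ε.root n : ℂ_[p])
    rw [PadicComplex.coe_eq, PadicComplex.coe_eq, ← map_pow, ε.root_succ]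
  have : x = ε.flat := Perfection.ext fun n => by
    change PreTilt.coeff n x = Ideal.Quotient.mk _ (ε.int n)
    rw [← mk_untiltRoot, hx]
  rw [← this, hx]

/-- The `p`-th root of `ε` in `𝒪_{ℂ_p}^♭`. -/
def RootSystem.flatRoot : finiteOrbit p K :=
  ⟨(frobeniusEquiv (OFlat p) p).symm ε.flat, frobeniusEquiv_symm_mem <|
    mem_finiteOrbit_of_forall fun _ hσ => galFlat_flat ε hσ⟩

theorem flatRoot_pow : (ε.flatRoot K : OFlat p) ^ p = ε.flat := by
  rw [← frobenius_def p, ← frobeniusEquiv_apply]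
  exact RingEquiv.apply_symm_apply _ _

theorem untiltRoot_flatRoot (n : ℕ) :
    untiltRoot n (ε.flatRoot K : OFlat p) = ε.int (n + 1) := by
  rw [← untiltRoot_pow, ← map_pow, flatRoot_pow, untiltRoot_flat]

/-- The element `1 + ε ^ (1 / p) + ⋯ + ε ^ ((p - 1) / p)`. -/
def RootSystem.pFlat : finiteOrbit p K := ∑ i ∈ Finset.range p, ε.flatRoot K ^ i

/-- The element `1 + [ε ^ (1 / p)] + ⋯ + [ε ^ ((p - 1) / p)]`. -/
def RootSystem.xi : WittVector p (finiteOrbit p K) :=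
  ∑ i ∈ Finset.range p, WittVector.teichmuller p (ε.flatRoot K) ^ i

variable (p) in
/-- The restriction of Fontaine's map `θ` to `W(finiteOrbit p K)`. -/
def thetaFin : WittVector p (finiteOrbit p K) →+* 𝓞_ℂ_[p] :=
  (WittVector.fontaineTheta 𝓞_ℂ_[p] p).comp (WittVector.map (finiteOrbit p K).subtype)

variable {K}

theorem thetaFin_teichmuller (x : finiteOrbit p K) :
    thetaFin p K (WittVector.teichmuller p x) = (x : OFlat p).untilt := by
  rw [thetaFin, RingHom.comp_apply, WittVector.map_teichmuller,
    WittVector.fontaineTheta_teichmuller]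
  rfl

theorem mk_thetaFin (x : WittVector p (finiteOrbit p K)) :
    Ideal.Quotient.mk _ (thetaFin p K x) = PreTilt.coeff 0 (x.coeff 0 : OFlat p) := by
  rw [thetaFin, RingHom.comp_apply, WittVector.mk_fontaineTheta, WittVector.map_coeff]
  rfl

variable (K)

/-- The value is the geometric sum of `ε⁽¹⁾`, a `p`-th root of unity different from `1`. -/
theorem thetaFin_xi : thetaFin p K (ε.xi K) = 0 := by
  rw [RootSystem.xi, map_sum]
  simp only [map_pow, thetaFin_teichmuller, ← untiltRoot_zero, untiltRoot_flatRoot]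
  have h1 : ε.int 1 ≠ 1 := fun h => ε.root_one <| by
    have := congrArg Subtype.val h
    exact UniformSpace.Completion.coe_injective _ this
  have h2 : ε.int 1 ^ p = 1 := Subtype.ext <| by
    change (ε.root 1 : ℂ_[p]) ^ p = 1
    rw [PadicComplex.coe_eq, ← map_pow, ε.root_succ, ε.root_zero, map_one]
  have h3 := geom_sum_mul (ε.int (0 + 1)) p
  rw [zero_add, h2, sub_self] at h3
  exact (mul_eq_zero.1 h3).resolve_right (sub_ne_zero.2 h1)

theorem not_isUnit_of_coeff_zero {x : OFlat p} (h : PreTilt.coeff 0 x = 0) : ¬ IsUnit x := fun hx =>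
  not_isUnit_zero (h ▸ hx.map (PreTilt.coeff 0))

theorem not_isUnit_flatRoot_sub_one : ¬ IsUnit ((ε.flatRoot K : OFlat p) - 1) := by
  intro h
  refine not_isUnit_of_coeff_zero (x := ((ε.flatRoot K : OFlat p) - 1) ^ p) ?_ (h.pow p)
  rw [sub_pow_char, flatRoot_pow, one_pow, map_sub, ← mk_untiltRoot, untiltRoot_flat, map_one,
    ← map_one (Ideal.Quotient.mk _), ← map_sub]
  convert map_zero (Ideal.Quotient.mk (Ideal.span {((p : ℕ) : 𝓞_ℂ_[p])}))
  rw [sub_eq_zero]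
  refine Subtype.ext ?_
  change (ε.root 0 : ℂ_[p]) = 1
  rw [ε.root_zero, PadicComplex.coe_eq, map_one]

/-- Over the residue field `ε ^ (1 / p)` becomes `1`, so `ξ` becomes `p` and `pFlat` becomes `0`.
Comparing Witt components of index `1` in the resulting `p = p * v` shows that `v` is a unit.
Together with `θ(ξ) = 0` this makes the untilt of `pFlat` a unit times `p`. -/
theorem exists_xi_eq : ∃ v : WittVector p (finiteOrbit p K), IsUnit v ∧
    ε.xi K = WittVector.teichmuller p (ε.pFlat K) + p * v := by
  have h0 : (ε.xi K - WittVector.teichmuller p (ε.pFlat K)).coeff 0 = 0 := by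
    rw [← WittVector.constantCoeff_apply]
    rw [map_sub, RootSystem.xi, map_sum]
    simp only [map_pow]
    rw [WittVector.constantCoeff_apply, WittVector.constantCoeff_apply, WittVector.teichmuller_coeff_zero, WittVector.teichmuller_coeff_zero, RootSystem.pFlat,
      sub_self]
  rw [← WittVector.mem_span_p_iff_coeff_zero_eq_zero, Ideal.mem_span_singleton] at h0
  obtain ⟨v, hv⟩ := h0
  have hv' : ε.xi K = WittVector.teichmuller p (ε.pFlat K) + p * v := by rw [← hv]; ring
  refine ⟨v, ?_, hv'⟩
  let ψ : finiteOrbit p K →+* IsLocalRing.ResidueField (OFlat p) :=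
    (IsLocalRing.residue _).comp (finiteOrbit p K).subtype
  have : CharP (IsLocalRing.ResidueField (OFlat p)) p :=
    (RingHom.charP_iff_charP ((IsLocalRing.residue (OFlat p)).comp
      (ZMod.castHom dvd_rfl (OFlat p))) p).1 inferInstance
  have hψ1 : ψ (ε.flatRoot K) = 1 := by
    have := not_isUnit_flatRoot_sub_one ε K
    rw [← IsLocalRing.residue_ne_zero_iff_isUnit, not_not, map_sub, map_one, sub_eq_zero] at this
    exact this
  have h1 := congrArg (WittVector.map ψ) hv'
  rw [RootSystem.xi, RootSystem.pFlat, map_add, map_mul, map_sum, WittVector.map_teichmuller, map_sum] at h1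
  simp only [map_pow, WittVector.map_teichmuller, hψ1, map_one, one_pow, Finset.sum_const,
    Finset.card_range, nsmul_eq_mul, mul_one, CharP.cast_eq_zero, WittVector.teichmuller_zero,
    zero_add, map_natCast] at h1
  have h2 := congrArg (fun x => WittVector.coeff x 1) h1
  have h3 : (p : WittVector p (IsLocalRing.ResidueField (OFlat p))) = 1 * p := by rw [one_mul]
  rw [mul_comm (p : WittVector p (IsLocalRing.ResidueField (OFlat p))), h3, ← mul_assoc, mul_one,
    WittVector.mul_charP_coeff_succ, WittVector.mul_charP_coeff_succ, WittVector.one_coeff_zero,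
    one_pow, WittVector.map_coeff] at h2
  have h4 : ψ (v.coeff 0) ≠ 0 := fun h => by
    rw [h, zero_pow (Fact.out : p.Prime).ne_zero] at h2
    exact one_ne_zero h2
  have h5 : IsUnit (v.coeff 0) := by
    rw [finiteOrbit_isUnit_iff, ← IsLocalRing.residue_ne_zero_iff_isUnit]
    exact h4
  obtain ⟨a, ha⟩ := h5
  exact ⟨WittVector.mkUnit ha.symm, rfl⟩

theorem exists_untilt_pFlat_eq : ∃ v : WittVector p (finiteOrbit p K), IsUnit v ∧
    thetaFin p K (WittVector.teichmuller p (ε.pFlat K)) = p * thetaFin p K v := by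
  obtain ⟨v, hv, h⟩ := exists_xi_eq ε K
  refine ⟨-v, hv.neg, ?_⟩
  have := congrArg (thetaFin p K) h
  rw [thetaFin_xi, map_add, map_mul, map_natCast] at this
  rw [map_neg, mul_neg, eq_neg_iff_add_eq_zero, ← this]

theorem pFlat_dvd_iff (x : OFlat p) :
    (ε.pFlat K : OFlat p) ∣ x ↔ PreTilt.coeff 0 x = 0 := by
  obtain ⟨v, hv, h⟩ := exists_untilt_pFlat_eq ε K
  rw [thetaFin_teichmuller] at h
  rw [← untilt_dvd_untilt, h, (hv.map (thetaFin p K)).mul_right_dvd,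
    ← PreTilt.mk_untilt_eq_coeff_zero, Ideal.Quotient.eq_zero_iff_mem, Ideal.mem_span_singleton]

theorem pFlat_ne_zero : (ε.pFlat K : OFlat p) ≠ 0 := by
  obtain ⟨v, hv, h⟩ := exists_untilt_pFlat_eq ε K
  rw [thetaFin_teichmuller] at h
  rw [Ne, ← untilt_eq_zero, h]
  exact mul_ne_zero (natCast_p_ne_zero p) (hv.map (thetaFin p K)).ne_zero

/-- Component `n` of `y ^ p ^ n` is component `0` of `y`, which reduces the claim to
`pFlat_dvd_iff`. The `pFlat`-adic topology is thus the inverse limit topology. -/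
theorem pFlat_pow_dvd_iff (n : ℕ) (x : OFlat p) :
    (ε.pFlat K : OFlat p) ^ p ^ n ∣ x ↔ PreTilt.coeff n x = 0 := by
  obtain ⟨y, rfl⟩ := (iterateFrobeniusEquiv (OFlat p) p n).surjective x
  rw [iterateFrobeniusEquiv_def]
  have h1 : PreTilt.coeff n (y ^ p ^ n) = PreTilt.coeff 0 y := by
    have := PreTilt.coeff_iterate_frobenius 0 n y
    rwa [zero_add, iterate_frobenius] at this
  rw [h1, ← pFlat_dvd_iff ε K]
  exact ⟨dvd_of_pow_dvd_pow (pow_ne_zero n (Fact.out : p.Prime).ne_zero) (pFlat_ne_zero ε K),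
    fun h => pow_dvd_pow_of_dvd h _⟩

theorem isAdicComplete_flat : IsAdicComplete (Ideal.span {(ε.pFlat K : OFlat p)}) (OFlat p) where
  haus' x hx := by
    refine Perfection.ext fun n => ?_
    have := hx (p ^ n)
    rw [SModEq.zero, Ideal.span_singleton_pow, smul_eq_mul, Ideal.mul_top,
      Ideal.mem_span_singleton, pFlat_pow_dvd_iff] at this
    exact this
  prec' f hf := by
    have hf' : ∀ {m n}, m ≤ n → (ε.pFlat K : OFlat p) ^ m ∣ f n - f m := fun hmn => by
      have := hf hmn
      rwa [SModEq.sub_mem, Ideal.span_singleton_pow, smul_eq_mul, Ideal.mul_top,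
        Ideal.mem_span_singleton, dvd_sub_comm] at this
    have hp1 := (Fact.out : p.Prime).one_lt
    -- Component `n` sees an element only modulo `pFlat ^ p ^ n`, so it is read off from the term of
    -- index `p ^ n`.
    let L : OFlat p := (⟨fun n => PreTilt.coeff n (f (p ^ n)), fun n => by
      rw [PreTilt.coeff_pow_p, ← sub_eq_zero, ← map_sub, ← pFlat_pow_dvd_iff ε K]
      exact hf' (Nat.pow_le_pow_right hp1.le (Nat.le_succ n))⟩ : Perfection (ModP 𝓞_ℂ_[p] p) p)
    have hL : ∀ n, PreTilt.coeff n L = PreTilt.coeff n (f (p ^ n)) := fun n => rfl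
    refine ⟨L, fun n => ?_⟩
    rw [SModEq.sub_mem, Ideal.span_singleton_pow, smul_eq_mul, Ideal.mul_top,
      Ideal.mem_span_singleton, dvd_sub_comm]
    have hn : n ≤ p ^ n := (Nat.lt_pow_self hp1).le
    have h1 : (ε.pFlat K : OFlat p) ^ n ∣ L - f (p ^ n) :=
      (pow_dvd_pow _ hn).trans ((pFlat_pow_dvd_iff ε K n _).2 (by rw [map_sub, hL, sub_self]))
    have := dvd_add h1 (hf' hn)
    rwa [sub_add_sub_cancel] at this

include ε K in
-- The tilt and `𝒪_{ℂ_p}` have the common quotient `𝒪_{ℂ_p} / p`, and monic polynomials over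
-- `𝒪_{ℂ_p}` have roots because `ℂ_p` is algebraically closed.
theorem flat_exists_root (P : (OFlat p)[X]) (hP : P.Monic) (hd : P.natDegree ≠ 0) :
    ∃ x, P.eval x = 0 := by
  have := isAdicComplete_flat ε K
  have : IsLocalHom (Ideal.Quotient.mk (Ideal.span {((p : ℕ) : 𝓞_ℂ_[p])})) :=
    isLocalHom_of_le_jacobson_bot _ (IsAdicComplete.le_jacobson_bot _)
  exact exists_root_of_surjective (W := 𝓞_ℂ_[p]) (pFlat_ne_zero ε K) (PreTilt.coeff 0)
    coeff_zero_surjective (fun x => (pFlat_dvd_iff ε K x).2)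
    (fun g _ i hi => flat_exists_associated_pow g i hi) (int_exists_root p)
    (Ideal.Quotient.mk _) Ideal.Quotient.mk_surjective P hP hd

include ε in
theorem finiteOrbit_exists_root (P : (finiteOrbit p K)[X]) (hP : P.Monic) (hd : P.natDegree ≠ 0) :
    ∃ x, P.eval x = 0 := by
  obtain ⟨x, hx⟩ := flat_exists_root ε K (P.map (finiteOrbit p K).subtype) (hP.map _)
    (by rwa [hP.natDegree_map])
  rw [eval_map] at hx
  refine ⟨⟨x, mem_finiteOrbit_of_root P hP.ne_zero x hx⟩, Subtype.val_injective ?_⟩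
  have := P.hom_eval₂ (RingHom.id _) (finiteOrbit p K).subtype
    ⟨x, mem_finiteOrbit_of_root P hP.ne_zero x hx⟩
  rw [RingHom.comp_id] at this
  exact this.trans hx

end kernel

/-! ### The image of `W(finiteOrbit p K)` under `θ`, and density of elements of finite orbit -/

section thetaRange

variable {p : ℕ} [Fact p.Prime] (ε : RootSystem p) (K : IntermediateField ℚ_[p] (PadicAlgCl p))

variable (p) in
/-- The image of `W(finiteOrbit p K)` under Fontaine's map `θ`. -/
abbrev thetaRange : Subring 𝓞_ℂ_[p] := (thetaFin p K).range

variable (p) in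
/-- Fontaine's map `θ` as a map onto `thetaRange p K`. -/
abbrev thetaOnto : WittVector p (finiteOrbit p K) →+* thetaRange p K := (thetaFin p K).rangeRestrict

theorem witt_isUnit_of_coeff_zero {w : WittVector p (finiteOrbit p K)} (h : IsUnit (w.coeff 0)) :
    IsUnit w := by
  obtain ⟨a, ha⟩ := h
  exact ⟨WittVector.mkUnit ha.symm, rfl⟩

theorem exists_eq_teichmuller_add (w : WittVector p (finiteOrbit p K)) :
    ∃ w', w = WittVector.teichmuller p (w.coeff 0) + p * w' := by
  have h0 : (w - WittVector.teichmuller p (w.coeff 0)).coeff 0 = 0 := by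
    rw [← WittVector.constantCoeff_apply, map_sub, WittVector.constantCoeff_apply,
      WittVector.constantCoeff_apply, WittVector.teichmuller_coeff_zero, sub_self]
  rw [← WittVector.mem_span_p_iff_coeff_zero_eq_zero, Ideal.mem_span_singleton] at h0
  obtain ⟨v, hv⟩ := h0
  exact ⟨v, by rw [← hv]; ring⟩

include ε in
-- Write `w = [x] + p * w'`. If `pFlat` divides `x`, then `p` divides `θ([x])`. Otherwise `pFlat = x
-- * f` with `f` a nonunit, so `p` is `θ([x]) * θ([f])` up to a unit, and the second summand only
-- changes `θ([x])` by a factor of the form `1 + [f] * ⋯`, a unit.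
theorem thetaOnto_associated_aux (w : WittVector p (finiteOrbit p K)) :
    (∃ e, e ≠ 0 ∧ Associated (thetaOnto p K w) (thetaOnto p K (WittVector.teichmuller p e))) ∨
      ∃ w', thetaOnto p K w = p * thetaOnto p K w' := by
  obtain ⟨v, hv, h⟩ := exists_untilt_pFlat_eq ε K
  have h' : thetaOnto p K (WittVector.teichmuller p (ε.pFlat K)) = p * thetaOnto p K v :=
    Subtype.ext h
  obtain ⟨w', hw⟩ := exists_eq_teichmuller_add K w
  set x := w.coeff 0
  by_cases hx : ε.pFlat K ∣ x
  · obtain ⟨f, hf⟩ := hx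
    refine Or.inr ⟨v * WittVector.teichmuller p f + w', ?_⟩
    rw [hw, hf, map_mul, map_add, map_mul, h', map_mul, map_natCast, map_add, map_mul]
    ring
  · obtain ⟨f, hf⟩ := (ValuationRing.dvd_total _ _).resolve_left hx
    have hfu : ¬ IsUnit f := fun hfu => hx (hf ▸ (hfu.mul_right_dvd.2 dvd_rfl))
    obtain ⟨vi, hvi⟩ := hv.exists_right_inv
    refine Or.inl ⟨x, fun h0 => hx (h0 ▸ dvd_zero _), ?_⟩
    have hu : IsUnit (1 + WittVector.teichmuller p f * (vi * w')) := by
      refine witt_isUnit_of_coeff_zero K ?_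
      rw [← WittVector.constantCoeff_apply, map_add, map_one, map_mul,
        WittVector.constantCoeff_apply, WittVector.teichmuller_coeff_zero]
      by_contra hn
      have h1 := IsLocalRing.nonunits_add hn
        (mul_mem_nonunits_left (b := -WittVector.constantCoeff (vi * w')) hfu)
      refine h1 ?_
      simp
    have h2 : thetaOnto p K w = thetaOnto p K (WittVector.teichmuller p x) *
        thetaOnto p K (1 + WittVector.teichmuller p f * (vi * w')) := by
      have h3 : (p : thetaRange p K) = thetaOnto p K (WittVector.teichmuller p (ε.pFlat K)) *
          thetaOnto p K vi := by
        rw [h', mul_assoc, ← map_mul, hvi, map_one, mul_one]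
      rw [hw, map_add, map_mul, map_natCast, h3, hf, map_mul, map_mul, map_add, map_one, map_mul,
        map_mul]
      ring
    rw [h2]
    exact associated_mul_unit_left _ _ (hu.map _)

include ε in
-- Apply the dichotomy repeatedly: either it stops after `n` divisions by `p`, each contributing a
-- factor `pFlat`, or `θ(w)` is divisible by all powers of `p` and vanishes. Divisibility in
-- `thetaRange p K` is thereby reduced to divisibility in `finiteOrbit p K`.
theorem thetaOnto_associated (w : WittVector p (finiteOrbit p K)) (hw : thetaOnto p K w ≠ 0) :
    ∃ e, e ≠ 0 ∧ Associated (thetaOnto p K w) (thetaOnto p K (WittVector.teichmuller p e)) := by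
  obtain ⟨v, hv, h⟩ := exists_untilt_pFlat_eq ε K
  have h' : thetaOnto p K (WittVector.teichmuller p (ε.pFlat K)) = p * thetaOnto p K v :=
    Subtype.ext h
  by_contra hne
  have key : ∀ n : ℕ, ∃ w', thetaOnto p K w = p ^ n * thetaOnto p K w' := fun n => by
    induction n with
    | zero => exact ⟨w, by simp⟩
    | succ n ih =>
      obtain ⟨w', hw'⟩ := ih
      rcases thetaOnto_associated_aux ε K w' with ⟨e, he0, he⟩ | ⟨w'', hw''⟩
      · refine absurd ⟨ε.pFlat K ^ n * e, mul_ne_zero (pow_ne_zero n fun h0 =>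
          pFlat_ne_zero ε K (congrArg Subtype.val h0)) he0, ?_⟩ hne
        rw [hw', map_mul, map_mul, map_pow, map_pow, h', mul_pow]
        exact Associated.mul_mul (associated_mul_unit_right _ _ ((hv.map _).pow n)) he
      · exact ⟨w'', by rw [hw', hw'', pow_succ, mul_assoc]⟩
  refine hw (Subtype.ext (IsHausdorff.haus
    (I := Ideal.span {((p : ℕ) : 𝓞_ℂ_[p])}) inferInstance _ fun n => ?_))
  obtain ⟨w', hw'⟩ := key n
  rw [SModEq.zero, Ideal.span_singleton_pow, smul_eq_mul, Ideal.mul_top,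
    Ideal.mem_span_singleton]
  exact ⟨thetaFin p K w', congrArg Subtype.val hw'⟩

include ε in
theorem valuationRing_thetaRange : ValuationRing (thetaRange p K) := by
  refine ValuationRing.iff_dvd_total.2 ⟨fun x y => ?_⟩
  obtain ⟨x, rfl⟩ := (thetaFin p K).rangeRestrict_surjective x
  obtain ⟨y, rfl⟩ := (thetaFin p K).rangeRestrict_surjective y
  by_cases hx : thetaOnto p K x = 0
  · exact Or.inr (hx ▸ dvd_zero _)
  by_cases hy : thetaOnto p K y = 0
  · exact Or.inl (hy ▸ dvd_zero _)
  obtain ⟨e, -, he⟩ := thetaOnto_associated ε K x hx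
  obtain ⟨f, -, hf⟩ := thetaOnto_associated ε K y hy
  rw [he.dvd_iff_dvd_left, hf.dvd_iff_dvd_right, he.dvd_iff_dvd_right, hf.dvd_iff_dvd_left]
  exact (ValuationRing.dvd_total e f).imp (fun h => map_dvd _ (map_dvd _ h))
    (fun h => map_dvd _ (map_dvd _ h))

/-- Cauchy sequences lift to `W(finiteOrbit p K)`, which is `p`-adically complete because
`finiteOrbit p K` is perfect; separatedness comes from `𝒪_{ℂ_p}`. -/
theorem isAdicComplete_thetaRange :
    IsAdicComplete (Ideal.span {(p : thetaRange p K)}) (thetaRange p K) where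
  haus' x hx := by
    refine Subtype.ext (IsHausdorff.haus
      (I := Ideal.span {((p : ℕ) : 𝓞_ℂ_[p])}) inferInstance _ fun n => ?_)
    have := hx n
    rw [SModEq.zero, Ideal.span_singleton_pow, smul_eq_mul, Ideal.mul_top,
      Ideal.mem_span_singleton] at this ⊢
    simpa using map_dvd (thetaRange p K).subtype this
  prec' f hf := by
    have hf' : ∀ {m n}, m ≤ n → (p : thetaRange p K) ^ m ∣ f n - f m := fun hmn => by
      have := hf hmn
      rwa [SModEq.sub_mem, Ideal.span_singleton_pow, smul_eq_mul, Ideal.mul_top,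
        Ideal.mem_span_singleton, dvd_sub_comm] at this
    have hsurj : Function.Surjective (thetaOnto p K) := (thetaFin p K).rangeRestrict_surjective
    have hd : ∀ n, ∃ w, f (n + 1) - f n = p ^ n * thetaOnto p K w := fun n => by
      obtain ⟨c, hc⟩ := hf' (Nat.le_succ n)
      obtain ⟨w, rfl⟩ := hsurj c
      exact ⟨w, hc⟩
    choose d hd using hd
    obtain ⟨w₀, hw₀⟩ := hsurj (f 0)
    let F : ℕ → WittVector p (finiteOrbit p K) :=
      fun n => w₀ + ∑ i ∈ Finset.range n, p ^ i * d i
    have hF : ∀ n, thetaOnto p K (F n) = f n := fun n => by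
      induction n with
      | zero => simp [F, hw₀]
      | succ n ih =>
        have : F (n + 1) = F n + p ^ n * d n := by simp [F, Finset.sum_range_succ, add_assoc]
        rw [this, map_add, ih, map_mul, map_pow, map_natCast, ← hd]
        ring
    obtain ⟨L, hL⟩ := IsPrecomplete.prec
      (I := Ideal.span {(p : WittVector p (finiteOrbit p K))}) inferInstance (f := F)
      (fun {m n} hmn => by
        rw [SModEq.sub_mem, Ideal.span_singleton_pow, smul_eq_mul, Ideal.mul_top,
          Ideal.mem_span_singleton, dvd_sub_comm]
        have : F n - F m = ∑ i ∈ Finset.Ico m n, p ^ i * d i := by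
          rw [Finset.sum_Ico_eq_sub _ hmn]; simp [F]
        rw [this]
        exact Finset.dvd_sum fun i hi => (pow_dvd_pow _ (Finset.mem_Ico.1 hi).1).mul_right _)
    refine ⟨thetaOnto p K L, fun n => ?_⟩
    have := hL n
    rw [SModEq.sub_mem, Ideal.span_singleton_pow, smul_eq_mul, Ideal.mul_top,
      Ideal.mem_span_singleton] at this ⊢
    have h2 := map_dvd (thetaOnto p K) this
    rwa [map_sub, hF, map_pow, map_natCast] at h2

theorem natCast_p_dvd_thetaOnto {w : WittVector p (finiteOrbit p K)} (hw : w.coeff 0 = 0) :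
    (p : thetaRange p K) ∣ thetaOnto p K w := by
  rw [← WittVector.mem_span_p_iff_coeff_zero_eq_zero, Ideal.mem_span_singleton] at hw
  have := map_dvd (thetaOnto p K) hw
  rwa [map_natCast] at this

variable (p) in
/-- The reduction of `θ` modulo `p`. -/
def thetaMod : finiteOrbit p K →+* thetaRange p K ⧸ Ideal.span {(p : thetaRange p K)} :=
  RingHom.liftOfSurjective (WittVector.constantCoeff : WittVector p (finiteOrbit p K) →+* _)
    (WittVector.constantCoeff_surjective p)
    ⟨(Ideal.Quotient.mk _).comp (thetaOnto p K), fun w hw => by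
      rw [RingHom.mem_ker, RingHom.comp_apply, Ideal.Quotient.eq_zero_iff_mem,
        Ideal.mem_span_singleton]
      exact natCast_p_dvd_thetaOnto K hw⟩

theorem thetaMod_coeff_zero (w : WittVector p (finiteOrbit p K)) :
    thetaMod p K (w.coeff 0) = Ideal.Quotient.mk _ (thetaOnto p K w) :=
  RingHom.liftOfSurjective_comp_apply _ _ _ w

include ε in
-- Transfer in the direction opposite to `flat_exists_root`: roots over `finiteOrbit p K` are
-- carried to `thetaRange p K` along `thetaMod`. Divisibility of the value group holds because
-- nonzero elements are Teichmüller images up to units and `finiteOrbit p K` has `i`-th roots.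
theorem thetaRange_exists_root (P : (thetaRange p K)[X]) (hP : P.Monic) (hd : P.natDegree ≠ 0) :
    ∃ x, P.eval x = 0 := by
  have := valuationRing_thetaRange ε K
  have := isAdicComplete_thetaRange (p := p) K
  have hloc : IsLocalHom (Ideal.Quotient.mk (Ideal.span {(p : thetaRange p K)})) :=
    isLocalHom_of_le_jacobson_bot _ (IsAdicComplete.le_jacobson_bot _)
  have hsurj : Function.Surjective (thetaOnto p K) := (thetaFin p K).rangeRestrict_surjective
  have hp0 : (p : thetaRange p K) ≠ 0 := fun h =>
    natCast_p_ne_zero p (by simpa using congrArg Subtype.val h)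
  have hnu : ¬ IsUnit (p : thetaRange p K) := fun h =>
    (not_isUnit_p p).1 (by simpa using h.map (thetaRange p K).subtype)
  have : Nontrivial (thetaRange p K ⧸ Ideal.span {(p : thetaRange p K)}) :=
    Ideal.Quotient.nontrivial_iff.2 (by rwa [Ne, Ideal.span_singleton_eq_top])
  -- Tested on Teichmüller lifts: `θ([d])` is the untilt of `d`, and untilting detects units.
  have : IsLocalHom (thetaMod p K) := ⟨fun d hd => by
    have h1 : thetaMod p K d = Ideal.Quotient.mk _
        (thetaOnto p K (WittVector.teichmuller p d)) := by
      rw [← thetaMod_coeff_zero, WittVector.teichmuller_coeff_zero]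
    rw [h1] at hd
    have h2 := (isUnit_of_map_unit _ _ hd).map (thetaRange p K).subtype
    have h3 : IsUnit (d : OFlat p).untilt := by
      rw [← thetaFin_teichmuller]; exact h2
    rw [finiteOrbit_isUnit_iff, isUnit_iff_dvd_one, ← untilt_dvd_untilt, map_one,
      ← isUnit_iff_dvd_one]
    exact h3⟩
  refine exists_root_of_surjective (W := finiteOrbit p K) hp0 (Ideal.Quotient.mk _)
    Ideal.Quotient.mk_surjective
    (fun x hx => by rwa [Ideal.Quotient.eq_zero_iff_mem, Ideal.mem_span_singleton] at hx)
    (fun g hg i hi => ?_) (finiteOrbit_exists_root ε K) (thetaMod p K) (fun y => ?_) P hP hd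
  · obtain ⟨w, rfl⟩ := hsurj g
    obtain ⟨e, he0, he⟩ := thetaOnto_associated ε K w hg
    obtain ⟨f, hf⟩ := finiteOrbit_exists_root ε K (X ^ i - C e) (monic_X_pow_sub_C e hi)
      (by rwa [natDegree_X_pow_sub_C])
    refine ⟨thetaOnto p K (WittVector.teichmuller p f), ?_⟩
    have : f ^ i = e := by simpa [sub_eq_zero] using hf
    rw [← map_pow, ← map_pow, this]
    exact he.symm
  · obtain ⟨z, rfl⟩ := Ideal.Quotient.mk_surjective y
    obtain ⟨w, rfl⟩ := hsurj z
    exact ⟨w.coeff 0, thetaMod_coeff_zero K w⟩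

/-- Integers of `ℚ̄_p` are approximate roots of monic polynomials over `ℤ`. -/
theorem exists_approx_minpoly (y : PadicAlgCl p) (hy : ‖y‖ ≤ 1) :
    ∃ P : ℤ[X], P.Monic ∧ P.natDegree ≠ 0 ∧
      ‖P.eval₂ (Int.castRingHom (PadicAlgCl p)) y‖ ≤ ‖(p : ℂ_[p])‖ ^ P.natDegree := by
  have hint : IsIntegral ℚ_[p] y := Algebra.IsIntegral.isIntegral y
  set d := (minpoly ℚ_[p] y).natDegree with hd
  have hd0 : d ≠ 0 := (minpoly.natDegree_pos hint).ne'
  have hc : ∀ n, ‖(minpoly ℚ_[p] y).coeff n‖ ≤ 1 :=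
    (spectralValue_le_one_iff (minpoly.monic hint)).1 hy
  have hlt : ‖(p : ℂ_[p])‖ = (p : ℝ)⁻¹ := norm_natCast_p p
  -- The coefficients of the minimal polynomial lie in `ℤ_p`; precision `‖p‖ ^ d` is chosen so that
  -- one of `d` linear factors will have norm at most `‖p‖`.
  have happ : ∀ n, ∃ a : ℤ, ‖(a : ℚ_[p]) - (minpoly ℚ_[p] y).coeff n‖ ≤ ‖(p : ℂ_[p])‖ ^ d :=
    fun n => by
      obtain ⟨c, hcn⟩ : ∃ c : ℤ_[p], (c : ℚ_[p]) = (minpoly ℚ_[p] y).coeff n := ⟨⟨_, hc n⟩, rfl⟩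
      obtain ⟨a, ha⟩ := PadicInt.denseRange_intCast.exists_dist_lt c (ε := ‖(p : ℂ_[p])‖ ^ d) (by
          rw [hlt]; exact pow_pos (inv_pos.2 (by exact_mod_cast (Fact.out : p.Prime).pos)) _)
      refine ⟨a, ?_⟩
      rw [dist_comm, dist_eq_norm] at ha
      rw [← hcn]
      rw [PadicInt.norm_def] at ha
      push_cast at ha
      exact ha.le
  choose a ha using happ
  set q : ℤ[X] := ∑ i ∈ Finset.range d, C (a i) * X ^ i with hq
  have hqdeg : q.degree < d := by
    refine (degree_sum_le _ _).trans_lt ?_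
    rw [Finset.sup_lt_iff (by exact_mod_cast WithBot.bot_lt_coe d)]
    intro i hi
    exact (degree_C_mul_X_pow_le _ _).trans_lt (by exact_mod_cast Finset.mem_range.1 hi)
  have hdeg : (X ^ d + q).natDegree = d := by
    rw [natDegree_add_eq_left_of_degree_lt (by rwa [degree_X_pow]), natDegree_X_pow]
  refine ⟨X ^ d + q, monic_X_pow_add hqdeg, by rwa [hdeg], ?_⟩
  have h1 := minpoly.aeval ℚ_[p] y
  rw [aeval_eq_sum_range, Finset.sum_range_succ, ← hd, (minpoly.monic hint).coeff_natDegree,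
    one_smul] at h1
  have h2 : (X ^ d + q).eval₂ (Int.castRingHom (PadicAlgCl p)) y =
      ∑ i ∈ Finset.range d, ((a i : ℚ_[p]) - (minpoly ℚ_[p] y).coeff i) • y ^ i := by
    rw [← sub_zero (eval₂ _ _ _), ← h1, hq, eval₂_add, eval₂_pow, eval₂_X, eval₂_finsetSum,
      add_comm, add_sub_add_right_eq_sub, ← Finset.sum_sub_distrib]
    refine Finset.sum_congr rfl fun i _ => ?_
    rw [sub_smul, eval₂_mul, eval₂_C, eval₂_pow, eval₂_X, Algebra.smul_def (a i : ℚ_[p]),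
      map_intCast, eq_intCast]
  rw [h2, hdeg]
  refine IsUltrametricDist.norm_sum_le_of_forall_le_of_nonneg (pow_nonneg (norm_nonneg _) _)
    fun i _ => ?_
  rw [norm_smul, norm_pow]
  exact (mul_le_of_le_one_right (norm_nonneg _) (pow_le_one₀ (norm_nonneg _) hy)).trans (ha i)

theorem norm_sub_le_max_complex (x y : ℂ_[p]) : ‖x - y‖ ≤ max ‖x‖ ‖y‖ := by
  rw [sub_eq_add_neg, ← norm_neg y]
  exact IsUltrametricDist.norm_add_le_max x (-y)

include ε in
-- Approximate `z` by an integer `y` of `ℚ̄_p`, and `y` by a root of an integral polynomial that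
-- splits over `thetaRange p K`. This root is some `θ(w)`, and modulo `p` it depends only on
-- `w.coeff 0`.
theorem finiteOrbit_coeff_zero_surjective (z : 𝓞_ℂ_[p]) :
    ∃ x : finiteOrbit p K, PreTilt.coeff 0 (x : OFlat p) = Ideal.Quotient.mk _ z := by
  have hp0 : 0 < ‖(p : ℂ_[p])‖ := by
    rw [norm_natCast_p]; exact inv_pos.2 (by exact_mod_cast (Fact.out : p.Prime).pos)
  obtain ⟨y, hy⟩ := UniformSpace.Completion.denseRange_coe.exists_dist_lt (z : ℂ_[p]) hp0
  rw [dist_eq_norm] at hy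
  have hy1 : ‖(y : ℂ_[p])‖ ≤ 1 := by
    have : (y : ℂ_[p]) = z - (z - y) := by ring
    rw [this]
    refine (norm_sub_le_max_complex _ _).trans (max_le ((mem_int_iff p _).1 z.2) ?_)
    exact (hy.trans (norm_natCast_p_lt_one p)).le
  obtain ⟨P, hP, hd, hPy⟩ := exists_approx_minpoly y (by rwa [← PadicComplex.norm_extends])
  obtain ⟨s, hs⟩ := exists_multiset_prod_eq (thetaRange_exists_root ε K)
    (P.map (Int.castRingHom (thetaRange p K))) (hP.map _)
  let Y : 𝓞_ℂ_[p] := ⟨y, (mem_int_iff p _).2 hy1⟩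
  have hcard : Multiset.card s = P.natDegree := by
    rw [← hP.natDegree_map (Int.castRingHom (thetaRange p K)), hs,
      natDegree_multiset_prod_X_sub_C_eq_card]
  have hev : P.eval₂ (Int.castRingHom 𝓞_ℂ_[p]) Y = (s.map fun a : thetaRange p K => Y - (a : 𝓞_ℂ_[p])).prod := by
    have h1 := congrArg (eval₂ (thetaRange p K).subtype Y) hs
    have h2 : eval₂ (thetaRange p K).subtype Y (s.map fun a => X - C a).prod =
        (s.map fun a : thetaRange p K => Y - (a : 𝓞_ℂ_[p])).prod := by
      rw [← coe_eval₂RingHom, map_multiset_prod, Multiset.map_map]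
      simp [Function.comp_def]
    rw [h2, eval₂_map, RingHom.eq_intCast' ((thetaRange p K).subtype.comp _)] at h1
    exact h1
  -- If all factors had norm larger than `‖p‖`, their product would exceed `‖p‖ ^ P.natDegree`.
  have hex : ∃ a ∈ s, (p : 𝓞_ℂ_[p]) ∣ Y - (a : 𝓞_ℂ_[p]) := by
    by_contra! hne
    have h1 : ∀ t ≤ s, t ≠ 0 → ‖(p : ℂ_[p])‖ ^ Multiset.card t <
        ‖(((t.map fun a : thetaRange p K => Y - (a : 𝓞_ℂ_[p])).prod : 𝓞_ℂ_[p]) : ℂ_[p])‖ := by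
      intro t
      induction t using Multiset.induction_on with
      | empty => intro _ h; exact absurd rfl h
      | cons a t ih =>
        intro hle _
        have ha : ‖(p : ℂ_[p])‖ < ‖((Y - (a : 𝓞_ℂ_[p]) : 𝓞_ℂ_[p]) : ℂ_[p])‖ := by
          have := hne a (Multiset.mem_of_le hle (Multiset.mem_cons_self a t))
          rw [int_dvd_iff, not_le] at this
          exact this
        rw [Multiset.map_cons, Multiset.prod_cons, Multiset.card_cons, pow_succ',
          MulMemClass.coe_mul, norm_mul]
        by_cases ht : t = 0
        · simpa [ht] using ha
        · exact mul_lt_mul'' ha (ih ((Multiset.le_cons_self t a).trans hle) ht) hp0.le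
            (pow_nonneg hp0.le _)
    have h2 := h1 s le_rfl (by rintro rfl; simp at hcard; exact hd hcard.symm)
    rw [← hev, hcard] at h2
    have h3 : ((P.eval₂ (Int.castRingHom 𝓞_ℂ_[p]) Y : 𝓞_ℂ_[p]) : ℂ_[p]) =
        ((P.eval₂ (Int.castRingHom (PadicAlgCl p)) y : PadicAlgCl p) : ℂ_[p]) := by
      have h4 := P.hom_eval₂ (Int.castRingHom 𝓞_ℂ_[p]) (𝓞_ℂ_[p]).subtype Y
      have h5 := P.hom_eval₂ (Int.castRingHom (PadicAlgCl p))
        (algebraMap (PadicAlgCl p) ℂ_[p]) y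
      rw [RingHom.eq_intCast' (RingHom.comp _ _)] at h4 h5
      exact h4.trans h5.symm
    rw [h3, PadicComplex.norm_extends] at h2
    exact absurd hPy (not_le.2 h2)
  obtain ⟨⟨a, w, rfl⟩, -, ha⟩ := hex
  refine ⟨w.coeff 0, ?_⟩
  rw [← mk_thetaFin, Ideal.Quotient.eq, Ideal.mem_span_singleton, int_dvd_iff]
  rw [int_dvd_iff] at ha
  have : ((thetaFin p K w - z : 𝓞_ℂ_[p]) : ℂ_[p]) = -((Y - thetaFin p K w : 𝓞_ℂ_[p]) : ℂ_[p])
      - (z - y) := by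
    push_cast
    ring
  rw [this]
  refine (norm_sub_le_max_complex _ _).trans (max_le ?_ hy.le)
  rw [norm_neg]
  exact ha

/-- Approximate a `p ^ n`-th root of `x` modulo `pFlat` and apply Frobenius `n` times. -/
theorem exists_finiteOrbit_approx (x : OFlat p) (n : ℕ) :
    ∃ y ∈ finiteOrbit p K, (ε.pFlat K : OFlat p) ^ p ^ n ∣ x - y := by
  obtain ⟨x, rfl⟩ := (iterateFrobeniusEquiv (OFlat p) p n).surjective x
  rw [iterateFrobeniusEquiv_def]
  obtain ⟨y, hy⟩ := finiteOrbit_coeff_zero_surjective ε K x.untilt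
  refine ⟨(y : OFlat p) ^ p ^ n, pow_mem y.2 _, ?_⟩
  rw [← sub_pow_char_pow]
  refine pow_dvd_pow_of_dvd ?_ _
  rw [pFlat_dvd_iff, map_sub, hy, PreTilt.mk_untilt_eq_coeff_zero, sub_self]

end thetaRange

/-! ## Approximate traces -/

/-- Translation by `g` permutes the cosets, and two representatives of a coset differ by an element
of `S`, which fixes `x`. -/
theorem smul_sum_out_smul {G M : Type*} [Group G] [AddCommMonoid M] [DistribMulAction G M]
    (S : Subgroup G) [Fintype (G ⧸ S)] {x : M} (hx : ∀ s ∈ S, s • x = x) (g : G) :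
    g • ∑ q : G ⧸ S, q.out • x = ∑ q : G ⧸ S, q.out • x := by
  rw [Finset.smul_sum]
  refine Fintype.sum_equiv (MulAction.toPerm g) _ _ fun q => ?_
  have h : (g * q.out)⁻¹ * (g • q).out ∈ S := by
    rw [← QuotientGroup.eq, QuotientGroup.out_eq', ← MulAction.Quotient.coe_smul_out]
    rfl
  rw [MulAction.toPerm_apply, ← mul_smul]
  conv_lhs => rw [← hx _ h]
  rw [← mul_smul, mul_inv_cancel_left]

section trace

variable {p : ℕ} [Fact p.Prime] {K : IntermediateField ℚ_[p] (PadicAlgCl p)}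

theorem coeff_galAInf (σ : PadicAlgCl p ≃ₐ[ℚ_[p]] PadicAlgCl p) (x : AInf p) (n : ℕ) :
    WittVector.coeff (galAInf p σ x) n = galFlat p σ (WittVector.coeff x n) :=
  WittVector.map_coeff _ _ _

instance mulSemiringAction_flat : MulSemiringAction (HK p K) (OFlat p) where
  smul σ x := galFlat p σ x
  one_smul := galFlat_one
  mul_smul σ τ x := galFlat_mul (σ : PadicAlgCl p ≃ₐ[ℚ_[p]] PadicAlgCl p) τ x
  smul_zero _ := map_zero _
  smul_add _ := map_add _
  smul_one _ := map_one _
  smul_mul _ := map_mul _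

instance mulSemiringAction_aInf : MulSemiringAction (HK p K) (AInf p) where
  smul σ x := galAInf p σ x
  one_smul x := WittVector.ext fun n => (coeff_galAInf _ x n).trans (galFlat_one _)
  mul_smul σ τ x := WittVector.ext fun n => by
    refine (coeff_galAInf _ x n).trans ((galFlat_mul _ _ _).trans ?_)
    rw [← coeff_galAInf, ← coeff_galAInf]
    rfl
  smul_zero _ := map_zero _
  smul_add _ := map_add _
  smul_one _ := map_one _
  smul_mul _ := map_mul _

theorem smul_aInf_def (σ : HK p K) (x : AInf p) : σ • x = galAInf p σ x := rfl

theorem smul_flat_def (σ : HK p K) (x : OFlat p) : σ • x = galFlat p σ x := rfl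

theorem coeff_smul_aInf (σ : HK p K) (x : AInf p) (n : ℕ) :
    WittVector.coeff (σ • x) n = σ • WittVector.coeff x n := coeff_galAInf _ x n

variable (p) in
/-- The Teichmüller lift with values in `A_inf`. -/
def teichAInf : OFlat p →* AInf p := WittVector.teichmuller p

theorem smul_teichAInf (σ : HK p K) (x : OFlat p) : σ • teichAInf p x = teichAInf p (σ • x) :=
  WittVector.map_teichmuller p (galFlat p σ) x

theorem teich_eq (ε : RootSystem p) (n : ℤ) : ε.teich n = teichAInf p (ε.piBar n) := rfl

instance isDomain_aInf : IsDomain (AInf p) := inferInstanceAs (IsDomain (WittVector p (OFlat p)))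

theorem p_dvd_of_coeff_zero {x : AInf p} (h : WittVector.coeff x 0 = 0) : (p : AInf p) ∣ x := by
  have h' := (WittVector.mem_span_p_iff_coeff_zero_eq_zero (p := p) (k := OFlat p) x).2 h
  exact Ideal.mem_span_singleton.1 h'

variable (p) in
/-- The reduction of `A_inf` modulo `p`. -/
def coeffZero : AInf p →+* OFlat p := (WittVector.constantCoeff : WittVector p (OFlat p) →+* _)

theorem coeffZero_teichAInf (x : OFlat p) : coeffZero p (teichAInf p x) = x :=
  WittVector.teichmuller_coeff_zero p x

theorem p_dvd_iff_coeffZero {x : AInf p} : (p : AInf p) ∣ x ↔ coeffZero p x = 0 := by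
  refine ⟨?_, p_dvd_of_coeff_zero⟩
  rintro ⟨y, rfl⟩
  rw [map_mul, map_natCast, CharP.cast_eq_zero, zero_mul]

theorem smul_coeffZero (σ : HK p K) (x : AInf p) : coeffZero p (σ • x) = σ • coeffZero p x :=
  coeff_smul_aInf σ x 0

theorem piBar_ne_zero (ε : RootSystem p) (n : ℤ) : ε.piBar n ≠ 0 := by
  rw [RootSystem.piBar, map_ne_zero_iff _ (RingEquiv.injective _), sub_ne_zero]
  intro h
  have h1 := untiltRoot_flat ε 1
  rw [h, map_one] at h1
  refine ε.root_one (UniformSpace.Completion.coe_injective _ ?_)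
  exact (congrArg Subtype.val h1).symm

theorem piBar_add_one (ε : RootSystem p) (n : ℤ) : ε.piBar (n + 1) = ε.piBar n ^ p := by
  rw [RootSystem.piBar, add_comm n, zpow_one_add, RingAut.mul_apply, frobeniusEquiv_apply,
    frobenius_def]
  rfl

theorem piBar_add (ε : RootSystem p) (n : ℤ) (k : ℕ) : ε.piBar (n + k) = ε.piBar n ^ p ^ k := by
  induction k with
  | zero => simp
  | succ k ih => rw [Nat.cast_succ, ← add_assoc, piBar_add_one, ih, pow_succ, pow_mul]

theorem smul_piBar (ε : RootSystem p) (n : ℤ) (σ : HK p K) : σ • ε.piBar n = ε.piBar n := by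
  rw [smul_flat_def, RootSystem.piBar, galFlat_zpow, map_sub, map_one, galFlat_flat ε σ.2]

theorem smul_teich (ε : RootSystem p) (n : ℤ) (σ : HK p K) : σ • ε.teich n = ε.teich n :=
  galAInf_teich ε σ.2 n

variable (ε : RootSystem p) (K)

theorem pFlat_dvd_piBar_zero : (ε.pFlat K : OFlat p) ∣ ε.piBar 0 := by
  rw [pFlat_dvd_iff, RootSystem.piBar, zpow_zero, RingAut.one_apply, map_sub, map_one,
    ← mk_untiltRoot, untiltRoot_flat, ← map_one (Ideal.Quotient.mk _), ← map_sub]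
  convert map_zero (Ideal.Quotient.mk (Ideal.span {((p : ℕ) : 𝓞_ℂ_[p])}))
  rw [sub_eq_zero]
  refine Subtype.ext ?_
  change (ε.root 0 : ℂ_[p]) = 1
  rw [ε.root_zero, PadicComplex.coe_eq, map_one]

/-- Otherwise all powers `pFlat ^ p ^ n` divide `c`, so every component of `c` vanishes. -/
theorem exists_dvd_pFlat_pow {c : OFlat p} (hc : c ≠ 0) :
    ∃ n : ℕ, c ∣ (ε.pFlat K : OFlat p) ^ p ^ n := by
  by_contra! h
  refine hc (Perfection.ext fun n => ?_)
  have := (ValuationRing.dvd_total _ _).resolve_left (h n)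
  rw [pFlat_pow_dvd_iff] at this
  exact this.trans (map_zero _).symm

include K in
theorem exists_dvd_piBar_pow (n : ℤ) {c : OFlat p} (hc : c ≠ 0) :
    ∃ k : ℕ, c ∣ ε.piBar n ^ p ^ k := by
  obtain ⟨l, hl⟩ := exists_dvd_pFlat_pow K ε hc
  have h1 := hl.trans (pow_dvd_pow_of_dvd (pFlat_dvd_piBar_zero K ε) (p ^ l))
  rw [← piBar_add, zero_add] at h1
  refine ⟨l + n.natAbs, ?_⟩
  rw [← piBar_add]
  have h2 : (0 : ℤ) ≤ n + n.natAbs := by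
    have := neg_abs_le n
    rw [Int.natCast_natAbs]
    linarith
  obtain ⟨r, hr⟩ := Int.eq_ofNat_of_zero_le h2
  have h3 : n + ((l + n.natAbs : ℕ) : ℤ) = l + (r : ℕ) := by rw [Nat.cast_add]; linarith
  rw [h3, piBar_add]
  exact h1.trans (dvd_pow_self _ (pow_ne_zero _ (Fact.out : p.Prime).ne_zero))

include ε in
theorem exists_finite_orbit_approx_flat (x : OFlat p) {c : OFlat p} (hc : c ≠ 0) :
    ∃ y, (MulAction.orbit (HK p K) y).Finite ∧ c ∣ x - y := by
  obtain ⟨n, hn⟩ := exists_dvd_pFlat_pow K ε hc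
  obtain ⟨y, hy, h⟩ := exists_finiteOrbit_approx ε K x n
  exact ⟨y, hy, hn.trans h⟩

/-- Treat one `p`-adic digit at a time: density in the tilt gives a digit `d` of finite orbit whose
error is a multiple of `piBar n ^ j`. Subtracting Teichmüller lifts leaves a multiple of `p`, to
which the induction hypothesis applies. -/
theorem exists_finite_orbit_approx (a : AInf p) (n : ℤ) (N j : ℕ) :
    ∃ a', (MulAction.orbit (HK p K) a').Finite ∧
      a - a' ∈ Ideal.span {(p : AInf p) ^ N, ε.teich n ^ j} := by
  induction N generalizing a with
  | zero =>
    refine ⟨0, (Set.finite_singleton 0).subset ?_, ?_⟩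
    · rintro _ ⟨σ, rfl⟩; exact smul_zero σ
    · rw [pow_zero, Ideal.span_insert, Ideal.span_singleton_one, top_sup_eq]
      trivial
  | succ N ih =>
    obtain ⟨d, hd, f, hf⟩ := exists_finite_orbit_approx_flat K ε (coeffZero p a)
      (pow_ne_zero j (piBar_ne_zero ε n))
    obtain ⟨a₁, ha₁⟩ : (p : AInf p) ∣ a - teichAInf p d - ε.teich n ^ j * teichAInf p f := by
      rw [p_dvd_iff_coeffZero, map_sub, map_sub, map_mul, map_pow, teich_eq, coeffZero_teichAInf,
        coeffZero_teichAInf, coeffZero_teichAInf, hf, sub_self]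
    obtain ⟨a₁', ho, hm⟩ := ih a₁
    refine ⟨teichAInf p d + p * a₁', (hd.image2 (fun x y => teichAInf p x + p * y) ho).subset ?_, ?_⟩
    · rintro _ ⟨σ, rfl⟩
      refine ⟨_, ⟨σ, rfl⟩, _, ⟨σ, rfl⟩, ?_⟩
      simp only [smul_add, smul_mul', smul_teichAInf]
      rw [smul_aInf_def _ (p : AInf p), map_natCast]
    · have h1 : a - (teichAInf p d + p * a₁') =
          ε.teich n ^ j * teichAInf p f + p * (a₁ - a₁') := by linear_combination ha₁
      rw [h1]
      obtain ⟨x, y, hxy⟩ := Ideal.mem_span_pair.1 hm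
      rw [← hxy]
      refine Ideal.mem_span_pair.2 ⟨x, teichAInf p f + p * y, ?_⟩
      ring

variable {K}

/-- Independence of characters: distinct cosets of `S` act by distinct characters on the monoid of
`S`-fixed elements, so their sum is not zero. They are distinct because `S` is the exact stabilizer
of `b`, whose Witt components are `S`-fixed. -/
theorem exists_sum_out_smul_ne_zero (S : Subgroup (HK p K)) [Fintype (HK p K ⧸ S)]
    {ι : Type*} (b : ι → AInf p) (hS : S = MulAction.stabilizer (HK p K) b) :
    ∃ z : OFlat p, (∀ s ∈ S, s • z = z) ∧ ∑ q : HK p K ⧸ S, q.out • z ≠ 0 := by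
  let D : Submonoid (OFlat p) :=
    { carrier := {z | ∀ s ∈ S, s • z = z}
      mul_mem' := fun hx hy s hs => by rw [smul_mul', hx s hs, hy s hs]
      one_mem' := fun s _ => smul_one s }
  let χ : HK p K ⧸ S → (D →* OFlat p) := fun q =>
    (MulSemiringAction.toRingHom (HK p K) (OFlat p) q.out : OFlat p →* OFlat p).comp D.subtype
  have hχ : Function.Injective χ := fun q q' h => by
    rw [← q.out_eq', ← q'.out_eq', QuotientGroup.eq]
    refine hS.ge ?_
    rw [MulAction.mem_stabilizer_iff, mul_smul, inv_smul_eq_iff]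
    refine funext fun i => WittVector.ext fun n => ?_
    have hmem : WittVector.coeff (b i) n ∈ D := fun s hs => by
      rw [hS, MulAction.mem_stabilizer_iff] at hs
      rw [← coeff_smul_aInf]
      exact congrArg (fun x : AInf p => WittVector.coeff x n) (congrFun hs i)
    have h1 : q.out • WittVector.coeff (b i) n = q'.out • WittVector.coeff (b i) n :=
      DFunLike.congr_fun h ⟨_, hmem⟩
    rw [← coeff_smul_aInf, ← coeff_smul_aInf] at h1
    exact h1.symm
  have hli := (linearIndependent_monoidHom D (OFlat p)).comp χ hχ
  rw [Fintype.linearIndependent_iff] at hli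
  by_contra! hne
  refine one_ne_zero (α := OFlat p) (hli (fun _ => 1) (funext fun z => ?_) (1 : HK p K))
  rw [Finset.sum_apply]
  simp only [one_smul]
  exact hne z z.2

/-- Traces commute with Frobenius. Replacing `z` by its `p ^ k`-th root replaces the trace by its `p
^ k`-th root, whose valuation can be made as small as required. -/
theorem exists_sum_out_smul_pow_dvd (S : Subgroup (HK p K)) [Fintype (HK p K ⧸ S)]
    {ι : Type*} (b : ι → AInf p) (hS : S = MulAction.stabilizer (HK p K) b) (n : ℤ) (N : ℕ) :
    ∃ z : OFlat p, (∀ s ∈ S, s • z = z) ∧ (∑ q : HK p K ⧸ S, q.out • z) ^ N ∣ ε.piBar n ∧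
      ∑ q : HK p K ⧸ S, q.out • z ≠ 0 := by
  obtain ⟨z, hz, h0⟩ := exists_sum_out_smul_ne_zero S b hS
  obtain ⟨k, hk⟩ := exists_dvd_piBar_pow K ε n (pow_ne_zero N h0)
  obtain ⟨y, rfl⟩ := (iterateFrobeniusEquiv (OFlat p) p k).surjective z
  rw [iterateFrobeniusEquiv_def] at hz
  simp only [iterateFrobeniusEquiv_def, smul_pow'] at hk h0 hz
  rw [← sum_pow_char_pow] at hk h0
  have hp := pow_ne_zero k (Fact.out : p.Prime).ne_zero
  have h0' : ∑ q : HK p K ⧸ S, q.out • y ≠ 0 := fun h => h0 (by rw [h, zero_pow hp])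
  refine ⟨y, fun s hs => ?_, ?_, h0'⟩
  · exact iterateFrobenius_inj (OFlat p) p k (hz s hs)
  · rw [← pow_mul, mul_comm, pow_mul] at hk
    exact dvd_of_pow_dvd_pow hp (pow_ne_zero N h0') hk

/-- Let `y` be the trace of `z` and `T` that of `[z]`, so `T = [y] + p * v`. Up to sign, `T` divides
`[y] ^ N` modulo `p ^ N`, with cofactor `c`. If `y ^ N * f = piBar n`, multiplying `[z]` by the
invariant element `[f] * c`, with the right sign, gives trace `[piBar n]` modulo `p ^ N`. -/
theorem exists_sum_out_smul_aInf (S : Subgroup (HK p K)) [Fintype (HK p K ⧸ S)]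
    {ι : Type*} (b : ι → AInf p) (hS : S = MulAction.stabilizer (HK p K) b) (n : ℤ) (N : ℕ) :
    ∃ w : AInf p, (∀ s ∈ S, s • w = w) ∧
      (p : AInf p) ^ N ∣ ∑ q : HK p K ⧸ S, q.out • w - ε.teich n := by
  obtain ⟨z, hz, ⟨f, hf⟩, h0⟩ := exists_sum_out_smul_pow_dvd ε S b hS n N
  set y := ∑ q : HK p K ⧸ S, q.out • z with hy
  set T := ∑ q : HK p K ⧸ S, q.out • teichAInf p z with hT
  have hw : ∀ s ∈ S, s • teichAInf p z = teichAInf p z := fun s hs => by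
    rw [smul_teichAInf, hz s hs]
  have hyinv : ∀ g : HK p K, g • y = y := smul_sum_out_smul S hz
  have hTinv : ∀ g : HK p K, g • T = T := smul_sum_out_smul S hw
  have hT0 : coeffZero p T = y := by
    rw [hT, hy, map_sum]
    exact Finset.sum_congr rfl fun q _ => by rw [smul_teichAInf, coeffZero_teichAInf]
  have hfinv : ∀ g : HK p K, g • f = f := fun g => by
    have h1 := congrArg (g • ·) hf
    simp only [smul_piBar, smul_mul', smul_pow', hyinv] at h1
    exact mul_left_cancel₀ (pow_ne_zero N h0) (h1.symm.trans hf)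
  obtain ⟨v, hv⟩ : (p : AInf p) ∣ T - teichAInf p y := by
    rw [p_dvd_iff_coeffZero, map_sub, hT0, coeffZero_teichAInf, sub_self]
  -- `x - x'` divides `x ^ N - x' ^ N`, applied to `x = T - [y]` and `x' = -[y]`, whose difference
  -- is `T`.
  obtain ⟨c, hc⟩ : T ∣ (T - teichAInf p y) ^ N - (-teichAInf p y) ^ N := by
    have := sub_dvd_pow_sub_pow (T - teichAInf p y) (-teichAInf p y) N
    rwa [sub_neg_eq_add, sub_add_cancel] at this
  have hTne : T ≠ 0 := fun h => h0 (by rw [← hT0, h, map_zero])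
  have hcinv : ∀ g : HK p K, g • c = c := fun g => by
    have h1 := congrArg (g • ·) hc
    simp only [smul_mul', smul_sub, smul_pow', smul_neg, hTinv, smul_teichAInf, hyinv] at h1
    exact mul_left_cancel₀ hTne (h1.symm.trans hc)
  have hsum : ∀ d : AInf p, (∀ g : HK p K, g • d = d) →
      ∑ q : HK p K ⧸ S, q.out • (d * teichAInf p z) = d * T := fun d hd => by
    rw [hT, Finset.mul_sum]
    exact Finset.sum_congr rfl fun q _ => by rw [smul_mul', hd]
  have hdinv : ∀ g : HK p K, g • (-(-1) ^ N * teichAInf p f * c) =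
      -(-1) ^ N * teichAInf p f * c := fun g => by
    simp only [smul_mul', smul_neg, smul_pow', smul_one, smul_teichAInf, hfinv, hcinv]
  refine ⟨-(-1) ^ N * teichAInf p f * c * teichAInf p z, fun s hs => ?_, ?_⟩
  · rw [smul_mul', hdinv, hw s hs]
  · rw [hsum _ hdinv, teich_eq, hf, map_mul, map_pow]
    refine ⟨-(-1) ^ N * teichAInf p f * v ^ N, ?_⟩
    rw [hv, mul_pow, neg_pow] at hc
    have h1 : ((-1 : AInf p) ^ N) * (-1) ^ N = 1 := by rw [← mul_pow]; simp
    linear_combination (-(-1) ^ N * teichAInf p f) * (-hc) + (teichAInf p y ^ N * teichAInf p f) * h1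

variable (K)

/-- Elements of `A_inf` can be approximated by elements of finite orbit, and there is `w` such that
the trace of `w` is close to `[π̄] ^ (p ^ n)`. -/
theorem exists_approx_trace (n : ℤ) (N j : ℕ) {ι : Type*} [Finite ι] (a : ι → AInf p) :
    ∃ (κ : Type) (_ : Fintype κ) (s : κ → HK p K) (w : AInf p) (a' : ι → AInf p),
      (∀ i, a i - a' i ∈ Ideal.span {(p : AInf p) ^ N, ε.teich n ^ j}) ∧
      (∀ i, ∑ q, galAInf p (s q) (w * a' i) ∈ AInfHK p K) ∧
      (p : AInf p) ^ N ∣ ∑ q, galAInf p (s q) w - ε.teich n := by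
  choose a' ho ha using fun i => exists_finite_orbit_approx K ε (a i) n N j
  -- The whole family has finite orbit, so its common stabilizer has finite index and one `w` serves
  -- all `a' i`.
  have hfin : (MulAction.orbit (HK p K) a').Finite := (Set.Finite.pi' ho).subset <| by
    rintro _ ⟨σ, rfl⟩ i
    exact ⟨σ, rfl⟩
  have := hfin.to_subtype
  have : Finite (HK p K ⧸ MulAction.stabilizer (HK p K) a') :=
    Finite.of_equiv _ (MulAction.orbitEquivQuotientStabilizer (HK p K) a')
  have := Fintype.ofFinite (HK p K ⧸ MulAction.stabilizer (HK p K) a')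
  obtain ⟨w, hw, h⟩ := exists_sum_out_smul_aInf ε
    (MulAction.stabilizer (HK p K) a') a' rfl n N
  refine ⟨_, this, fun q => q.out, w, a', ha, fun i => mem_AInfHK.2 fun σ hσ => ?_, h⟩
  refine smul_sum_out_smul (M := AInf p)
    (MulAction.stabilizer (HK p K) a') (x := w * a' i) (fun s hs => ?_) ⟨σ, hσ⟩
  rw [smul_mul', hw s hs]
  exact congrArg (w * ·) (congrFun (MulAction.mem_stabilizer_iff.1 hs) i)

end trace

/-! ## Tensor products with modules killed by a power of a maximal ideal -/

section devissage

variable {Λ : Type*} [CommRing Λ] (𝔪 : Ideal Λ)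
  {S : Type*} [AddCommGroup S] [Module Λ S] {G : Type*} [AddCommGroup G] [Module Λ G]

theorem rTensor_mkQ_injective {M : Type*} [AddCommGroup M] [Module Λ M]
    (hM : ∀ a ∈ 𝔪, ∀ m : M, a • m = 0) :
    Function.Injective ((𝔪 • (⊤ : Submodule Λ S)).mkQ.rTensor M) := by
  rw [injective_iff_map_eq_zero]
  intro x hx
  obtain ⟨y, rfl⟩ := (rTensor_exact M (LinearMap.exact_subtype_mkQ (𝔪 • (⊤ : Submodule Λ S)))
    (Submodule.mkQ_surjective _) x).1 hx
  clear hx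
  induction y with
  | zero => simp
  | add y z hy hz => rw [map_add, hy, hz, add_zero]
  | tmul s m =>
    obtain ⟨s, hs⟩ := s
    rw [LinearMap.rTensor_tmul, Submodule.subtype_apply]
    change s ⊗ₜ[Λ] m = 0
    induction hs using Submodule.smul_induction_on' with
    | smul a ha n _ => rw [TensorProduct.smul_tmul, hM a ha, TensorProduct.tmul_zero]
    | add a _ b _ ha hb => rw [TensorProduct.add_tmul, ha, hb, add_zero]

/-- Modulo `𝔪` the map is an injection of vector spaces over `Λ / 𝔪`, hence split, and a split
injection stays injective after tensoring; `M` sees `S` only modulo `𝔪`. -/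
theorem rTensor_injective_of_smul_eq_zero [𝔪.IsMaximal] (f : S →ₗ[Λ] G)
    (hf : ∀ s, f s ∈ 𝔪 • (⊤ : Submodule Λ G) → s ∈ 𝔪 • (⊤ : Submodule Λ S))
    {M : Type*} [AddCommGroup M] [Module Λ M] (hM : ∀ a ∈ 𝔪, ∀ m : M, a • m = 0) :
    Function.Injective (f.rTensor M) := by
  let := Ideal.Quotient.field 𝔪
  let fbar : (S ⧸ 𝔪 • (⊤ : Submodule Λ S)) →ₗ[Λ] (G ⧸ 𝔪 • (⊤ : Submodule Λ G)) :=
    Submodule.mapQ _ _ f (by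
      rw [← Submodule.map_le_iff_le_comap, Submodule.map_smul'']
      exact Submodule.smul_mono le_rfl le_top)
  let fk : (S ⧸ 𝔪 • (⊤ : Submodule Λ S)) →ₗ[Λ ⧸ 𝔪] (G ⧸ 𝔪 • (⊤ : Submodule Λ G)) :=
    { fbar with
      map_smul' := fun a x => by
        obtain ⟨a, rfl⟩ := Ideal.Quotient.mk_surjective a
        exact fbar.map_smul a x }
  have hker : LinearMap.ker fk = ⊥ := by
    rw [LinearMap.ker_eq_bot']
    intro x hx
    obtain ⟨s, rfl⟩ := Submodule.mkQ_surjective _ x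
    have h1 : Submodule.mkQ (𝔪 • (⊤ : Submodule Λ G)) (f s) = 0 := hx
    rw [Submodule.mkQ_apply, Submodule.Quotient.mk_eq_zero] at h1 ⊢
    exact hf s h1
  obtain ⟨r, hr⟩ := fk.exists_leftInverse_of_injective hker
  let rΛ : (G ⧸ 𝔪 • (⊤ : Submodule Λ G)) →ₗ[Λ] (S ⧸ 𝔪 • (⊤ : Submodule Λ S)) :=
    { r with map_smul' := fun a x => r.map_smul (Ideal.Quotient.mk 𝔪 a) x }
  have hcomp : (rΛ ∘ₗ (𝔪 • (⊤ : Submodule Λ G)).mkQ) ∘ₗ f = (𝔪 • (⊤ : Submodule Λ S)).mkQ :=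
    LinearMap.ext fun s => LinearMap.congr_fun hr (Submodule.Quotient.mk s)
  have h2 := rTensor_mkQ_injective (S := S) 𝔪 hM
  rw [← hcomp, LinearMap.rTensor_comp, LinearMap.coe_comp] at h2
  exact h2.of_comp

/-- Dévissage along `𝔪 N ⊆ N`: the quotient is killed by `𝔪` and the submodule by one power less.
`hG` supplies the only exactness on the left that the diagram chase needs. Submodules of a fixed `M`
are used so that `hG` applies at every stage. -/
theorem rTensor_injective_of_pow_smul_eq_zero [𝔪.IsMaximal] (f : S →ₗ[Λ] G)
    (hf : ∀ s, f s ∈ 𝔪 • (⊤ : Submodule Λ G) → s ∈ 𝔪 • (⊤ : Submodule Λ S)) (r : ℕ)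
    {M : Type*} [AddCommGroup M] [Module Λ M]
    (hG : ∀ N : Submodule Λ M, Function.Injective ((𝔪 • (⊤ : Submodule Λ N)).subtype.lTensor G))
    (hM : ∀ a ∈ 𝔪 ^ r, ∀ m : M, a • m = 0) :
    Function.Injective (f.rTensor M) := by
  suffices h : ∀ N : Submodule Λ M, (∀ a ∈ 𝔪 ^ r, ∀ m : N, a • m = 0) →
      Function.Injective (f.rTensor N) by
    have h1 := h ⊤ fun a ha m => Subtype.ext (hM a ha m)
    let e : (⊤ : Submodule Λ M) ≃ₗ[Λ] M := Submodule.topEquiv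
    have h2 : f.rTensor M ∘ₗ e.toLinearMap.lTensor S =
        e.toLinearMap.lTensor G ∘ₗ f.rTensor _ := by
      rw [LinearMap.rTensor_comp_lTensor, LinearMap.lTensor_comp_rTensor]
    have h3 : Function.Injective (f.rTensor M ∘ LinearEquiv.lTensor S e) := by
      refine (congrArg (fun φ : S ⊗[Λ] _ →ₗ[Λ] G ⊗[Λ] M => Function.Injective φ) h2).mpr ?_
      rw [LinearMap.coe_comp]
      exact (LinearEquiv.lTensor G e).injective.comp h1
    exact h3.of_comp_right (LinearEquiv.lTensor S e).surjective
  clear hM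
  induction r with
  | zero =>
    intro N hN
    have : Subsingleton N := subsingleton_of_forall_eq 0 fun m => by
      simpa using hN 1 (by simp) m
    have : Subsingleton (S ⊗[Λ] N) := inferInstance
    exact Function.injective_of_subsingleton _
  | succ r ih =>
    intro N hN
    rw [injective_iff_map_eq_zero]
    intro x hx
    set N₁ := 𝔪 • (⊤ : Submodule Λ N)
    have hN₁ : Function.Injective (f.rTensor N₁) := by
      have hE : (N₁.map N.subtype) ≃ₗ[Λ] N₁ :=
        (Submodule.equivMapOfInjective N.subtype N.subtype_injective N₁).symm
      have h1 := ih (N₁.map N.subtype) (by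
        rintro a ha ⟨_, m, hm, rfl⟩
        refine Subtype.ext ?_
        change a • (m : M) = 0
        have : a • m = 0 := by
          refine Submodule.smul_induction_on hm (fun b hb n _ => ?_) fun b c hb hc => ?_
          · rw [smul_smul]
            exact hN _ (pow_succ 𝔪 r ▸ Ideal.mul_mem_mul ha hb) n
          · rw [smul_add, hb, hc, add_zero]
        exact congrArg Subtype.val this)
      have h2 : f.rTensor N₁ ∘ₗ hE.toLinearMap.lTensor S =
          hE.toLinearMap.lTensor G ∘ₗ f.rTensor _ := by
        rw [LinearMap.rTensor_comp_lTensor, LinearMap.lTensor_comp_rTensor]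
      have h3 : Function.Injective (f.rTensor N₁ ∘ LinearEquiv.lTensor S hE) := by
        refine (congrArg (fun φ : S ⊗[Λ] _ →ₗ[Λ] G ⊗[Λ] N₁ => Function.Injective φ) h2).mpr ?_
        rw [LinearMap.coe_comp]
        exact (LinearEquiv.lTensor G hE).injective.comp h1
      exact h3.of_comp_right (LinearEquiv.lTensor S hE).surjective
    have hq : Function.Injective (f.rTensor (N ⧸ N₁)) :=
      rTensor_injective_of_smul_eq_zero 𝔪 f hf fun a ha m => by
        obtain ⟨m, rfl⟩ := Submodule.mkQ_surjective _ m
        rw [← map_smul, Submodule.mkQ_apply, Submodule.Quotient.mk_eq_zero]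
        exact Submodule.smul_mem_smul ha trivial
    have h1 : N₁.mkQ.lTensor S x = 0 := hq <| by
      rw [← LinearMap.comp_apply, LinearMap.rTensor_comp_lTensor,
        ← LinearMap.lTensor_comp_rTensor, LinearMap.comp_apply, hx, map_zero, map_zero]
    obtain ⟨y, rfl⟩ := (lTensor_exact S (LinearMap.exact_subtype_mkQ N₁)
      (Submodule.mkQ_surjective _) x).1 h1
    rw [← LinearMap.comp_apply, LinearMap.rTensor_comp_lTensor,
      ← LinearMap.lTensor_comp_rTensor, LinearMap.comp_apply] at hx
    have h2 : f.rTensor N₁ y = 0 := hG N (hx.trans (map_zero _).symm)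
    rw [hN₁ (h2.trans (map_zero _).symm), map_zero]

variable {A : Type*} [AddCommGroup A] [Module Λ A]

/-- A snake lemma chase: with `G` flat, the kernel of `A ⊗ N' → A ⊗ N` comes from that of `S ⊗ N/N'
→ G ⊗ N/N'`. -/
theorem lTensor_subtype_injective_of_exact [Module.Flat Λ G] (i : S →ₗ[Λ] G) (π : G →ₗ[Λ] A)
    (hex : Function.Exact i π) (hπ : Function.Surjective π)
    {N : Type*} [AddCommGroup N] [Module Λ N] (N' : Submodule Λ N)
    (hinj : Function.Injective (i.rTensor (N ⧸ N'))) :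
    Function.Injective (N'.subtype.lTensor A) := by
  rw [injective_iff_map_eq_zero]
  intro x hx
  obtain ⟨g, rfl⟩ := LinearMap.rTensor_surjective N' hπ x
  rw [← LinearMap.comp_apply, LinearMap.lTensor_comp_rTensor,
    ← LinearMap.rTensor_comp_lTensor, LinearMap.comp_apply] at hx
  obtain ⟨s, hs⟩ := (rTensor_exact N hex hπ _).1 hx
  have h1 : N'.mkQ.lTensor S s = 0 := hinj <| by
    rw [← LinearMap.comp_apply, LinearMap.rTensor_comp_lTensor,
      ← LinearMap.lTensor_comp_rTensor, LinearMap.comp_apply, map_zero,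
      hs, ← LinearMap.comp_apply, ← LinearMap.lTensor_comp]
    have : N'.mkQ ∘ₗ N'.subtype = 0 := by ext; simp
    rw [this, LinearMap.lTensor_zero, LinearMap.zero_apply]
  obtain ⟨s', rfl⟩ := (lTensor_exact S (LinearMap.exact_subtype_mkQ N')
      (Submodule.mkQ_surjective _) s).1 h1
  have h2 : g = i.rTensor N' s' := by
    refine Module.Flat.lTensor_preserves_injective_linearMap (M := G) N'.subtype
      N'.subtype_injective ?_
    rw [← hs, ← LinearMap.comp_apply, ← LinearMap.comp_apply, LinearMap.lTensor_comp_rTensor,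
      LinearMap.rTensor_comp_lTensor]
  rw [h2, ← LinearMap.comp_apply, ← LinearMap.rTensor_comp, hex.linearMap_comp_eq_zero,
    LinearMap.rTensor_zero, LinearMap.zero_apply]

theorem exists_eq_smul_add_smul {P T : Λ} {V : Type*} [AddCommGroup V] [Module Λ V] {v : V}
    (hv : v ∈ Ideal.span {P, T} • (⊤ : Submodule Λ V)) : ∃ v₁ v₂, v = P • v₁ + T • v₂ := by
  refine Submodule.smul_induction_on hv (fun a ha n _ => ?_) ?_
  · obtain ⟨x, y, rfl⟩ := Ideal.mem_span_pair.1 ha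
    exact ⟨x • n, y • n, by rw [add_smul, smul_smul, smul_smul, mul_comm x, mul_comm y]⟩
  · rintro _ _ ⟨a, b, rfl⟩ ⟨c, d, rfl⟩
    exact ⟨a + c, b + d, by simp only [smul_add]; abel⟩

/-- If `P g₁ + T g₂` maps to zero, regularity says that the images of `g₁`, `g₂` form a multiple of
the Koszul relation `(-T, P)`. Lifting the multiplier to `G` corrects `g₁`, `g₂` to elements of the
kernel without changing the sum. -/
theorem mem_smul_top_of_regular {P T : Λ} (hP : ∀ x : A, P • x = 0 → x = 0)
    (hT : ∀ x y : A, T • x = P • y → ∃ z, x = P • z) (π : G →ₗ[Λ] A)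
    (hπ : Function.Surjective π) (s : LinearMap.ker π)
    (h : (s : G) ∈ Ideal.span {P, T} • (⊤ : Submodule Λ G)) :
    s ∈ Ideal.span {P, T} • (⊤ : Submodule Λ (LinearMap.ker π)) := by
  obtain ⟨s, hs⟩ := s
  obtain ⟨g₁, g₂, h⟩ := exists_eq_smul_add_smul h
  have h' : s = P • g₁ + T • g₂ := h
  have h0 : P • π g₁ + T • π g₂ = 0 := by
    rw [← map_smul, ← map_smul, ← map_add, ← h']; exact hs
  obtain ⟨z, hz⟩ := hT (π g₂) (-π g₁) (by rw [smul_neg]; exact eq_neg_of_add_eq_zero_right h0)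
  obtain ⟨g, rfl⟩ := hπ z
  have h1 : π g₁ + T • π g = 0 := hP _ (by
    rw [smul_add, ← h0, hz, smul_comm P T])
  have hm1 : g₁ + T • g ∈ LinearMap.ker π := by
    rw [LinearMap.mem_ker, map_add, map_smul, h1]
  have hm2 : g₂ - P • g ∈ LinearMap.ker π := by
    rw [LinearMap.mem_ker, map_sub, map_smul, hz, sub_self]
  have h2 : (⟨s, hs⟩ : LinearMap.ker π) = P • ⟨_, hm1⟩ + T • ⟨_, hm2⟩ := Subtype.ext <| by
    change s = P • (g₁ + T • g) + T • (g₂ - P • g)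
    rw [h', smul_add, smul_sub, smul_comm P T g]
    abel
  rw [h2]
  exact add_mem (Submodule.smul_mem_smul (Ideal.subset_span (by simp)) trivial)
    (Submodule.smul_mem_smul (Ideal.subset_span (by simp)) trivial)

theorem lTensor_subtype_injective_of_surjective [Module.Flat Λ G] {P T : Λ}
    (h𝔪 : 𝔪 = Ideal.span {P, T}) [𝔪.IsMaximal] (hP : ∀ x : A, P • x = 0 → x = 0)
    (hT : ∀ x y : A, T • x = P • y → ∃ z, x = P • z) (r : ℕ) (π : G →ₗ[Λ] A)
    (hπ : Function.Surjective π) {N : Type*} [AddCommGroup N] [Module Λ N] (N' : Submodule Λ N)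
    (hN : ∀ a ∈ 𝔪 ^ r, ∀ n : N, a • n ∈ N') :
    Function.Injective (N'.subtype.lTensor A) := by
  refine lTensor_subtype_injective_of_exact (LinearMap.ker π).subtype π
    (LinearMap.exact_subtype_ker_map _) hπ N' ?_
  refine rTensor_injective_of_pow_smul_eq_zero 𝔪 _ ?_ r
    (fun V => Module.Flat.lTensor_preserves_injective_linearMap _ (Submodule.subtype_injective _))
    fun a ha m => ?_
  · subst h𝔪
    exact mem_smul_top_of_regular hP hT _ hπ
  · obtain ⟨m, rfl⟩ := Submodule.mkQ_surjective _ m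
    rw [← map_smul, Submodule.mkQ_apply, Submodule.Quotient.mk_eq_zero]
    exact hN a ha m

/-- If `(P, T)` is a regular sequence on `A` then `A ⊗ N' → A ⊗ N` is injective for submodules
`N' ⊆ N` that contain `(P, T) ^ r N`. -/
theorem lTensor_subtype_injective_of_regular {P T : Λ} (h𝔪 : 𝔪 = Ideal.span {P, T})
    [𝔪.IsMaximal] (hP : ∀ x : A, P • x = 0 → x = 0)
    (hT : ∀ x y : A, T • x = P • y → ∃ z, x = P • z) (r : ℕ)
    {N : Type*} [AddCommGroup N] [Module Λ N] (N' : Submodule Λ N)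
    (hN : ∀ a ∈ 𝔪 ^ r, ∀ n : N, a • n ∈ N') :
    Function.Injective (N'.subtype.lTensor A) :=
  lTensor_subtype_injective_of_surjective 𝔪 h𝔪 hP hT r
    (Finsupp.linearCombination Λ (id : A → A)) (Finsupp.linearCombination_id_surjective Λ A) N' hN

end devissage

/-! ### Nonzerodivisors and divisibility in `A ⊗ Q` -/

section divisibility

variable {Λ : Type*} [CommRing Λ] (𝔪 : Ideal Λ) [𝔪.IsMaximal] {A A' Q : Type*} [CommRing A]
  [Algebra Λ A] [CommRing A'] [Algebra Λ A'] [CommRing Q] [Algebra Λ Q]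

theorem lTensor_mulLeft (v : Q) (x : A ⊗[Λ] Q) :
    (LinearMap.mulLeft Λ v).lTensor A x = ((1 : A) ⊗ₜ[Λ] v) * x := by
  induction x with
  | zero => simp
  | add x y hx hy => rw [map_add, hx, hy, mul_add]
  | tmul a q => simp

variable {P T : Λ} (h𝔪 : 𝔪 = Ideal.span {P, T}) (hP : ∀ x : A, P • x = 0 → x = 0)
  (hT : ∀ x y : A, T • x = P • y → ∃ z, x = P • z)
include h𝔪 hP hT

/-- Multiplication by `v` is an isomorphism `Q ≃ vQ`, and `A ⊗ vQ → A ⊗ Q` is injective because a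
power of `𝔪` kills `Q / vQ`. -/
theorem one_tmul_mul_eq_zero {v : Q} (hv : ∀ q : Q, v * q = 0 → q = 0) {r : ℕ}
    (hr : ∀ a ∈ 𝔪 ^ r, v ∣ algebraMap Λ Q a) {x : A ⊗[Λ] Q}
    (hx : ((1 : A) ⊗ₜ[Λ] v) * x = 0) : x = 0 := by
  have hinj : Function.Injective (LinearMap.mulLeft Λ v : Q →ₗ[Λ] Q) :=
    (injective_iff_map_eq_zero _).2 hv
  let e := LinearEquiv.ofInjective (LinearMap.mulLeft Λ v : Q →ₗ[Λ] Q) hinj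
  have hE := lTensor_subtype_injective_of_regular (A := A) 𝔪 h𝔪 hP hT r
    (LinearMap.range (LinearMap.mulLeft Λ v : Q →ₗ[Λ] Q)) fun a ha q => by
      obtain ⟨c, hc⟩ := hr a ha
      exact ⟨c * q, by rw [LinearMap.mulLeft_apply, ← mul_assoc, ← hc, Algebra.smul_def]⟩
  rw [← lTensor_mulLeft] at hx
  have h1 : (LinearMap.mulLeft Λ v : Q →ₗ[Λ] Q) = Submodule.subtype _ ∘ₗ e.toLinearMap := rfl
  rw [h1, LinearMap.lTensor_comp, LinearMap.comp_apply] at hx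
  exact (LinearEquiv.lTensor A e).injective ((hE (hx.trans (map_zero _).symm)).trans
    (map_zero _).symm)

/-- Divisibility by `1 ⊗ v` means vanishing in the tensor product with `Q / vQ`, so the claim is
injectivity of `A' ⊗ Q/vQ → A ⊗ Q/vQ`. Here `A` need not be flat; regularity of `(P, T)` replaces
flatness in the dévissage. -/
theorem one_tmul_dvd_of_map_dvd (f : A' →ₐ[Λ] A)
    (hf : ∀ s, f s ∈ 𝔪 • (⊤ : Submodule Λ A) → s ∈ 𝔪 • (⊤ : Submodule Λ A')) {v : Q} {r : ℕ}
    (hr : ∀ a ∈ 𝔪 ^ r, v ∣ algebraMap Λ Q a) {x : A' ⊗[Λ] Q}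
    (hx : ((1 : A) ⊗ₜ[Λ] v) ∣ Algebra.TensorProduct.map f (AlgHom.id Λ Q) x) :
    ((1 : A') ⊗ₜ[Λ] v) ∣ x := by
  let φ : Q →ₗ[Λ] Q := LinearMap.mulLeft Λ v
  have hex : Function.Exact φ (LinearMap.range φ).mkQ := LinearMap.exact_map_mkQ_range φ
  have hsurj := Submodule.mkQ_surjective (LinearMap.range φ)
  have hinj : Function.Injective (f.toLinearMap.rTensor (Q ⧸ LinearMap.range φ)) :=
    rTensor_injective_of_pow_smul_eq_zero 𝔪 f.toLinearMap hf r
      (fun N => lTensor_subtype_injective_of_regular 𝔪 h𝔪 hP hT 1 _ fun a ha n =>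
        Submodule.smul_mem_smul (pow_one 𝔪 ▸ ha) trivial)
      fun a ha m => by
        obtain ⟨q, rfl⟩ := hsurj m
        rw [← map_smul, Submodule.mkQ_apply, Submodule.Quotient.mk_eq_zero]
        obtain ⟨c, hc⟩ := hr a ha
        exact ⟨c * q, by rw [LinearMap.mulLeft_apply, ← mul_assoc, ← hc, Algebra.smul_def]⟩
  obtain ⟨y, hy⟩ := hx
  have h1 : (LinearMap.range φ).mkQ.lTensor A' x = 0 := hinj <| by
    rw [← LinearMap.comp_apply, LinearMap.rTensor_comp_lTensor,
      ← LinearMap.lTensor_comp_rTensor, LinearMap.comp_apply, map_zero]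
    have h2 : f.toLinearMap.rTensor Q x = φ.lTensor A y := by
      rw [lTensor_mulLeft, ← hy]
      rfl
    rw [h2]
    exact (lTensor_exact A hex hsurj _).2 ⟨y, rfl⟩
  obtain ⟨z, rfl⟩ := (lTensor_exact A' hex hsurj x).1 h1
  exact ⟨z, lTensor_mulLeft v z⟩

end divisibility

/-! ## Adic completions -/

section completion

variable {S : Type*} [CommRing S]

theorem exists_evalₐ_eq (I : Ideal S) (n : ℕ) (x : AdicCompletion I S) :
    ∃ s : S, AdicCompletion.evalₐ I n x = Ideal.Quotient.mk _ s ∧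
      AdicCompletion.evalₐ I n (x - algebraMap S _ s) = 0 := by
  obtain ⟨s, hs⟩ := Ideal.Quotient.mk_surjective (AdicCompletion.evalₐ I n x)
  refine ⟨s, hs.symm, ?_⟩
  rw [map_sub, AlgHom.commutes, ← hs]
  exact sub_self _

theorem evalₐ_algebraMap (I : Ideal S) (n : ℕ) (s : S) :
    AdicCompletion.evalₐ I n (algebraMap S _ s) = Ideal.Quotient.mk _ s :=
  AlgHom.commutes _ _

theorem evalₐ_eq_zero_of_le {I : Ideal S} {m n : ℕ} (h : m ≤ n) {x : AdicCompletion I S}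
    (hx : AdicCompletion.evalₐ I n x = 0) : AdicCompletion.evalₐ I m x = 0 := by
  obtain ⟨y, rfl⟩ := AdicCompletion.mk_surjective I S x
  rw [AdicCompletion.evalₐ_mk] at hx ⊢
  rw [← AdicCompletion.Ideal.mk_eq_mk I h y]
  rw [Ideal.Quotient.eq_zero_iff_mem] at hx ⊢
  exact Ideal.pow_le_pow_right h hx

theorem mem_map_pow_of_evalₐ_eq_zero {I : Ideal S} (hI : I.FG) {n : ℕ} {x : AdicCompletion I S}
    (hx : AdicCompletion.evalₐ I n x = 0) :
    x ∈ (I ^ n).map (algebraMap S (AdicCompletion I S)) := by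
  have h1 : x ∈ (I ^ n • ⊤ : Submodule S (AdicCompletion I S)) := by
    rw [AdicCompletion.pow_smul_top_eq_ker_eval hI, LinearMap.mem_ker]
    have h2 : Ideal.Quotient.factor (le_of_eq (Ideal.mul_top (I ^ n)).symm)
        (AdicCompletion.evalₐ I n x) = AdicCompletion.eval I S n x :=
      AdicCompletion.factor_evalₐ_eq_eval I x _
    rw [← h2, hx, map_zero]
  rw [Ideal.smul_top_eq_map] at h1
  exact h1

variable (u : S)

theorem pow_dvd_of_evalₐ_eq_zero {n : ℕ} {x : AdicCompletion (Ideal.span {u}) S}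
    (hx : AdicCompletion.evalₐ (Ideal.span {u}) n x = 0) : algebraMap S _ u ^ n ∣ x := by
  have := mem_map_pow_of_evalₐ_eq_zero ⟨{u}, by simp⟩ hx
  rwa [Ideal.span_singleton_pow, Ideal.map_span, Set.image_singleton, Ideal.mem_span_singleton,
    map_pow] at this

theorem evalₐ_eq_zero_of_pow_dvd {n : ℕ} {x : AdicCompletion (Ideal.span {u}) S}
    (hx : algebraMap S _ u ^ n ∣ x) : AdicCompletion.evalₐ (Ideal.span {u}) n x = 0 := by
  obtain ⟨y, rfl⟩ := hx
  rw [map_mul, ← map_pow, evalₐ_algebraMap, Ideal.Quotient.eq_zero_iff_mem.2, zero_mul]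
  rw [Ideal.span_singleton_pow]
  exact Ideal.mem_span_singleton_self _

theorem evalₐ_algebraMap_eq_zero_iff {n : ℕ} {s : S} :
    AdicCompletion.evalₐ (Ideal.span {u}) n (algebraMap S _ s) = 0 ↔ u ^ n ∣ s := by
  rw [evalₐ_algebraMap, Ideal.Quotient.eq_zero_iff_mem, Ideal.span_singleton_pow,
    Ideal.mem_span_singleton]

variable {u}

theorem algebraMap_mul_eq_zero (hu : ∀ s : S, u * s = 0 → s = 0)
    {x : AdicCompletion (Ideal.span {u}) S} (hx : algebraMap S _ u * x = 0) : x = 0 := by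
  refine AdicCompletion.ext_evalₐ fun n => ?_
  rw [map_zero]
  obtain ⟨s, -, hs⟩ := exists_evalₐ_eq (Ideal.span {u}) (n + 1) x
  obtain ⟨y, hy⟩ := pow_dvd_of_evalₐ_eq_zero u hs
  have h1 : AdicCompletion.evalₐ (Ideal.span {u}) (n + 1) (algebraMap S _ (u * s)) = 0 := by
    rw [map_mul]
    have : algebraMap S (AdicCompletion (Ideal.span {u}) S) u * algebraMap S _ s =
        algebraMap S _ u ^ (n + 1) * (-(algebraMap S _ u * y)) := by
      linear_combination hx - (algebraMap S (AdicCompletion (Ideal.span {u}) S) u) * hy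
    rw [this]
    exact evalₐ_eq_zero_of_pow_dvd u (dvd_mul_right _ _)
  rw [evalₐ_algebraMap_eq_zero_iff, pow_succ'] at h1
  obtain ⟨c, hc⟩ := h1
  have h2 : u ^ n ∣ s := ⟨c, sub_eq_zero.1 (hu _ (by linear_combination hc))⟩
  have h3 := evalₐ_eq_zero_of_le (Nat.le_succ n) hs
  rw [map_sub, sub_eq_zero] at h3
  rw [h3, evalₐ_algebraMap_eq_zero_iff]
  exact h2

variable {C : Type*} [CommRing C] {I : Ideal C} {I' : Ideal S}

theorem pow_mul_le_comap {φ : C →+* S} {c : ℕ} (h : (I ^ c).map φ ≤ I') (n : ℕ) :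
    I ^ (c * n) ≤ (I' ^ n).comap φ := by
  rw [← Ideal.map_le_iff_le_comap, pow_mul, Ideal.map_pow]
  exact Ideal.pow_right_mono h n

theorem adicLift_compat (φ : C →+* S) (c : ℕ) (h : (I ^ c).map φ ≤ I') {m n : ℕ} (hle : m ≤ n) :
    (Ideal.Quotient.factorPow I' hle).comp
      ((Ideal.quotientMap (I' ^ n) φ (pow_mul_le_comap h n)).comp
        (AdicCompletion.evalₐ I (c * n) : AdicCompletion I C →+* C ⧸ I ^ (c * n))) =
      (Ideal.quotientMap (I' ^ m) φ (pow_mul_le_comap h m)).comp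
        (AdicCompletion.evalₐ I (c * m) : AdicCompletion I C →+* C ⧸ I ^ (c * m)) := by
  refine RingHom.ext fun x => ?_
  obtain ⟨y, rfl⟩ := AdicCompletion.mk_surjective I C x
  rw [RingHom.comp_apply, RingHom.comp_apply, RingHom.comp_apply, RingHom.coe_coe,
    RingHom.coe_coe, AdicCompletion.evalₐ_mk, AdicCompletion.evalₐ_mk,
    ← AdicCompletion.Ideal.mk_eq_mk I (Nat.mul_le_mul_left c hle) y]
  rfl

/-- The map between completions induced by a continuous ring homomorphism. -/
def adicLift (φ : C →+* S) (c : ℕ) (h : (I ^ c).map φ ≤ I') :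
    AdicCompletion I C →+* AdicCompletion I' S :=
  AdicCompletion.liftRingHom I'
    (fun n => (Ideal.quotientMap (I' ^ n) φ (pow_mul_le_comap h n)).comp
      (AdicCompletion.evalₐ I (c * n) : AdicCompletion I C →+* C ⧸ I ^ (c * n)))
    (adicLift_compat φ c h)

theorem adicLift_algebraMap (φ : C →+* S) (c : ℕ) (h : (I ^ c).map φ ≤ I') (x : C) :
    adicLift φ c h (algebraMap C _ x) = algebraMap S (AdicCompletion I' S) (φ x) := by
  refine AdicCompletion.ext_evalₐ fun n => ?_
  rw [adicLift, AdicCompletion.evalₐ_liftRingHom _ _ (adicLift_compat φ c h)]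
  simp

end completion

/-! ## The rings `B[u/β, α/u]` -/

section ratPoly

variable {B : Type*} [CommRing B] (u α β : B)

/-- The element `u / β`. -/
def uDivBeta : ratPoly u α β :=
  ⟨algebraMap B _ (u * u) * IsLocalization.Away.invSelf (u * β),
    Algebra.subset_adjoin (Or.inl rfl)⟩

/-- The element `α / u`. -/
def alphaDivU : ratPoly u α β :=
  ⟨algebraMap B _ (α * β) * IsLocalization.Away.invSelf (u * β),
    Algebra.subset_adjoin (Or.inr rfl)⟩

theorem ratPoly_mul_eq_zero {x : ratPoly u α β} (h : algebraMap B _ u * x = 0) : x = 0 := by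
  have hu : IsUnit (algebraMap B (Localization.Away (u * β)) u) :=
    isUnit_of_dvd_unit (map_dvd _ (dvd_mul_right u β))
      (IsLocalization.Away.algebraMap_isUnit (u * β))
  exact Subtype.ext ((hu.mul_right_eq_zero).1 (congrArg Subtype.val h))

theorem beta_mul_uDivBeta : algebraMap B _ β * uDivBeta u α β = algebraMap B _ u := by
  refine Subtype.ext ?_
  change algebraMap B (Localization.Away (u * β)) β * (algebraMap B _ (u * u) * _) =
    algebraMap B _ u
  have h := IsLocalization.Away.mul_invSelf (S := Localization.Away (u * β)) (u * β)
  rw [map_mul] at h ⊢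
  linear_combination (algebraMap B (Localization.Away (u * β)) u) * h

theorem u_mul_alphaDivU : algebraMap B _ u * alphaDivU u α β = algebraMap B _ α := by
  refine Subtype.ext ?_
  change algebraMap B (Localization.Away (u * β)) u * (algebraMap B _ (α * β) * _) =
    algebraMap B _ α
  have h := IsLocalization.Away.mul_invSelf (S := Localization.Away (u * β)) (u * β)
  rw [map_mul] at h ⊢
  linear_combination (algebraMap B (Localization.Away (u * β)) α) * h

theorem ratPoly_mul_eq_zero' {x : ratPoly u α β} (h : algebraMap B _ β * x = 0) : x = 0 :=
  ratPoly_mul_eq_zero u α β (by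
    rw [← beta_mul_uDivBeta, mul_right_comm, h, zero_mul])

variable {u α β}

theorem ratPoly_induction {W : Subring (ratPoly u α β)} (hB : ∀ b, algebraMap B _ b ∈ W)
    (hy : uDivBeta u α β ∈ W) (hz : alphaDivU u α β ∈ W) (x : ratPoly u α β) : x ∈ W := by
  obtain ⟨x, hx⟩ := x
  refine Algebra.adjoin_induction (p := fun x hx => (⟨x, hx⟩ : ratPoly u α β) ∈ W) ?_ ?_ ?_ ?_ hx
  · rintro x (rfl | rfl)
    · exact hy
    · exact hz
  · exact hB
  · intro x y _ _ hx hy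
    exact W.add_mem hx hy
  · intro x y _ _ hx hy
    exact W.mul_mem hx hy

/-- The fractions satisfy `β * (u/β) = u` and `u * (α/u) = α`, which determine their images when `u`
and `β` go to nonzerodivisors. -/
theorem ratPoly_hom_ext {D : Type*} [CommRing D] {f g : ratPoly u α β →+* D}
    (h : ∀ b, f (algebraMap B _ b) = g (algebraMap B _ b))
    (hu : ∀ d, f (algebraMap B _ u) * d = 0 → d = 0)
    (hβ : ∀ d, f (algebraMap B _ β) * d = 0 → d = 0) : f = g := by
  refine RingHom.ext (ratPoly_induction (W := f.eqLocus g) h ?_ ?_)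
  · refine sub_eq_zero.1 (hβ _ ?_)
    rw [mul_sub, ← map_mul, beta_mul_uDivBeta, h u, h β, ← map_mul, beta_mul_uDivBeta, sub_self]
  · refine sub_eq_zero.1 (hu _ ?_)
    rw [mul_sub, ← map_mul, u_mul_alphaDivU, h α, h u, ← map_mul, u_mul_alphaDivU, sub_self]

theorem algebraMap_ratPoly_injective (hu : ∀ b, u * b = 0 → b = 0) (hβ : ∀ b, β * b = 0 → b = 0) :
    Function.Injective (algebraMap B (ratPoly u α β)) := by
  have h : Function.Injective (algebraMap B (Localization.Away (u * β))) := by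
    refine IsLocalization.injective (M := Submonoid.powers (u * β)) _ ?_
    rw [Submonoid.powers_le, mem_nonZeroDivisors_iff_right]
    intro b hb
    exact hβ _ (hu _ (by linear_combination hb))
  exact fun x y hxy => h (congrArg Subtype.val hxy)

/-- Both fractions already exist in `B` when `β ∣ u ∣ α`. -/
theorem algebraMap_ratPoly_surjective (hu : β ∣ u) (hα : u ∣ α) :
    Function.Surjective (algebraMap B (ratPoly u α β)) := by
  refine ratPoly_induction (W := (algebraMap B (ratPoly u α β)).range) (fun b => ⟨b, rfl⟩) ?_ ?_
  · obtain ⟨b, hb⟩ := hu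
    refine ⟨b, sub_eq_zero.1 (ratPoly_mul_eq_zero' u α β ?_)⟩
    rw [mul_sub, ← map_mul, ← hb, beta_mul_uDivBeta, sub_self]
  · obtain ⟨b, hb⟩ := hα
    refine ⟨b, sub_eq_zero.1 (ratPoly_mul_eq_zero u α β ?_)⟩
    rw [mul_sub, ← map_mul, ← hb, u_mul_alphaDivU, sub_self]

variable {B' : Type*} [CommRing B'] {u' α' β' : B'}

theorem ratPolyMap_uDivBeta (g : B →+* B') (hu : g u = u') (hα : g α = α') (hβ : g β = β') :
    ratPolyMap g hu hα hβ (uDivBeta u α β) = uDivBeta u' α' β' := by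
  have h := congrArg (ratPolyMap g hu hα hβ) (beta_mul_uDivBeta u α β)
  rw [map_mul, (ratPolyMap_algebraMap g hu hα hβ β).trans (congrArg _ hβ),
    (ratPolyMap_algebraMap g hu hα hβ u).trans (congrArg _ hu)] at h
  refine sub_eq_zero.1 (ratPoly_mul_eq_zero' _ _ _ ?_)
  rw [mul_sub, beta_mul_uDivBeta, h, sub_self]

theorem ratPolyMap_alphaDivU (g : B →+* B') (hu : g u = u') (hα : g α = α') (hβ : g β = β') :
    ratPolyMap g hu hα hβ (alphaDivU u α β) = alphaDivU u' α' β' := by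
  have h := congrArg (ratPolyMap g hu hα hβ) (u_mul_alphaDivU u α β)
  rw [map_mul, (ratPolyMap_algebraMap g hu hα hβ u).trans (congrArg _ hu),
    (ratPolyMap_algebraMap g hu hα hβ α).trans (congrArg _ hα)] at h
  refine sub_eq_zero.1 (ratPoly_mul_eq_zero _ _ _ ?_)
  rw [mul_sub, u_mul_alphaDivU, h, sub_self]

end ratPoly

section tensorLift

variable {Λ A Q P : Type*} [CommRing Λ] [CommRing A] [Algebra Λ A] [CommRing Q] [Algebra Λ Q]
  [CommRing P]

/-- The ring homomorphism `A ⊗ Q → P` given by two ring homomorphisms that agree on the base. -/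
def tensorLift (f : A →+* P) (g : Q →+* P)
    (h : ∀ c, f (algebraMap Λ A c) = g (algebraMap Λ Q c)) : A ⊗[Λ] Q →+* P :=
  letI := (f.comp (algebraMap Λ A)).toAlgebra
  (Algebra.TensorProduct.lift (⟨f, fun _ => rfl⟩ : A →ₐ[Λ] P)
    (⟨g, fun c => (h c).symm⟩ : Q →ₐ[Λ] P) (fun _ _ => Commute.all _ _)).toRingHom

theorem tensorLift_tmul (f : A →+* P) (g : Q →+* P)
    (h : ∀ c, f (algebraMap Λ A c) = g (algebraMap Λ Q c)) (a : A) (q : Q) :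
    tensorLift f g h (a ⊗ₜ[Λ] q) = f a * g q :=
  letI := (f.comp (algebraMap Λ A)).toAlgebra
  Algebra.TensorProduct.lift_tmul (⟨f, fun _ => rfl⟩ : A →ₐ[Λ] P)
    (⟨g, fun c => (h c).symm⟩ : Q →ₐ[Λ] P) (fun _ _ => Commute.all _ _) a q

end tensorLift

/-! ### The rings `R₀[X][u/X, X^e/u]` and `B[u/t, s/u]`, and the map between them -/

section datum

variable {p : ℕ} [Fact p.Prime] {R₀ : Type*} [CommRing R₀] [Algebra ℤ_[p] R₀] (u : R₀) (e : ℕ)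

/-- The ring `R₀[X][u / X, X ^ e / u]`. -/
abbrev PolyRat : Type _ := ratPoly (C u) (X ^ e) (X : R₀[X])

instance algebraPolyRat : Algebra ℤ_[p][X] (PolyRat u e) :=
  ((algebraMap R₀[X] (PolyRat u e)).comp (mapRingHom (algebraMap ℤ_[p] R₀))).toAlgebra

theorem algebraMap_polyRat (c : ℤ_[p][X]) :
    algebraMap ℤ_[p][X] (PolyRat u e) c =
      algebraMap R₀[X] (PolyRat u e) (c.map (algebraMap ℤ_[p] R₀)) := rfl

variable {A : Type*} [CommRing A] [Algebra ℤ_[p] A]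

variable (p) (J : Ideal A) (t s : A)

/-- The map `A → R₀ ⊗̂ A`. -/
def ctRight : A →+* CTensor p u J :=
  (algebraMap (R₀ ⊗[ℤ_[p]] A) (CTensor p u J)).comp
    (Algebra.TensorProduct.includeRight : A →ₐ[ℤ_[p]] R₀ ⊗[ℤ_[p]] A)

/-- The map `R₀ → R₀ ⊗̂ A`. -/
def ctLeft : R₀ →+* CTensor p u J :=
  (algebraMap (R₀ ⊗[ℤ_[p]] A) (CTensor p u J)).comp
    (Algebra.TensorProduct.includeLeft : R₀ →ₐ[ℤ_[p]] R₀ ⊗[ℤ_[p]] A)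

theorem ctRight_apply (a : A) : ctRight p u J a = ctmul p u J 1 a := rfl

theorem ctLeft_apply (r : R₀) : ctLeft p u J r = ctmul p u J r 1 := rfl

theorem ctLeft_algebraMap (c : ℤ_[p]) :
    ctLeft p u J (algebraMap _ _ c) = ctRight p u J (algebraMap _ _ c) := by
  rw [ctLeft_apply, ctRight_apply, ctmul, ctmul]
  congr 1
  exact ((Algebra.TensorProduct.includeLeft : R₀ →ₐ[ℤ_[p]] R₀ ⊗[ℤ_[p]] A).commutes c).trans
    ((Algebra.TensorProduct.includeRight : A →ₐ[ℤ_[p]] R₀ ⊗[ℤ_[p]] A).commutes c).symm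

/-- The map `R₀[X] → R₀ ⊗̂ A` that sends `X` to `t`. -/
def polyToCT : R₀[X] →+* CTensor p u J := eval₂RingHom (ctLeft p u J) (ctmul p u J 1 t)

theorem polyToCT_C (r : R₀) : polyToCT p u J t (C r) = ctmul p u J r 1 := eval₂_C _ _

theorem polyToCT_X : polyToCT p u J t X = ctmul p u J 1 t := eval₂_X _ _

/-- The ring `B[u / t, s / u]` for `B = R₀ ⊗̂ A`. -/
abbrev CTRat : Type _ := ratPoly (ctmul p u J u 1) (ctmul p u J 1 s) (ctmul p u J 1 t)

variable {p e J t s}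

theorem tensorIdeal_fg (hJ : J.FG) : (tensorIdeal p u J).FG :=
  Submodule.FG.sup ⟨{u ⊗ₜ[ℤ_[p]] (1 : A)}, by simp⟩ (hJ.map _)

theorem ctmul_one_one : ctmul p u J 1 1 = 1 := map_one (ctRight p u J)

theorem ctmul_eq_mul (r : R₀) (a : A) : ctmul p u J r a = ctmul p u J 1 a * ctmul p u J r 1 := by
  rw [ctmul, ctmul, ctmul, ← map_mul, Algebra.TensorProduct.tmul_mul_tmul, one_mul, mul_one]

variable [Algebra ℤ_[p][X] A]

variable (e) in
/-- The conditions on `A`, its ideal of definition `J` and elements `t`, `s = t ^ e` under which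
`B[u / t, s / u]`, for `B = R₀ ⊗̂ A`, is compared with `A ⊗ R₀[X][u / X, X ^ e / u]`. -/
structure IsTensorDatum (J : Ideal A) (t s : A) : Prop where
  algebraMap_X : algebraMap ℤ_[p][X] A X = t
  algebraMap_C : ∀ c, algebraMap ℤ_[p][X] A (C c) = algebraMap ℤ_[p] A c
  eq_pow : s = t ^ e
  fg : J.FG
  le_radical : J ≤ (Ideal.span {(p : A), t}).radical

/-- The map `R₀[X][u / X, X ^ e / u] → B[u / t, s / u]`. -/
def polyRatToCTRat (hd : IsTensorDatum (p := p) e J t s) : PolyRat u e →+* CTRat p u J t s :=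
  ratPolyMap (polyToCT p u J t) (polyToCT_C p u J t u)
    (by rw [map_pow, polyToCT_X, hd.eq_pow, ← ctRight_apply, ← ctRight_apply, map_pow])
    (polyToCT_X p u J t)

theorem polyRatToCTRat_algebraMap (hd : IsTensorDatum (p := p) e J t s) (c : ℤ_[p][X]) :
    algebraMap _ (CTRat p u J t s) (ctRight p u J (algebraMap ℤ_[p][X] A c)) =
      polyRatToCTRat u hd (algebraMap _ _ c) := by
  rw [algebraMap_polyRat, polyRatToCTRat, ratPolyMap_algebraMap]
  congr 1
  have : (ctRight p u J).comp (algebraMap ℤ_[p][X] A) =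
      (polyToCT p u J t).comp (mapRingHom (algebraMap ℤ_[p] R₀)) := by
    refine Polynomial.ringHom_ext (fun c => ?_) ?_
    · simp only [RingHom.comp_apply, coe_mapRingHom, map_C, hd.algebraMap_C]
      rw [polyToCT_C, ← ctLeft_apply, ctLeft_algebraMap]
    · simp only [RingHom.comp_apply, coe_mapRingHom, map_X, hd.algebraMap_X]
      rw [polyToCT_X, ctRight_apply]
  exact RingHom.congr_fun this c

/-- The map `A ⊗ R₀[X][u / X, X ^ e / u] → B[u / t, s / u]`. -/
def tensorToCTRat (hd : IsTensorDatum (p := p) e J t s) :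
    A ⊗[ℤ_[p][X]] PolyRat u e →+* CTRat p u J t s :=
  tensorLift ((algebraMap _ _).comp (ctRight p u J)) (polyRatToCTRat u hd)
    (polyRatToCTRat_algebraMap u hd)

theorem tensorToCTRat_tmul (hd : IsTensorDatum (p := p) e J t s) (a : A) (q : PolyRat u e) :
    tensorToCTRat u hd (a ⊗ₜ[ℤ_[p][X]] q) =
      algebraMap _ _ (ctmul p u J 1 a) * polyRatToCTRat u hd q :=
  tensorLift_tmul _ _ _ a q

/-- Since `u` divides a power of `p` and, in the target, a power of `t`, all generators of the ideal
lie in the radical of `(u)`; finite generation gives a uniform power. The `(u, J)`-adic topology is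
thus compared with the `u`-adic one. -/
theorem exists_pow_tensorIdeal_map_le (hd : IsTensorDatum (p := p) e J t s)
    (hp : ∃ N : ℕ, u ∣ (p : R₀) ^ N) {W : Type*} [CommRing W] (φ : R₀ ⊗[ℤ_[p]] A →+* W)
    (ht : φ (u ⊗ₜ 1) ∣ φ (1 ⊗ₜ t) ^ e) :
    ∃ c : ℕ, (tensorIdeal p u J ^ c).map φ ≤ Ideal.span {φ (u ⊗ₜ 1)} := by
  have hle : (tensorIdeal p u J).map φ ≤ (Ideal.span {φ (u ⊗ₜ 1)}).radical := by
    rw [tensorIdeal, Ideal.map_sup, sup_le_iff, Ideal.map_span, Set.image_singleton,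
      Ideal.map_le_iff_le_comap, Ideal.map_le_iff_le_comap]
    refine ⟨Ideal.le_radical, hd.le_radical.trans ?_⟩
    rw [Ideal.comap_radical, Ideal.comap_radical, Ideal.radical_le_radical_iff, Ideal.span_le]
    rintro x (rfl | rfl)
    · obtain ⟨N, r, hN⟩ := hp
      refine ⟨N, ?_⟩
      rw [Ideal.mem_comap, Ideal.mem_comap, Ideal.mem_span_singleton]
      refine ⟨φ (r ⊗ₜ 1), ?_⟩
      rw [← map_mul, Algebra.TensorProduct.tmul_mul_tmul, ← hN, mul_one, map_pow, map_natCast]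
      congr 1
      exact (map_natCast (Algebra.TensorProduct.includeLeft : R₀ →ₐ[ℤ_[p]] R₀ ⊗[ℤ_[p]] A) p ▸
        (map_pow (Algebra.TensorProduct.includeLeft : R₀ →ₐ[ℤ_[p]] R₀ ⊗[ℤ_[p]] A) (p : R₀) N)).symm
    · refine ⟨e, ?_⟩
      rw [Ideal.mem_comap, Ideal.mem_comap, Ideal.mem_span_singleton, map_pow, map_pow]
      exact ht
  obtain ⟨c, hc⟩ := Ideal.exists_pow_le_of_le_radical_of_fg hle ((tensorIdeal_fg u hd.fg).map φ)
  exact ⟨c, by rwa [Ideal.map_pow]⟩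

end datum

/-! ### `A ⊗ R₀[X][u/X, X^e/u] → B[u/t, s/u]` modulo powers of `u` -/

section comparison

theorem algebraMap_tmul_one {p : ℕ} [Fact p.Prime] {R₀ : Type*} [CommRing R₀] [Algebra ℤ_[p] R₀]
    (u : R₀) {e : ℕ} {A : Type*} [CommRing A] [Algebra ℤ_[p][X] A] (c : ℤ_[p][X]) :
    algebraMap ℤ_[p][X] A c ⊗ₜ[ℤ_[p][X]] (1 : PolyRat u e) =
      (1 : A) ⊗ₜ algebraMap ℤ_[p][X] (PolyRat u e) c := by
  rw [Algebra.algebraMap_eq_smul_one, Algebra.algebraMap_eq_smul_one, TensorProduct.smul_tmul]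

variable {p : ℕ} [Fact p.Prime] {R₀ : Type*} [CommRing R₀] [Algebra ℤ_[p] R₀] (u : R₀) {e : ℕ}
  {A : Type*} [CommRing A] [Algebra ℤ_[p] A] [Algebra ℤ_[p][X] A] {J : Ideal A} {t s : A}

theorem polyRatToCTRat_uDivBeta (hd : IsTensorDatum (p := p) e J t s) :
    polyRatToCTRat u hd (uDivBeta _ _ _) = uDivBeta _ _ _ := ratPolyMap_uDivBeta _ _ _ _

theorem polyRatToCTRat_alphaDivU (hd : IsTensorDatum (p := p) e J t s) :
    polyRatToCTRat u hd (alphaDivU _ _ _) = alphaDivU _ _ _ := ratPolyMap_alphaDivU _ _ _ _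

theorem polyRatToCTRat_C (hd : IsTensorDatum (p := p) e J t s) (r : R₀) :
    polyRatToCTRat u hd (algebraMap _ _ (C r)) = algebraMap _ _ (ctmul p u J r 1) := by
  rw [polyRatToCTRat, ratPolyMap_algebraMap, polyToCT_C]

theorem tensorToCTRat_one_tmul (hd : IsTensorDatum (p := p) e J t s) (q : PolyRat u e) :
    tensorToCTRat u hd (1 ⊗ₜ q) = polyRatToCTRat u hd q := by
  rw [tensorToCTRat_tmul, (congrArg _ (ctmul_one_one u)).trans (map_one _), one_mul]

theorem algebraMap_mem_range_tensorToCTRat (hd : IsTensorDatum (p := p) e J t s)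
    (x : R₀ ⊗[ℤ_[p]] A) :
    algebraMap (CTensor p u J) (CTRat p u J t s) (algebraMap _ _ x) ∈
      (tensorToCTRat u hd).range := by
  induction x with
  | zero => rw [map_zero, map_zero]; exact zero_mem _
  | add x y hx hy => rw [map_add, map_add]; exact add_mem hx hy
  | tmul r a =>
    refine ⟨a ⊗ₜ algebraMap _ _ (C r), ?_⟩
    rw [tensorToCTRat_tmul, polyRatToCTRat_C, ← map_mul, ← ctmul_eq_mul]
    rfl

theorem pow_dvd_pow_map {W : Type*} [CommRing W] {I : Ideal W} {V : W} {c : ℕ}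
    (hc : I ^ c ≤ Ideal.span {V}) (k : ℕ) {x : W} (hx : x ∈ I ^ (c * k)) : V ^ k ∣ x := by
  rw [pow_mul] at hx
  rw [← Ideal.mem_span_singleton, ← Ideal.span_singleton_pow]
  exact Ideal.pow_right_mono hc k hx

theorem exists_dvd_sub_tensorToCTRat (hd : IsTensorDatum (p := p) e J t s)
    (hp : ∃ N : ℕ, u ∣ (p : R₀) ^ N) (k : ℕ) (z : CTRat p u J t s) :
    ∃ w, algebraMap _ _ (ctmul p u J u 1) ^ k ∣ z - tensorToCTRat u hd w := by
  set U := algebraMap _ (CTRat p u J t s) (ctmul p u J u 1)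
  -- The elements that can be approximated modulo `U ^ k` form a subring, so it is enough to treat
  -- `B` and the two fractions.
  let W := (((Ideal.Quotient.mk (Ideal.span {U ^ k})).comp (tensorToCTRat u hd)).range).comap
    (Ideal.Quotient.mk (Ideal.span {U ^ k}))
  have hW : ∀ z, z ∈ W ↔ ∃ w, U ^ k ∣ z - tensorToCTRat u hd w := fun z => by
    refine exists_congr fun w => ?_
    rw [RingHom.comp_apply, eq_comm, Ideal.Quotient.eq, Ideal.mem_span_singleton]
  rw [← hW]
  refine ratPoly_induction (fun b => ?_) ?_ ?_ z
  · rw [hW]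
    obtain ⟨c, hc⟩ := exists_pow_tensorIdeal_map_le u hd hp
      ((algebraMap (CTensor p u J) (CTRat p u J t s)).comp (algebraMap _ _))
      ⟨alphaDivU _ _ _ , by
        change algebraMap _ _ (ctRight p u J t) ^ e = U * _
        rw [u_mul_alphaDivU, ← map_pow, ← map_pow, ← hd.eq_pow, ctRight_apply]⟩
    obtain ⟨x, -, hx⟩ := exists_evalₐ_eq _ (c * k) b
    obtain ⟨w, hw⟩ := algebraMap_mem_range_tensorToCTRat u hd x
    refine ⟨w, ?_⟩
    rw [hw, ← map_sub]
    have h1 := Ideal.mem_map_of_mem (algebraMap (CTensor p u J) (CTRat p u J t s))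
      (mem_map_pow_of_evalₐ_eq_zero (tensorIdeal_fg u hd.fg) hx)
    rw [Ideal.map_map, Ideal.map_pow] at h1
    rw [Ideal.map_pow] at hc
    exact pow_dvd_pow_map hc k h1
  · rw [hW]
    exact ⟨1 ⊗ₜ uDivBeta _ _ _, by
      rw [tensorToCTRat_one_tmul, polyRatToCTRat_uDivBeta, sub_self]; exact dvd_zero _⟩
  · rw [hW]
    exact ⟨1 ⊗ₜ alphaDivU _ _ _, by
      rw [tensorToCTRat_one_tmul, polyRatToCTRat_alphaDivU, sub_self]; exact dvd_zero _⟩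

variable (p e A) in
/-- The element `1 ⊗ u` of `A ⊗ R₀[X][u / X, X ^ e / u]`. -/
def tensorU : A ⊗[ℤ_[p][X]] PolyRat u e := 1 ⊗ₜ algebraMap R₀[X] _ (C u)

theorem tensorToCTRat_tensorU (hd : IsTensorDatum (p := p) e J t s) :
    tensorToCTRat u hd (tensorU p u e A) = algebraMap _ _ (ctmul p u J u 1) := by
  rw [tensorU, tensorToCTRat_one_tmul, polyRatToCTRat_C]

/-- The map `R₀ ⊗ A → A ⊗ R₀[X][u / X, X ^ e / u]`. -/
def toTensorPolyRat (hd : IsTensorDatum (p := p) e J t s) :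
    R₀ ⊗[ℤ_[p]] A →+* A ⊗[ℤ_[p][X]] PolyRat u e :=
  tensorLift
    (((Algebra.TensorProduct.includeRight : PolyRat u e →ₐ[ℤ_[p][X]] A ⊗[ℤ_[p][X]] PolyRat u e) :
      PolyRat u e →+* _).comp ((algebraMap R₀[X] (PolyRat u e)).comp C))
    (Algebra.TensorProduct.includeLeft : A →ₐ[ℤ_[p][X]] A ⊗[ℤ_[p][X]] PolyRat u e)
    (fun c => by
      have h1 : algebraMap R₀[X] (PolyRat u e) (C (algebraMap ℤ_[p] R₀ c)) =
        algebraMap ℤ_[p][X] _ (C c) := by rw [algebraMap_polyRat, map_C]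
      rw [RingHom.comp_apply, RingHom.comp_apply, h1, ← hd.algebraMap_C]
      exact (algebraMap_tmul_one u (C c)).symm)

theorem toTensorPolyRat_tmul (hd : IsTensorDatum (p := p) e J t s) (r : R₀) (a : A) :
    toTensorPolyRat u hd (r ⊗ₜ a) = a ⊗ₜ algebraMap _ _ (C r) := by
  refine (tensorLift_tmul _ _ _ r a).trans ?_
  change (1 : A) ⊗ₜ[ℤ_[p][X]] (_ : PolyRat u e) * (a ⊗ₜ[ℤ_[p][X]] (1 : PolyRat u e)) = _
  rw [Algebra.TensorProduct.tmul_mul_tmul, one_mul, mul_one]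
  rfl

theorem t_tmul_one (hd : IsTensorDatum (p := p) e J t s) :
    t ⊗ₜ[ℤ_[p][X]] (1 : PolyRat u e) = (1 : A) ⊗ₜ algebraMap R₀[X] _ X := by
  have h := algebraMap_polyRat (p := p) u e X
  rw [map_X] at h
  rw [← h, ← hd.algebraMap_X]
  exact algebraMap_tmul_one u X

theorem t_tmul_one_mul (hd : IsTensorDatum (p := p) e J t s) :
    (t ⊗ₜ[ℤ_[p][X]] (1 : PolyRat u e)) * 1 ⊗ₜ uDivBeta _ _ _ = tensorU p u e A := by
  rw [t_tmul_one u hd, Algebra.TensorProduct.tmul_mul_tmul, one_mul, beta_mul_uDivBeta, tensorU]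

theorem tensorU_mul (hd : IsTensorDatum (p := p) e J t s) :
    tensorU p u e A * 1 ⊗ₜ[ℤ_[p][X]] alphaDivU _ _ _ = s ⊗ₜ 1 := by
  rw [tensorU, Algebra.TensorProduct.tmul_mul_tmul, one_mul, u_mul_alphaDivU, hd.eq_pow]
  have h := congrArg (· ^ e) (t_tmul_one (p := p) u hd)
  simp only [Algebra.TensorProduct.tmul_pow, one_pow] at h
  rw [h, map_pow]

theorem algebraMap_C_one : algebraMap R₀[X] (PolyRat u e) (C 1) = 1 :=
  (congrArg _ C_1).trans (map_one _)

theorem exists_completion_map (hd : IsTensorDatum (p := p) e J t s)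
    (hp : ∃ N : ℕ, u ∣ (p : R₀) ^ N) :
    ∃ Φ : CTensor p u J →+* AdicCompletion (Ideal.span {tensorU p u e A})
      (A ⊗[ℤ_[p][X]] PolyRat u e),
      ∀ r a, Φ (ctmul p u J r a) = algebraMap _ _ (a ⊗ₜ[ℤ_[p][X]] algebraMap R₀[X] (PolyRat u e) (C r)) := by
  have hU : toTensorPolyRat u hd (u ⊗ₜ 1) = tensorU p u e A := toTensorPolyRat_tmul u hd u 1
  obtain ⟨c, hc⟩ := exists_pow_tensorIdeal_map_le u hd hp (toTensorPolyRat u hd) (by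
    rw [hU, toTensorPolyRat_tmul, map_one, map_one, Algebra.TensorProduct.tmul_pow, one_pow,
      ← hd.eq_pow, ← tensorU_mul u hd]
    exact dvd_mul_right _ _)
  rw [hU] at hc
  refine ⟨adicLift _ c hc, fun r a => ?_⟩
  rw [ctmul, adicLift_algebraMap, toTensorPolyRat_tmul]

/-- Verified on the two tensor factors, using `ratPoly_hom_ext` on the second. For `D` the
completion of `A ⊗ Q`, it says that `Φ` provides a left inverse of `tensorToCTRat` up to completion.
-/
theorem ratPolyMap_tensorToCTRat (hd : IsTensorDatum (p := p) e J t s) {D : Type*} [CommRing D]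
    (Φ : CTensor p u J →+* D) (θ : A ⊗[ℤ_[p][X]] PolyRat u e →+* D)
    (hΦ : ∀ r a, Φ (ctmul p u J r a) = θ (a ⊗ₜ[ℤ_[p][X]] algebraMap R₀[X] (PolyRat u e) (C r)))
    {u' s' t' : D} (hu : Φ (ctmul p u J u 1) = u') (hs : Φ (ctmul p u J 1 s) = s')
    (ht : Φ (ctmul p u J 1 t) = t') (w : A ⊗[ℤ_[p][X]] PolyRat u e) :
    ratPolyMap Φ hu hs ht (tensorToCTRat u hd w) = algebraMap D _ (θ w) := by
  have hpoly : ∀ f : R₀[X], Φ (polyToCT p u J t f) =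
      θ ((1 : A) ⊗ₜ[ℤ_[p][X]] algebraMap R₀[X] (PolyRat u e) f) := by
    have : Φ.comp (polyToCT p u J t) = (θ.comp
        ((Algebra.TensorProduct.includeRight : PolyRat u e →ₐ[ℤ_[p][X]]
          A ⊗[ℤ_[p][X]] PolyRat u e) : PolyRat u e →+* _)).comp (algebraMap _ _) := by
      refine Polynomial.ringHom_ext (fun r => ?_) ?_
      · rw [RingHom.comp_apply, polyToCT_C, hΦ]
        rfl
      · rw [RingHom.comp_apply, polyToCT_X, hΦ, map_one, map_one, t_tmul_one u hd]
        rfl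
    exact RingHom.congr_fun this
  have hP : ∀ f : R₀[X], ratPolyMap Φ hu hs ht (polyRatToCTRat u hd (algebraMap _ _ f)) =
      algebraMap _ _ (Φ (polyToCT p u J t f)) := fun f => by
    rw [polyRatToCTRat, ratPolyMap_algebraMap, ratPolyMap_algebraMap]
  have hQ : (ratPolyMap Φ hu hs ht).comp (polyRatToCTRat u hd) = ((algebraMap _ _).comp θ).comp
      ((Algebra.TensorProduct.includeRight : PolyRat u e →ₐ[ℤ_[p][X]]
        A ⊗[ℤ_[p][X]] PolyRat u e) : PolyRat u e →+* _) := by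
    refine ratPoly_hom_ext (fun f => ?_) (fun d hd' => ?_) (fun d hd' => ?_)
    · rw [RingHom.comp_apply, hP, hpoly]
      rfl
    · rw [RingHom.comp_apply, hP, polyToCT_C, hu] at hd'
      exact ratPoly_mul_eq_zero _ _ _ hd'
    · rw [RingHom.comp_apply, hP, polyToCT_X, ht] at hd'
      exact ratPoly_mul_eq_zero' _ _ _ hd'
  induction w with
  | zero => simp only [map_zero]
  | add x y hx hy => simp only [map_add, hx, hy]
  | tmul a q =>
    have h1 := RingHom.congr_fun hQ q
    rw [RingHom.comp_apply] at h1
    rw [tensorToCTRat_tmul, map_mul, h1, ratPolyMap_algebraMap, hΦ, map_one, map_one]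
    change algebraMap _ _ _ * algebraMap _ _ (θ ((1 : A) ⊗ₜ[ℤ_[p][X]] q)) = _
    rw [← map_mul, ← map_mul, Algebra.TensorProduct.tmul_mul_tmul, one_mul, mul_one]

/-- In the completion of `T` one has `β' ∣ V ∣ α'`, with `V` still a nonzerodivisor, so adjoining
the fractions changes nothing there. Applying `Φ` to the given divisibility therefore yields `V ^ k
∣ w` in the completion, hence in `T`. -/
theorem dvd_of_dvd_map {B T : Type*} [CommRing B] [CommRing T] {u α β : B} {V α' β' : T}
    (hV : ∀ x : T, V * x = 0 → x = 0) (hβV : β' ∣ V) (hVα : V ∣ α')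
    (Φ : B →+* AdicCompletion (Ideal.span {V}) T) (hu : Φ u = algebraMap T _ V)
    (hα : Φ α = algebraMap T _ α') (hβ : Φ β = algebraMap T _ β') (μ : T →+* ratPoly u α β)
    (hμ : ∀ w, ratPolyMap Φ hu hα hβ (μ w) = algebraMap _ _ (algebraMap T (AdicCompletion (Ideal.span {V}) T) w)) {k : ℕ} {w : T}
    (hw : algebraMap B _ u ^ k ∣ μ w) : V ^ k ∣ w := by
  have hu1 : ∀ d, algebraMap T (AdicCompletion (Ideal.span {V}) T) V * d = 0 → d = 0 :=
    fun d hd => algebraMap_mul_eq_zero hV hd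
  have ht1 : ∀ d, algebraMap T (AdicCompletion (Ideal.span {V}) T) β' * d = 0 → d = 0 :=
    fun d hd => by
      obtain ⟨y, hy⟩ := map_dvd (algebraMap T (AdicCompletion (Ideal.span {V}) T)) hβV
      exact hu1 d ((congrArg (· * d) hy).trans (by rw [mul_right_comm, hd, zero_mul]))
  obtain ⟨z, hz⟩ := hw
  obtain ⟨d, hd'⟩ := algebraMap_ratPoly_surjective
    (map_dvd (algebraMap T (AdicCompletion (Ideal.span {V}) T)) hβV) (map_dvd _ hVα)
    (ratPolyMap Φ hu hα hβ z)
  have h1 := congrArg (ratPolyMap Φ hu hα hβ) hz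
  rw [hμ, map_mul, map_pow, (ratPolyMap_algebraMap Φ hu hα hβ u).trans (congrArg _ hu), ← hd',
    ← map_pow] at h1
  rw [← evalₐ_algebraMap_eq_zero_iff]
  exact evalₐ_eq_zero_of_pow_dvd _ ⟨d, algebraMap_ratPoly_injective hu1 ht1
    (h1.trans (map_mul _ _ _).symm)⟩

set_option maxHeartbeats 1000000 in
/-- If `1 ⊗ u` is not a zero divisor, then `A ⊗ R₀[X][u / X, X ^ e / u] → B[u / t, s / u]` is
injective modulo powers of `u`. -/
theorem dvd_of_dvd_tensorToCTRat (hd : IsTensorDatum (p := p) e J t s)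
    (hp : ∃ N : ℕ, u ∣ (p : R₀) ^ N)
    (hu : ∀ x : A ⊗[ℤ_[p][X]] PolyRat u e, tensorU p u e A * x = 0 → x = 0) {k : ℕ}
    {w : A ⊗[ℤ_[p][X]] PolyRat u e}
    (hw : algebraMap _ _ (ctmul p u J u 1) ^ k ∣ tensorToCTRat u hd w) :
    tensorU p u e A ^ k ∣ w := by
  obtain ⟨Φ, hΦ⟩ := exists_completion_map u hd hp
  have h0 : ∀ a, Φ (ctmul p u J 1 a) = algebraMap _ _ (a ⊗ₜ[ℤ_[p][X]] (1 : PolyRat u e)) :=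
    fun a => (hΦ 1 a).trans (congrArg (fun q => algebraMap _ _ (a ⊗ₜ[ℤ_[p][X]] q))
      (algebraMap_C_one u))
  have h3 : t ⊗ₜ[ℤ_[p][X]] (1 : PolyRat u e) ∣ tensorU p u e A :=
    ⟨_, (t_tmul_one_mul u hd).symm⟩
  have h4 : tensorU p u e A ∣ s ⊗ₜ[ℤ_[p][X]] (1 : PolyRat u e) := ⟨_, (tensorU_mul u hd).symm⟩
  have h5 := ratPolyMap_tensorToCTRat u hd Φ (algebraMap _ _) hΦ (hΦ u 1) (h0 s) (h0 t)
  exact dvd_of_dvd_map hu h3 h4 Φ (hΦ u 1) (h0 s) (h0 t) (tensorToCTRat u hd) h5 hw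

end comparison

/-! ## The ideal `(p, X)` of `ℤ_p[X]` -/

section maximalIdeal

variable (p : ℕ) [Fact p.Prime]

theorem span_p_X_eq : Ideal.span {C (p : ℤ_[p]), X} =
    (Ideal.span {(p : ℤ_[p])}).comap (constantCoeff : ℤ_[p][X] →+* ℤ_[p]) := by
  refine le_antisymm ?_ fun f hf => ?_
  · rw [Ideal.span_le]
    rintro x (rfl | rfl)
    · exact Ideal.mem_span_singleton.2 (by simp)
    · exact Ideal.mem_span_singleton.2 (by simp)
  · obtain ⟨c, hc⟩ := Ideal.mem_span_singleton.1 (Ideal.mem_comap.1 hf)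
    refine Ideal.mem_span_pair.2 ⟨C c, f.divX, ?_⟩
    rw [constantCoeff_apply] at hc
    conv_rhs => rw [← f.divX_mul_X_add, hc]
    rw [C_mul]
    ring

instance isMaximal_span_p_X : (Ideal.span {C (p : ℤ_[p]), X}).IsMaximal := by
  rw [span_p_X_eq]
  have : (Ideal.span {(p : ℤ_[p])}).IsMaximal := by
    rw [← PadicInt.maximalIdeal_eq_span_p]
    infer_instance
  exact Ideal.comap_isMaximal_of_surjective _ constantCoeff_surjective

end maximalIdeal

theorem exists_pow_dvd_algebraMap_aux {Λ W : Type*} [CommRing Λ] [CommRing W] [Algebra Λ W]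
    {P T : Λ} {U : W} (hP : ∃ N : ℕ, U ∣ algebraMap Λ W P ^ N)
    (hT : ∃ N : ℕ, U ∣ algebraMap Λ W T ^ N) (k : ℕ) :
    ∃ r : ℕ, ∀ a ∈ Ideal.span {P, T} ^ r, U ^ k ∣ algebraMap Λ W a := by
  have hle : Ideal.span {P, T} ≤ ((Ideal.span {U ^ k}).comap (algebraMap Λ W)).radical := by
    rw [Ideal.span_le]
    have key : ∀ x : Λ, (∃ N : ℕ, U ∣ algebraMap Λ W x ^ N) →
        x ∈ ((Ideal.span {U ^ k}).comap (algebraMap Λ W)).radical := by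
      rintro x ⟨N, hN⟩
      refine ⟨N * k, ?_⟩
      rw [Ideal.mem_comap, Ideal.mem_span_singleton, pow_mul, map_pow, map_pow]
      exact pow_dvd_pow_of_dvd hN k
    rintro x (rfl | rfl)
    · exact key _ hP
    · exact key _ hT
  obtain ⟨r, hr⟩ := Ideal.exists_pow_le_of_le_radical_of_fg hle (Submodule.fg_span (Set.toFinite _))
  exact ⟨r, fun a ha => Ideal.mem_span_singleton.1 (hr ha)⟩

/-! ### Change of `A`, and injectivity modulo powers of `u` -/

section functoriality

variable {p : ℕ} [Fact p.Prime] {R₀ : Type*} [CommRing R₀] [Algebra ℤ_[p] R₀] (u : R₀) {e : ℕ}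
  {A A' : Type*} [CommRing A] [Algebra ℤ_[p] A] {J : Ideal A} {t s : A}
  [CommRing A'] [Algebra ℤ_[p] A'] {J' : Ideal A'} {t' s' : A'}

variable (f : A' →ₐ[ℤ_[p]] A) (hJ : J'.map f ≤ J)
  (h1 : ctMap p u f hJ (ctmul p u J' u 1) = ctmul p u J u 1)
  (h2 : ctMap p u f hJ (ctmul p u J' 1 s') = ctmul p u J 1 s)
  (h3 : ctMap p u f hJ (ctmul p u J' 1 t') = ctmul p u J 1 t)

theorem ratPolyMap_ctMap_ctmul (a : A') :
    ratPolyMap (ctMap p u f hJ) h1 h2 h3 (algebraMap _ _ (ctmul p u J' 1 a)) =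
      algebraMap _ (CTRat p u J t s) (ctmul p u J 1 (f a)) := by
  rw [ratPolyMap_algebraMap, ctMap_ctmul]

variable [Algebra ℤ_[p][X] A] [Algebra ℤ_[p][X] A']

/-- A map of `ℤ_p`-algebras that sends `t'` to `t` as a map of `ℤ_p[X]`-algebras. -/
def polyAlgHom (hd' : IsTensorDatum (p := p) e J' t' s') (hd : IsTensorDatum (p := p) e J t s)
    (ht : f t' = t) : A' →ₐ[ℤ_[p][X]] A where
  __ := (f : A' →+* A)
  commutes' c := by
    have : (f : A' →+* A).comp (algebraMap ℤ_[p][X] A') = algebraMap ℤ_[p][X] A := by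
      refine Polynomial.ringHom_ext (fun c => ?_) ?_
      · rw [RingHom.comp_apply, hd'.algebraMap_C, hd.algebraMap_C]
        exact f.commutes c
      · rw [RingHom.comp_apply, hd'.algebraMap_X, hd.algebraMap_X]
        exact ht
    exact RingHom.congr_fun this c

theorem ratPolyMap_polyRatToCTRat (hd' : IsTensorDatum (p := p) e J' t' s')
    (hd : IsTensorDatum (p := p) e J t s) (q : PolyRat u e) :
    ratPolyMap (ctMap p u f hJ) h1 h2 h3 (polyRatToCTRat u hd' q) = polyRatToCTRat u hd q := by
  have hpoly : ∀ g : R₀[X], ctMap p u f hJ (polyToCT p u J' t' g) = polyToCT p u J t g := by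
    have : (ctMap p u f hJ).comp (polyToCT p u J' t') = polyToCT p u J t := by
      refine Polynomial.ringHom_ext (fun r => ?_) ?_
      · rw [RingHom.comp_apply, polyToCT_C, polyToCT_C, ctMap_ctmul, map_one]
      · rw [RingHom.comp_apply, polyToCT_X, polyToCT_X, h3]
    exact RingHom.congr_fun this
  have h : (ratPolyMap (ctMap p u f hJ) h1 h2 h3).comp (polyRatToCTRat u hd') =
      polyRatToCTRat u hd := by
    refine ratPoly_hom_ext (fun g => ?_) (fun d hd => ?_) (fun d hd => ?_)
    · rw [RingHom.comp_apply, polyRatToCTRat, polyRatToCTRat, ratPolyMap_algebraMap,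
        ratPolyMap_algebraMap, ratPolyMap_algebraMap, hpoly]
    · rw [RingHom.comp_apply, polyRatToCTRat, ratPolyMap_algebraMap, ratPolyMap_algebraMap, hpoly,
        polyToCT_C] at hd
      exact ratPoly_mul_eq_zero _ _ _ hd
    · rw [RingHom.comp_apply, polyRatToCTRat, ratPolyMap_algebraMap, ratPolyMap_algebraMap, hpoly,
        polyToCT_X] at hd
      exact ratPoly_mul_eq_zero' _ _ _ hd
  exact RingHom.congr_fun h q

theorem ratPolyMap_ctMap_tensorToCTRat (hd' : IsTensorDatum (p := p) e J' t' s')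
    (hd : IsTensorDatum (p := p) e J t s) (ht : f t' = t) (w : A' ⊗[ℤ_[p][X]] PolyRat u e) :
    ratPolyMap (ctMap p u f hJ) h1 h2 h3 (tensorToCTRat u hd' w) =
      tensorToCTRat u hd (Algebra.TensorProduct.map (polyAlgHom f hd' hd ht) (AlgHom.id _ _) w) := by
  induction w with
  | zero => simp only [map_zero]
  | add x y hx hy => simp only [map_add, hx, hy]
  | tmul a q =>
    rw [tensorToCTRat_tmul, map_mul, ratPolyMap_ctMap_ctmul, ratPolyMap_polyRatToCTRat _ _ _ _ _ _
      hd' hd, Algebra.TensorProduct.map_tmul, tensorToCTRat_tmul]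
    rfl

theorem U_dvd_algebraMap_C_p_pow (hp : ∃ N : ℕ, u ∣ (p : R₀) ^ N) :
    ∃ N : ℕ, algebraMap R₀[X] (PolyRat u e) (C u) ∣
      algebraMap ℤ_[p][X] (PolyRat u e) (C (p : ℤ_[p])) ^ N := by
  obtain ⟨N, r, hN⟩ := hp
  refine ⟨N, algebraMap _ _ (C r), ?_⟩
  have h1 : algebraMap ℤ_[p][X] (PolyRat u e) (C (p : ℤ_[p])) =
      algebraMap R₀[X] (PolyRat u e) (C (p : R₀)) := by
    rw [algebraMap_polyRat, map_C, map_natCast]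
  have h2 : (C (p : R₀)) ^ N = C u * C r := by rw [← C_pow, hN, C_mul]
  rw [h1]
  exact ((map_pow (algebraMap R₀[X] (PolyRat u e)) _ _).symm.trans (congrArg _ h2)).trans
    (map_mul _ _ _)

theorem U_dvd_algebraMap_X_pow :
    algebraMap R₀[X] (PolyRat u e) (C u) ∣ algebraMap ℤ_[p][X] (PolyRat u e) X ^ e := by
  have h1 : algebraMap ℤ_[p][X] (PolyRat u e) X = algebraMap R₀[X] (PolyRat u e) X := by
    rw [algebraMap_polyRat, map_X]
  rw [h1]
  exact ⟨_, (map_pow (algebraMap R₀[X] (PolyRat u e)) _ _).symm.trans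
    (u_mul_alphaDivU (C u) (X ^ e) (X : R₀[X])).symm⟩

theorem exists_pow_dvd_algebraMap (hp : ∃ N : ℕ, u ∣ (p : R₀) ^ N) (k : ℕ) :
    ∃ r : ℕ, ∀ a ∈ Ideal.span {C (p : ℤ_[p]), X} ^ r,
      (algebraMap R₀[X] (PolyRat u e) (C u)) ^ k ∣ algebraMap ℤ_[p][X] (PolyRat u e) a :=
  exists_pow_dvd_algebraMap_aux (U_dvd_algebraMap_C_p_pow u hp) ⟨e, U_dvd_algebraMap_X_pow u⟩ k

variable (hp : ∃ N : ℕ, u ∣ (p : R₀) ^ N)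
  (hreg : ∀ x : A, (p : A) * x = 0 → x = 0)
  (hreg' : ∀ x y : A, t * x = p * y → ∃ z, x = p * z)

theorem C_p_smul (hd : IsTensorDatum (p := p) e J t s) (x : A) :
    C (p : ℤ_[p]) • x = (p : A) * x := by
  rw [Algebra.smul_def, hd.algebraMap_C, map_natCast]

theorem X_smul (hd : IsTensorDatum (p := p) e J t s) (x : A) :
    (X : ℤ_[p][X]) • x = t * x := by
  rw [Algebra.smul_def, hd.algebraMap_X]

include hp hreg hreg'

theorem tensorU_mul_eq_zero (hd : IsTensorDatum (p := p) e J t s)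
    (x : A ⊗[ℤ_[p][X]] PolyRat u e) (hx : tensorU p u e A * x = 0) : x = 0 := by
  obtain ⟨r, hr⟩ := exists_pow_dvd_algebraMap_aux (U_dvd_algebraMap_C_p_pow (e := e) u hp)
    ⟨e, U_dvd_algebraMap_X_pow u⟩ 1
  have h1 : ∀ x : A, C (p : ℤ_[p]) • x = 0 → x = 0 := fun x => by
    rw [C_p_smul hd]
    exact hreg x
  have h2 : ∀ x y : A, (X : ℤ_[p][X]) • x = C (p : ℤ_[p]) • y →
      ∃ z, x = C (p : ℤ_[p]) • z := fun x y => by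
    simp only [C_p_smul hd, X_smul hd]
    exact hreg' x y
  have h3 : ∀ q : PolyRat u e, algebraMap R₀[X] (PolyRat u e) (C u) * q = 0 → q = 0 :=
    fun q => ratPoly_mul_eq_zero _ _ _
  exact one_tmul_mul_eq_zero (Ideal.span {C (p : ℤ_[p]), X}) rfl h1 h2 h3
    (fun a ha => (pow_one (algebraMap R₀[X] (PolyRat u e) (C u))).symm.dvd.trans (hr a ha)) hx

/-- If `A' / (p, t) → A / (p, t)` is injective, then `B'[u / t, s / u] → B[u / t, s / u]` is
injective modulo powers of `u`. -/
theorem dvd_of_dvd_ratPolyMap (hd' : IsTensorDatum (p := p) e J' t' s')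
    (hd : IsTensorDatum (p := p) e J t s) (ht : f t' = t)
    (hf : ∀ x, f x ∈ Ideal.span {(p : A), t} → x ∈ Ideal.span {(p : A'), t'}) {k : ℕ}
    {z : CTRat p u J' t' s'}
    (hz : algebraMap _ _ (ctmul p u J u 1) ^ k ∣ ratPolyMap (ctMap p u f hJ) h1 h2 h3 z) :
    algebraMap _ _ (ctmul p u J' u 1) ^ k ∣ z := by
  obtain ⟨w, hw⟩ := exists_dvd_sub_tensorToCTRat u hd' hp k z
  have hmapU : ratPolyMap (ctMap p u f hJ) h1 h2 h3 (algebraMap _ _ (ctmul p u J' u 1)) =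
      algebraMap _ _ (ctmul p u J u 1) := (ratPolyMap_algebraMap _ _ _ _ _).trans (congrArg _ h1)
  have h4 := map_dvd (ratPolyMap (ctMap p u f hJ) h1 h2 h3) hw
  rw [map_pow, hmapU, map_sub, dvd_sub_right hz, ratPolyMap_ctMap_tensorToCTRat _ _ _ _ _ _
    hd' hd ht] at h4
  -- Injectivity modulo `u ^ k` is used over `A` only; over `A'` the approximation `hw` suffices.
  have h5 := dvd_of_dvd_tensorToCTRat u hd hp (tensorU_mul_eq_zero u hp hreg hreg' hd) h4
  obtain ⟨r, hr⟩ := exists_pow_dvd_algebraMap (e := e) u hp k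
  have h6 : tensorU p u e A' ^ k ∣ w := by
    rw [tensorU, Algebra.TensorProduct.tmul_pow, one_pow] at h5 ⊢
    refine one_tmul_dvd_of_map_dvd (Ideal.span {C (p : ℤ_[p]), X}) rfl ?_ ?_
      (polyAlgHom f hd' hd ht) (fun x hx => ?_) hr h5
    · intro x
      rw [C_p_smul hd]
      exact hreg x
    · intro x y
      simp only [C_p_smul hd, X_smul hd]
      exact hreg' x y
    · rw [Ideal.smul_top_eq_map, Submodule.restrictScalars_mem, Ideal.map_span, Set.image_pair,
        hd.algebraMap_C, hd.algebraMap_X, map_natCast] at hx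
      rw [Ideal.smul_top_eq_map, Submodule.restrictScalars_mem, Ideal.map_span, Set.image_pair,
        hd'.algebraMap_C, hd'.algebraMap_X, map_natCast]
      exact hf x hx
  have h7 := map_dvd (tensorToCTRat u hd') h6
  rw [map_pow, tensorToCTRat_tensorU] at h7
  exact (dvd_iff_dvd_of_dvd_sub hw).2 h7

end functoriality

/-! ### Descent of invariants by approximate traces -/

section trace

variable {p : ℕ} [Fact p.Prime] {R₀ : Type*} [CommRing R₀] [Algebra ℤ_[p] R₀] (u : R₀) {e : ℕ}
  {A A' : Type*} [CommRing A] [Algebra ℤ_[p] A] {J : Ideal A} {t s : A}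
  [CommRing A'] [Algebra ℤ_[p] A'] {J' : Ideal A'} {t' s' : A'}

theorem exists_eq_sum_tmul {Λ M N : Type*} [CommRing Λ] [AddCommGroup M] [Module Λ M]
    [AddCommGroup N] [Module Λ N] (x : M ⊗[Λ] N) :
    ∃ (k : ℕ) (a : Fin k → M) (b : Fin k → N), x = ∑ i, a i ⊗ₜ b i := by
  induction x with
  | zero => exact ⟨0, Fin.elim0, Fin.elim0, by simp⟩
  | tmul a b => exact ⟨1, fun _ => a, fun _ => b, by simp⟩
  | add x y hx hy =>
    obtain ⟨k, a, b, rfl⟩ := hx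
    obtain ⟨l, c, d, rfl⟩ := hy
    exact ⟨k + l, Fin.append a c, Fin.append b d, by rw [Fin.sum_univ_add]; simp⟩

/-- The computation with approximate traces, for a ring `P` that receives a map from `A`. -/
theorem dvd_trace_sub {A P κ ι : Type*} [CommRing A] [CommRing P] [Fintype κ] [Fintype ι]
    (ρ : A →+* P) (γ : κ → A →+* A) (γP : κ → P →+* P) {V t w : A} {U z : P}
    (q : ι → P) (a : ι → A) (hU : ∀ g, γP g U = U) (hq : ∀ g i, γP g (q i) = q i)
    (hρ : ∀ g x, γP g (ρ x) = ρ (γ g x)) (hz : ∀ g, U ∣ γP g z - z)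
    (ha : U ∣ z - ∑ i, ρ (a i) * q i) (hV : U ∣ ρ V) (hw : V ∣ ∑ g, γ g w - t) :
    U ∣ ρ t * z - ∑ i, ρ (∑ g, γ g (w * a i)) * q i := by
  -- Apply `γP g` to the approximation of `z` multiplied by `ρ w`; invariance of `z` modulo `U` puts
  -- `z` back in place of its conjugate.
  have h1 : ∀ g, U ∣ ρ (γ g w) * z - ∑ i, ρ (γ g (w * a i)) * q i := fun g => by
    have h2 := map_dvd (γP g) (ha.mul_left (ρ w))
    rw [hU, map_mul, hρ, map_sub, map_sum] at h2
    have h3 : ∑ i, ρ (γ g (w * a i)) * q i = ρ (γ g w) * ∑ i, γP g (ρ (a i) * q i) := by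
      rw [Finset.mul_sum]
      refine Finset.sum_congr rfl fun i _ => ?_
      rw [map_mul, map_mul, map_mul, hρ, hq, mul_assoc]
    have h4 : ρ (γ g w) * z - ∑ i, ρ (γ g (w * a i)) * q i =
        ρ (γ g w) * (γP g z - ∑ i, γP g (ρ (a i) * q i)) - ρ (γ g w) * (γP g z - z) := by
      rw [h3]; ring
    rw [h4]
    exact dvd_sub h2 ((hz g).mul_left _)
  have h2 : U ∣ ∑ g, (ρ (γ g w) * z - ∑ i, ρ (γ g (w * a i)) * q i) :=
    Finset.dvd_sum fun g _ => h1 g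
  have h3 : ∑ g, (ρ (γ g w) * z - ∑ i, ρ (γ g (w * a i)) * q i) =
      ρ (∑ g, γ g w - t) * z + (ρ t * z - ∑ i, ρ (∑ g, γ g (w * a i)) * q i) := by
    have h4 : ∑ g, ∑ i, ρ (γ g (w * a i)) * q i = ∑ i, ρ (∑ g, γ g (w * a i)) * q i := by
      rw [Finset.sum_comm]
      exact Finset.sum_congr rfl fun i _ => by rw [map_sum, Finset.sum_mul]
    rw [Finset.sum_sub_distrib, h4, ← Finset.sum_mul, map_sub, map_sum]
    ring
  rw [h3] at h2
  exact (dvd_add_right ((hV.trans (map_dvd ρ hw)).mul_right z)).1 h2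

variable [Algebra ℤ_[p][X] A] [Algebra ℤ_[p][X] A']

/-- If approximate traces exist, then an element of `B[u / t, s / u]` that is invariant modulo
`u ^ k` becomes, after multiplication by `u`, congruent to an element of `B'[u / t, s / u]`. -/
theorem exists_dvd_sub_of_trace (f : A' →ₐ[ℤ_[p]] A) (hJ : J'.map f ≤ J)
    (h1 : ctMap p u f hJ (ctmul p u J' u 1) = ctmul p u J u 1)
    (h2 : ctMap p u f hJ (ctmul p u J' 1 s') = ctmul p u J 1 s)
    (h3 : ctMap p u f hJ (ctmul p u J' 1 t') = ctmul p u J 1 t)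
    (hp : ∃ N : ℕ, u ∣ (p : R₀) ^ N)
    (hd' : IsTensorDatum (p := p) e J' t' s') (hd : IsTensorDatum (p := p) e J t s)
    {G : Type*} (γ : G → A →ₐ[ℤ_[p]] A) (hγJ : ∀ g, J.map (γ g) ≤ J)
    (hγ1 : ∀ g, ctMap p u (γ g) (hγJ g) (ctmul p u J u 1) = ctmul p u J u 1)
    (hγ2 : ∀ g, ctMap p u (γ g) (hγJ g) (ctmul p u J 1 s) = ctmul p u J 1 s)
    (hγ3 : ∀ g, ctMap p u (γ g) (hγJ g) (ctmul p u J 1 t) = ctmul p u J 1 t)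
    (htr : ∀ (N j : ℕ) {l : ℕ} (a : Fin l → A), ∃ (κ : Type) (_ : Fintype κ) (σ : κ → G) (w : A)
      (a' : Fin l → A), (∀ i, a i - a' i ∈ Ideal.span {(p : A) ^ N, t ^ j}) ∧
      (∀ i, ∃ b, f b = ∑ q, γ (σ q) (w * a' i)) ∧ (p : A) ^ N ∣ ∑ q, γ (σ q) w - t)
    {k : ℕ} {z : CTRat p u J t s}
    (hz : ∀ g, algebraMap _ _ (ctmul p u J u 1) ^ k ∣
      ratPolyMap (ctMap p u (γ g) (hγJ g)) (hγ1 g) (hγ2 g) (hγ3 g) z - z) :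
    ∃ z' : CTRat p u J' t' s', algebraMap _ _ (ctmul p u J u 1) ^ k ∣
      algebraMap _ _ (ctmul p u J u 1) * z - ratPolyMap (ctMap p u f hJ) h1 h2 h3 z' := by
  obtain ⟨w₀, hw₀⟩ := exists_dvd_sub_tensorToCTRat u hd hp k z
  obtain ⟨l, a, q, rfl⟩ := exists_eq_sum_tmul w₀
  obtain ⟨N, hN⟩ := hp
  -- As `u` divides `p ^ N` and `t ^ e`, errors in `(p ^ (N * k), t ^ (e * k))` vanish modulo `u ^
  -- k`.
  obtain ⟨κ, _, σ, w, a', ha', hb, hw⟩ := htr (N * k) (e * k) a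
  choose b hb using hb
  set U := algebraMap (CTensor p u J) (CTRat p u J t s) (ctmul p u J u 1) with hU
  let ρ : A →+* CTRat p u J t s := (algebraMap _ _).comp (ctRight p u J)
  have hρp : U ∣ ρ p ^ N := by
    obtain ⟨r, hr⟩ := hN
    have h4 := congrArg (fun r => algebraMap (CTensor p u J) (CTRat p u J t s) (ctLeft p u J r)) hr
    simp only [map_pow, map_natCast, map_mul] at h4
    rw [map_natCast, h4]
    exact dvd_mul_right _ _
  have hρt : U ∣ ρ t ^ e := by
    refine ⟨alphaDivU _ _ _, ?_⟩
    rw [u_mul_alphaDivU, ← map_pow, ← hd.eq_pow]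
    rfl
  have hρy : uDivBeta _ _ _ * ρ t = U := by
    rw [mul_comm]
    exact beta_mul_uDivBeta _ _ _
  have hP : U ^ k ∣ ρ ((p : A) ^ (N * k)) := by
    rw [map_pow, pow_mul]; exact pow_dvd_pow_of_dvd hρp k
  have hT : U ^ k ∣ ρ (t ^ (e * k)) := by
    rw [map_pow, pow_mul]; exact pow_dvd_pow_of_dvd hρt k
  have ha2 : ∀ i, U ^ k ∣ ρ (a i) - ρ (a' i) := fun i => by
    obtain ⟨x, y, hxy⟩ := Ideal.mem_span_pair.1 (ha' i)
    rw [← map_sub, ← hxy, map_add, map_mul, map_mul]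
    exact dvd_add (hP.mul_left _) (hT.mul_left _)
  have ha3 : U ^ k ∣ z - ∑ i, ρ (a' i) * polyRatToCTRat u hd (q i) := by
    have h4 : z - ∑ i, ρ (a' i) * polyRatToCTRat u hd (q i) =
        (z - tensorToCTRat u hd (∑ i, a i ⊗ₜ q i)) +
          ∑ i, (ρ (a i) - ρ (a' i)) * polyRatToCTRat u hd (q i) := by
      rw [map_sum]
      simp only [tensorToCTRat_tmul, sub_mul, Finset.sum_sub_distrib]
      have : ∀ i, algebraMap (CTensor p u J) (CTRat p u J t s) (ctmul p u J 1 (a i)) = ρ (a i) :=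
        fun i => rfl
      simp only [this]
      ring
    rw [h4]
    exact dvd_add hw₀ (Finset.dvd_sum fun i _ => (ha2 i).mul_right _)
  have h5 := dvd_trace_sub (V := (p : A) ^ (N * k)) (t := t) (w := w) (z := z) ρ
    (fun c => (γ (σ c) : A →+* A))
    (fun c => ratPolyMap (ctMap p u (γ (σ c)) (hγJ _)) (hγ1 _) (hγ2 _) (hγ3 _))
    (fun i => polyRatToCTRat u hd (q i)) a'
    (fun c => by
      rw [map_pow]
      exact congrArg (· ^ k) ((ratPolyMap_algebraMap _ _ _ _ _).trans (congrArg _ (hγ1 _))))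
    (fun c i => ratPolyMap_polyRatToCTRat u _ _ _ _ _ hd hd (q i))
    (fun c x => ratPolyMap_ctMap_ctmul u _ _ _ _ _ x) (fun c => hz _) ha3 hP hw
  let ρ' : A' →+* CTRat p u J' t' s' := (algebraMap _ _).comp (ctRight p u J')
  -- The trace computation descends `t * z`; the factor `u / t` turns it into `u * z`.
  refine ⟨uDivBeta _ _ _ * ∑ i, ρ' (b i) * polyRatToCTRat u hd' (q i), ?_⟩
  have h6 : ratPolyMap (ctMap p u f hJ) h1 h2 h3
      (uDivBeta _ _ _ * ∑ i, ρ' (b i) * polyRatToCTRat u hd' (q i)) =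
      uDivBeta _ _ _ * ∑ i, ρ (∑ c, γ (σ c) (w * a' i)) * polyRatToCTRat u hd (q i) := by
    rw [map_mul, ratPolyMap_uDivBeta, map_sum]
    congr 1
    refine Finset.sum_congr rfl fun i _ => ?_
    rw [map_mul, ratPolyMap_polyRatToCTRat u f hJ h1 h2 h3 hd' hd, ← hb]
    congr 1
    exact ratPolyMap_ctMap_ctmul u f hJ h1 h2 h3 (b i)
  have h7 := h5.mul_left (uDivBeta _ _ _)
  rw [mul_sub, ← mul_assoc, hρy] at h7
  rw [h6]
  exact h7

end trace

/-! ## Invariants and completion -/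

section adicMap

variable {S S' : Type*} [CommRing S] [CommRing S'] {I : Ideal S} {I' : Ideal S'}

theorem evalₐ_adicMap (f : S' →+* S) (h : I'.map f ≤ I) {n : ℕ} {x : AdicCompletion I' S'}
    {s : S'} (hs : AdicCompletion.evalₐ I' n x = Ideal.Quotient.mk _ s) :
    AdicCompletion.evalₐ I n (adicMap f h x) = Ideal.Quotient.mk _ (f s) := by
  rw [adicMap, AdicCompletion.evalₐ_liftRingHom _ _ (adicMap_compat f h), RingHom.comp_apply,
    RingHom.coe_coe, hs]
  rfl

theorem adicMap_adicMap_of_comp_eq (f : S' →+* S) (h : I'.map f ≤ I) (γ : S →+* S)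
    (hγ : I.map γ ≤ I) (hf : γ.comp f = f) (x : AdicCompletion I' S') :
    adicMap γ hγ (adicMap f h x) = adicMap f h x := by
  refine AdicCompletion.ext_evalₐ fun n => ?_
  obtain ⟨s, hs, -⟩ := exists_evalₐ_eq I' n x
  rw [evalₐ_adicMap γ hγ (evalₐ_adicMap f h hs), evalₐ_adicMap f h hs]
  exact congrArg _ (RingHom.congr_fun hf s)

variable {u : S} {u' : S'}

theorem pow_dvd_sub_of_adicMap_eq (γ : S →+* S) (hγ : (Ideal.span {u}).map γ ≤ Ideal.span {u})
    {x : AdicCompletion (Ideal.span {u}) S} (hx : adicMap γ hγ x = x) {k : ℕ} {z : S}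
    (hz : AdicCompletion.evalₐ (Ideal.span {u}) k x = Ideal.Quotient.mk _ z) :
    u ^ k ∣ γ z - z := by
  rw [← evalₐ_algebraMap_eq_zero_iff, map_sub, map_sub, evalₐ_algebraMap, evalₐ_algebraMap,
    ← hz, ← evalₐ_adicMap γ hγ hz, hx, sub_self]

theorem evalₐ_algebraMap_mul_eq {x : AdicCompletion (Ideal.span {u}) S} {k : ℕ} {v y z : S}
    (hz : AdicCompletion.evalₐ (Ideal.span {u}) k x = Ideal.Quotient.mk _ z)
    (h : u ^ k ∣ v * z - y) :
    AdicCompletion.evalₐ (Ideal.span {u}) k (algebraMap S _ v * x) = Ideal.Quotient.mk _ y := by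
  rw [← evalₐ_algebraMap_eq_zero_iff, map_sub, map_sub, sub_eq_zero, evalₐ_algebraMap,
    evalₐ_algebraMap] at h
  rw [map_mul, hz, evalₐ_algebraMap, ← h, map_mul]

variable (f : S' →+* S) (h : (Ideal.span {u'}).map f ≤ Ideal.span {u})
  (hf : ∀ (k : ℕ) (z : S'), u ^ k ∣ f z → u' ^ k ∣ z)

include hf

theorem adicMap_injective : Function.Injective (adicMap f h) := by
  refine (injective_iff_map_eq_zero _).2 fun x hx => AdicCompletion.ext_evalₐ fun n => ?_
  obtain ⟨s, hs, -⟩ := exists_evalₐ_eq (Ideal.span {u'}) n x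
  have h1 := evalₐ_adicMap f h hs
  rw [hx, map_zero, ← evalₐ_algebraMap, eq_comm, evalₐ_algebraMap_eq_zero_iff] at h1
  rw [hs, map_zero, ← evalₐ_algebraMap, evalₐ_algebraMap_eq_zero_iff]
  exact hf n s h1

/-- By `hf`, preimages of successive approximations of `y` agree modulo `u' ^ k`, so they converge
in the completion of `S'`. -/
theorem exists_adicMap_eq {y : AdicCompletion (Ideal.span {u}) S}
    (hy : ∀ k, ∃ z, AdicCompletion.evalₐ (Ideal.span {u}) k y = Ideal.Quotient.mk _ (f z)) :
    ∃ x, adicMap f h x = y := by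
  choose z hz using hy
  have hz' : ∀ k, z k ≡ z (k + 1) [SMOD (Ideal.span {u'} ^ k • ⊤ : Submodule S' S')] := fun k => by
    rw [SModEq.sub_mem, smul_eq_mul, Ideal.mul_top, Ideal.span_singleton_pow,
      Ideal.mem_span_singleton]
    refine hf k _ ?_
    have h1 : AdicCompletion.evalₐ (Ideal.span {u}) k (algebraMap S _ (f (z (k + 1))) - y) = 0 :=
      evalₐ_eq_zero_of_le (Nat.le_succ k) (by rw [map_sub, evalₐ_algebraMap, hz, sub_self])
    rw [← evalₐ_algebraMap_eq_zero_iff, map_sub, map_sub, map_sub, evalₐ_algebraMap, ← hz k,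
      sub_eq_zero]
    rw [map_sub, sub_eq_zero] at h1
    exact h1.symm
  let c : AdicCompletion.AdicCauchySequence (Ideal.span {u'}) S' :=
    AdicCompletion.AdicCauchySequence.mk (Ideal.span {u'}) S' z hz'
  refine ⟨AdicCompletion.mk _ _ c, AdicCompletion.ext_evalₐ fun n => ?_⟩
  rw [hz n]
  exact evalₐ_adicMap f h (AdicCompletion.evalₐ_mk (I := Ideal.span {u'}) n c)

end adicMap

/-! ### Invariants after inverting `U` -/

section away

variable {P P' : Type*} [CommRing P] [CommRing P'] {U : P} {U' : P'}

theorem away_algebraMap_injective (hU : ∀ x : P, U * x = 0 → x = 0) :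
    Function.Injective (algebraMap P (Localization.Away U)) := by
  refine IsLocalization.injective _ (M := Submonoid.powers U) ?_
  rw [Submonoid.powers_le, mem_nonZeroDivisors_iff_right]
  exact fun x hx => hU x (by rwa [mul_comm])

variable (g : P' →+* P) (hg : g U' = U)
  (hle : Submonoid.powers U' ≤ (Submonoid.powers U).comap g) (hU : ∀ x : P, U * x = 0 → x = 0)

include hU in
theorem away_map_injective (hinj : Function.Injective g) :
    Function.Injective (IsLocalization.map (M := Submonoid.powers U') (T := Submonoid.powers U)
      (S := Localization.Away U') (Localization.Away U) g hle) := by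
  refine (injective_iff_map_eq_zero _).2 fun x hx => ?_
  obtain ⟨n, a, ha⟩ := IsLocalization.Away.surj U' x
  have h1 := congrArg (IsLocalization.map (M := Submonoid.powers U') (T := Submonoid.powers U)
      (S := Localization.Away U') (Localization.Away U) g hle) ha
  rw [map_mul, hx, zero_mul, IsLocalization.map_eq] at h1
  have h2 : a = 0 := hinj (away_algebraMap_injective hU (by rw [← h1, map_zero, map_zero]))
  rw [h2, map_zero] at ha
  exact ((IsLocalization.Away.algebraMap_isUnit U').pow n).mul_left_eq_zero.1 ha

include hg hU in
theorem away_map_range {ι : Type*} (γ : ι → P →+* P) (hγ : ∀ i, γ i U = U)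
    (hγle : ∀ i, Submonoid.powers U ≤ (Submonoid.powers U).comap (γ i))
    (h1 : ∀ i x, γ i (g x) = g x) (h2 : ∀ x, (∀ i, γ i x = x) → ∃ y, g y = U * x) :
    (IsLocalization.map (M := Submonoid.powers U') (T := Submonoid.powers U)
      (S := Localization.Away U') (Localization.Away U) g hle).range =
    ⨅ i, (IsLocalization.map (M := Submonoid.powers U) (T := Submonoid.powers U)
      (S := Localization.Away U) (Localization.Away U) (γ i) (hγle i)).eqLocus (RingHom.id _) := by
  refine le_antisymm (le_iInf fun i => ?_) fun x hx => ?_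
  · rintro _ ⟨y, rfl⟩
    have : (IsLocalization.map (M := Submonoid.powers U) (T := Submonoid.powers U)
        (S := Localization.Away U) (Localization.Away U) (γ i) (hγle i)).comp
        (IsLocalization.map (M := Submonoid.powers U') (T := Submonoid.powers U)
        (S := Localization.Away U') (Localization.Away U) g hle) =
        IsLocalization.map (M := Submonoid.powers U') (T := Submonoid.powers U)
        (S := Localization.Away U') (Localization.Away U) g hle := by
      refine IsLocalization.ringHom_ext (Submonoid.powers U') (RingHom.ext fun z => ?_)
      simp only [RingHom.comp_apply, IsLocalization.map_eq, h1]
    exact RingHom.congr_fun this y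
  · rw [Subring.mem_iInf] at hx
    obtain ⟨n, a, ha⟩ := IsLocalization.Away.surj U x
    obtain ⟨b, hb⟩ := h2 a fun i => by
      refine away_algebraMap_injective hU ?_
      have h3 := congrArg (IsLocalization.map (M := Submonoid.powers U) (T := Submonoid.powers U)
        (S := Localization.Away U) (Localization.Away U) (γ i) (hγle i)) ha
      rw [map_mul, map_pow, IsLocalization.map_eq, IsLocalization.map_eq, hγ] at h3
      rw [← h3, ← ha]
      exact congrArg (· * _) (hx i)
    -- The exponent is `n` for the denominator of `x`, plus one for the factor `U` lost in `h2`.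
    refine ⟨algebraMap _ _ b * IsLocalization.Away.invSelf U' ^ (n + 1), ?_⟩
    refine ((IsLocalization.Away.algebraMap_isUnit (S := Localization.Away U) U).pow
      (n + 1)).mul_right_cancel ?_
    have h4 : (IsLocalization.map (M := Submonoid.powers U') (T := Submonoid.powers U)
      (S := Localization.Away U') (Localization.Away U) g hle) (algebraMap _ _ U') =
      algebraMap _ _ U := by rw [IsLocalization.map_eq, hg]
    rw [← h4, ← map_pow, ← map_mul, mul_assoc, ← mul_pow, mul_comm (IsLocalization.Away.invSelf U'),
      IsLocalization.Away.mul_invSelf, one_pow, mul_one, map_pow, h4, IsLocalization.map_eq, hb,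
      map_mul,
      ← ha]
    ring

end away

/-! ### Passage from `B[u/β, α/u]` to `B⟨u/β, α/u⟩[1/u]` -/

section ratLoc

variable {B B' : Type*} [CommRing B] [CommRing B'] {u α β : B} {u' α' β' : B'}

theorem ratPolyMap_comp_eq (g : B' →+* B) (hu : g u' = u) (hα : g α' = α) (hβ : g β' = β)
    (γ : B →+* B) (hγu : γ u = u) (hγα : γ α = α) (hγβ : γ β = β) (h : γ.comp g = g) :
    (ratPolyMap γ hγu hγα hγβ).comp (ratPolyMap g hu hα hβ) = ratPolyMap g hu hα hβ := by
  have key : ∀ b, (ratPolyMap γ hγu hγα hγβ).comp (ratPolyMap g hu hα hβ) (algebraMap B' _ b) =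
      algebraMap B _ (g b) := fun b => by
    rw [RingHom.comp_apply, ratPolyMap_algebraMap, ratPolyMap_algebraMap]
    exact congrArg _ (RingHom.congr_fun h b)
  refine ratPoly_hom_ext (fun b => ?_) (fun d hd => ?_) (fun d hd => ?_)
  · rw [key, ratPolyMap_algebraMap]
  · rw [key, hu] at hd
    exact ratPoly_mul_eq_zero _ _ _ hd
  · rw [key, hβ] at hd
    exact ratPoly_mul_eq_zero' _ _ _ hd

/-- Invariants of `B⟨u / β, α / u⟩[1 / u]`, from invariants of `B[u / β, α / u]` modulo powers
of `u`. -/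
theorem ratLocMap_injective_and_range (g : B' →+* B) (hu : g u' = u) (hα : g α' = α)
    (hβ : g β' = β) {ι : Type*} (γ : ι → B →+* B) (hγu : ∀ i, γ i u = u) (hγα : ∀ i, γ i α = α)
    (hγβ : ∀ i, γ i β = β) (hcomp : ∀ i, (γ i).comp g = g)
    (hdvd : ∀ (k : ℕ) (z : ratPoly u' α' β'), algebraMap B _ u ^ k ∣ ratPolyMap g hu hα hβ z →
      algebraMap B' _ u' ^ k ∣ z)
    (happrox : ∀ (k : ℕ) (z : ratPoly u α β),
      (∀ i, algebraMap B _ u ^ k ∣ ratPolyMap (γ i) (hγu i) (hγα i) (hγβ i) z - z) →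
      ∃ z', algebraMap B _ u ^ k ∣ algebraMap B _ u * z - ratPolyMap g hu hα hβ z') :
    Function.Injective (ratLocMap g hu hα hβ) ∧ (ratLocMap g hu hα hβ).range =
      ⨅ i, (ratLocMap (γ i) (hγu i) (hγα i) (hγβ i)).eqLocus (RingHom.id _) := by
  have hreg : ∀ x : RatInt u α β,
      algebraMap (ratPoly u α β) (RatInt u α β) (algebraMap B (ratPoly u α β) u) * x = 0 →
      x = 0 := fun x hx =>
    algebraMap_mul_eq_zero (fun s hs => ratPoly_mul_eq_zero u α β hs) hx
  have hgU : ratIntMap g hu hα hβ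
      (algebraMap (ratPoly u' α' β') (RatInt u' α' β') (algebraMap B' _ u')) =
      algebraMap (ratPoly u α β) (RatInt u α β) (algebraMap B _ u) := by
    rw [ratIntMap, adicMap_algebraMap, ratPolyMap_algebraMap, hu]
  refine ⟨away_map_injective _ _ hreg (adicMap_injective _ _ hdvd), ?_⟩
  refine away_map_range _ hgU _ hreg (fun i => ratIntMap (γ i) (hγu i) (hγα i) (hγβ i))
    (fun i => ?_) _ (fun i x => ?_) fun x hx => ?_
  · rw [ratIntMap, adicMap_algebraMap, ratPolyMap_algebraMap, hγu]
  · exact adicMap_adicMap_of_comp_eq _ _ _ _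
      (ratPolyMap_comp_eq g hu hα hβ (γ i) (hγu i) (hγα i) (hγβ i) (hcomp i)) x
  · refine exists_adicMap_eq _ _ hdvd fun k => ?_
    obtain ⟨z, hz, -⟩ := exists_evalₐ_eq _ k x
    obtain ⟨z', hz'⟩ := happrox k z fun i => pow_dvd_sub_of_adicMap_eq _ _ (hx i) hz
    exact ⟨z', evalₐ_algebraMap_mul_eq hz hz'⟩

theorem ctMap_comp_eq {p : ℕ} [Fact p.Prime] {R₀ A A' : Type*} [CommRing R₀] [Algebra ℤ_[p] R₀]
    [CommRing A] [Algebra ℤ_[p] A] [CommRing A'] [Algebra ℤ_[p] A'] (u : R₀) {J : Ideal A}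
    {J' : Ideal A'} (f : A' →ₐ[ℤ_[p]] A) (hJ : J'.map f ≤ J) (γ : A →ₐ[ℤ_[p]] A)
    (hγ : J.map γ ≤ J) (h : γ.comp f = f) :
    (ctMap p u γ hγ).comp (ctMap p u f hJ) = ctMap p u f hJ := by
  refine RingHom.ext fun x => adicMap_adicMap_of_comp_eq _ (tensorIdeal_map p u f hJ) _
    (tensorIdeal_map p u γ hγ) (RingHom.ext fun y => ?_) x
  have : (Algebra.TensorProduct.map (AlgHom.id ℤ_[p] R₀) γ).comp
      (Algebra.TensorProduct.map (AlgHom.id ℤ_[p] R₀) f) =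
      Algebra.TensorProduct.map (AlgHom.id ℤ_[p] R₀) f := by
    rw [← Algebra.TensorProduct.map_comp, h, AlgHom.comp_id]
  exact DFunLike.congr_fun this y

end ratLoc

/-! ### Application to `A_inf` and `A_inf^{H_K}` -/

section instantiate

variable {p : ℕ} [Fact p.Prime] (ε : RootSystem p) (K : IntermediateField ℚ_[p] (PadicAlgCl p))

theorem teich_add (n : ℤ) (k : ℕ) : ε.teich (n + k) = ε.teich n ^ p ^ k := by
  rw [teich_eq, teich_eq, piBar_add, map_pow]

theorem teichHK_add (n : ℤ) (k : ℕ) : ε.teichHK K (n + k) = ε.teichHK K n ^ p ^ k :=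
  Subtype.ext (teich_add ε n k)

theorem span_le_radical_of_add {A : Type*} [CommRing A] (x : ℤ → A)
    (hx : ∀ (n : ℤ) (k : ℕ), x (n + k) = x n ^ p ^ k) (n : ℤ) :
    Ideal.span {(p : A), x 0} ≤ (Ideal.span {(p : A), x n}).radical := by
  rw [Ideal.span_le]
  rintro y (rfl | rfl)
  · exact Ideal.le_radical (Ideal.subset_span (Set.mem_insert _ _))
  -- One formula for both signs of `n`: `x 0 ^ p ^ n.toNat = x n ^ p ^ (-n).toNat`, where one of the
  -- two `toNat` is zero.
  · refine ⟨p ^ n.toNat, ?_⟩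
    have h1 : (0 : ℤ) + n.toNat = n + (-n).toNat := by omega
    have h2 : x n ∈ Ideal.span {(p : A), x n} := Ideal.subset_span (Set.mem_insert_of_mem _ rfl)
    have h3 : x 0 ^ p ^ n.toNat = x n ^ p ^ (-n).toNat := by rw [← hx, h1, hx]
    rw [h3]
    exact Ideal.pow_mem_of_mem _ h2 _ (pow_pos (Fact.out : p.Prime).pos _)

theorem isTensorDatum_of_add {A : Type*} [CommRing A] [Algebra ℤ_[p] A] (x : ℤ → A)
    (hx : ∀ (n : ℤ) (k : ℕ), x (n + k) = x n ^ p ^ k) {m n : ℤ} (hnm : n ≤ m) :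
    letI : Algebra ℤ_[p][X] A := (aeval (R := ℤ_[p]) (x n)).toAlgebra
    IsTensorDatum (p := p) (p ^ (m - n).toNat) (Ideal.span {(p : A), x 0}) (x n) (x m) :=
  letI : Algebra ℤ_[p][X] A := (aeval (R := ℤ_[p]) (x n)).toAlgebra
  { algebraMap_X := aeval_X _
    algebraMap_C := fun c => aeval_C _ c
    eq_pow := by
      rw [← hx, Int.toNat_of_nonneg (by omega)]
      congr 1
      ring
    fg := Submodule.fg_span (Set.toFinite _)
    le_radical := span_le_radical_of_add x hx n }

theorem p_ne_zero_aInf : (p : AInf p) ≠ 0 := WittVector.p_nonzero p (OFlat p)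

theorem p_dvd_of_teich_mul_eq (n : ℤ) {x y : AInf p} (h : ε.teich n * x = p * y) :
    ∃ z, x = p * z := by
  have h1 : (p : AInf p) ∣ ε.teich n * x := ⟨y, h⟩
  rw [p_dvd_iff_coeffZero, map_mul, teich_eq, coeffZero_teichAInf] at h1
  exact p_dvd_iff_coeffZero.2 ((mul_eq_zero.1 h1).resolve_left (piBar_ne_zero ε n))

theorem mem_AInfHK_iff {x : AInf p} : x ∈ AInfHK p K ↔ ∀ σ : HK p K, σ • x = x :=
  mem_AInfHK.trans ⟨fun h σ => h σ σ.2, fun h σ hσ => h ⟨σ, hσ⟩⟩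

/-- If `x = a * p + b * [π̄] ^ (p ^ n)` is invariant, so is `b` modulo `p`, because `π̄` is a
nonzerodivisor in the tilt. Replace `b` by the Teichmüller lift of its reduction; the remaining
multiple of `p` has an invariant cofactor, as `A_inf` has no `p`-torsion. -/
theorem mem_span_of_coe_mem_span (n : ℤ) {x : AInfHK p K}
    (hx : (x : AInf p) ∈ Ideal.span {(p : AInf p), ε.teich n}) :
    x ∈ Ideal.span {(p : AInfHK p K), ε.teichHK K n} := by
  have := isDomain_aInf (p := p)
  obtain ⟨a, b, hab⟩ := Ideal.mem_span_pair.1 hx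
  have hxinv := (mem_AInfHK_iff K).1 x.2
  have h1 : coeffZero p x = coeffZero p b * ε.piBar n := by
    rw [← hab, map_add, map_mul, map_mul, p_dvd_iff_coeffZero.1 dvd_rfl, mul_zero, zero_add,
      teich_eq, coeffZero_teichAInf]
  have hb : ∀ σ : HK p K, σ • coeffZero p b = coeffZero p b := fun σ => by
    refine mul_right_cancel₀ (piBar_ne_zero ε n) ?_
    rw [← h1, ← hxinv σ, smul_coeffZero, h1, smul_mul', smul_piBar]
  obtain ⟨c, hc⟩ : (p : AInf p) ∣ x - ε.teich n * teichAInf p (coeffZero p b) := by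
    rw [p_dvd_iff_coeffZero, map_sub, map_mul, teich_eq, coeffZero_teichAInf, coeffZero_teichAInf,
      h1, mul_comm, sub_self]
  have hb' : teichAInf p (coeffZero p b) ∈ AInfHK p K := (mem_AInfHK_iff K).2 fun σ => by
    rw [smul_teichAInf, hb]
  have hc' : c ∈ AInfHK p K := (mem_AInfHK_iff K).2 fun σ => by
    refine mul_left_cancel₀ p_ne_zero_aInf ?_
    have h2 := congrArg (σ • ·) hc
    simp only [smul_sub, smul_mul', hxinv, smul_teich, smul_teichAInf, hb] at h2
    rw [hc] at h2
    rw [h2]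
    congr 1
    exact (map_natCast (galAInf p (σ : PadicAlgCl p ≃ₐ[ℚ_[p]] PadicAlgCl p)) p).symm
  refine Ideal.mem_span_pair.2 ⟨⟨c, hc'⟩, ⟨_, hb'⟩, Subtype.ext ?_⟩
  change c * (p : AInf p) + teichAInf p (coeffZero p b) * ε.teich n = x
  linear_combination -hc

/-- A power of `p` is divisible by a pseudo-uniformizer in a ring of definition that is formally
of finite type. -/
theorem exists_dvd_p_pow {R : Type*} [CommRing R] [TopologicalSpace R] [IsTopologicalRing R]
    [Algebra ℤ_[p] R] (R₀ : Subalgebra ℤ_[p] R) (hR₀ : IsRingOfDefinition p R₀)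
    (hft : IsFormallyOfFiniteType p R₀) {u : R₀} (hu : IsUnit (u : R)) :
    ∃ N : ℕ, u ∣ (p : R₀) ^ N := by
  obtain ⟨I, -, hI, -, hpI, -⟩ := hft
  obtain ⟨v, hv⟩ := hu.exists_right_inv
  -- Multiplication by `v = u⁻¹` is continuous and `R₀` is open, so `v * p ^ N` lies in `R₀` for
  -- large `N`.
  have hcont : Continuous fun x : R₀ => v * (x : R) := by fun_prop
  have hnhds : (fun x : R₀ => v * (x : R)) ⁻¹' R₀ ∈ nhds (0 : R₀) :=
    (hR₀.1.preimage hcont).mem_nhds (by simp [R₀.zero_mem])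
  have : IsTopologicalRing R₀ := inferInstanceAs (IsTopologicalRing R₀.toSubring)
  obtain ⟨N, hN⟩ := (isAdic_iff.1 hI).2 _ hnhds
  refine ⟨N, ⟨⟨v * (p : R) ^ N, ?_⟩, Subtype.ext ?_⟩⟩
  · simpa using hN (Ideal.pow_mem_pow hpI N)
  · change ((p : R₀) ^ N : R₀).1 = (u : R) * (v * (p : R) ^ N)
    rw [← mul_assoc, hv, one_mul]
    simp

theorem exponent_le {a b : ℚ} (ha : 0 < a) (hab : a ≤ b) {m n : ℤ} (hm : sExp p a = (p : ℚ) ^ m)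
    (hn : sExp p b = (p : ℚ) ^ n) : n ≤ m := by
  have hp : (1 : ℚ) < p := by exact_mod_cast (Fact.out : p.Prime).one_lt
  rw [← zpow_le_zpow_iff_right₀ hp, ← hm, ← hn, sExp, sExp]
  have : (0 : ℚ) < p := by linarith
  gcongr

/-- The variable `X` acts as `ε.teich n` on `A_inf` and as `ε.teichHK K n` on the invariants, with
`e = p ^ (m - n)`. The regular sequence `(p, [π̄] ^ (p ^ n))` and `mem_span_of_coe_mem_span` give
injectivity modulo `u ^ k`, and `exists_approx_trace` gives descent. -/
theorem lambdaIncl_injective_and_range {R₀ : Type*} [CommRing R₀] [Algebra ℤ_[p] R₀] {u : R₀}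
    (hp : ∃ N : ℕ, u ∣ (p : R₀) ^ N) {m n : ℤ} (hnm : n ≤ m) :
    Function.Injective (lambdaIncl ε K u m n) ∧
      (lambdaIncl ε K u m n).range = lambdaInvariants ε K u m n := by
  have := isDomain_aInf (p := p)
  let : Algebra ℤ_[p][X] (AInf p) := (aeval (R := ℤ_[p]) (ε.teich n)).toAlgebra
  let : Algebra ℤ_[p][X] (AInfHK p K) := (aeval (R := ℤ_[p]) (ε.teichHK K n)).toAlgebra
  have hd : IsTensorDatum (p := p) (p ^ (m - n).toNat) ε.ideal (ε.teich n) (ε.teich m) :=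
    isTensorDatum_of_add ε.teich (teich_add ε) hnm
  have hd' : IsTensorDatum (p := p) (p ^ (m - n).toNat) (ε.idealHK K) (ε.teichHK K n)
      (ε.teichHK K m) := isTensorDatum_of_add (ε.teichHK K) (teichHK_add ε K) hnm
  refine ratLocMap_injective_and_range _ _ _ _
    (fun σ : HK p K => ctMap p u (galAInf p σ) (J := ε.ideal) (J' := ε.ideal) _) _ _ _
    (fun σ => ctMap_comp_eq u _ _ _ _ (AlgHom.ext fun x => mem_AInfHK.1 x.2 σ σ.2))
    (fun k z => dvd_of_dvd_ratPolyMap u _ _ _ _ _ hp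
      (fun x hx => (mul_eq_zero.1 hx).resolve_left p_ne_zero_aInf)
      (fun x y => p_dvd_of_teich_mul_eq ε n) hd' hd rfl
      (fun x => mem_span_of_coe_mem_span ε K n))
    (fun k z => exists_dvd_sub_of_trace u _ _ _ _ _ hp hd' hd
      (fun σ : HK p K => galAInf p σ) _ _ _ _ fun N j l a => ?_)
  obtain ⟨κ, hκ, s, w, a', h1, h2, h3⟩ := exists_approx_trace K ε n N j a
  exact ⟨κ, hκ, s, w, a', h1, fun i => ⟨⟨_, h2 i⟩, rfl⟩, h3⟩

end instantiate

end Period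

end

theorem mainTheorem5 (p : ℕ) [Fact p.Prime]
    (K : IntermediateField ℚ_[p] (PadicAlgCl p)) [FiniteDimensional ℚ_[p] K]
    (ε : Period.RootSystem p)
    {R : Type*} [CommRing R] [UniformSpace R] [IsUniformAddGroup R] [IsTopologicalRing R]
    [Algebra ℤ_[p] R] (hR : Period.IsPseudoaffinoid p R)
    (R₀ : Subalgebra ℤ_[p] R) [IsNoetherianRing R₀] (hR₀ : Period.IsRingOfDefinition p R₀)
    (hft : Period.IsFormallyOfFiniteType p R₀)
    (u : R₀) (hu : Period.IsPseudoUniformizer (u : R))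
    (a b : ℚ) (ha : 0 < a) (hab : a ≤ b)
    (m n : ℤ) (hm : Period.sExp p a = (p : ℚ) ^ m) (hn : Period.sExp p b = (p : ℚ) ^ n) :
    Function.Injective (Period.lambdaIncl ε K u m n) ∧
      (Period.lambdaIncl ε K u m n).range = Period.lambdaInvariants ε K u m n :=
  Period.lambdaIncl_injective_and_range ε K (Period.exists_dvd_p_pow R₀ hR₀ hft hu.1)
    (Period.exponent_le ha hab hm hn)
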